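/- **Proposition 3.6.** Let $X$ be a complex manifold (Hausdorff, second countable) with $\dim_{\mathbb C}X=n\ge 2$, equipped with a Hermitian metric, identified with its $C^\infty$ positive definite $(1,1)$-form $\omega$, and let $\eta:X\to\mathbb R$ be a $C^\infty$ function such that at every point $\eta>0$ or $\eta<0$. All forms below are $\mathbb C$-valued. *Notation.* For a nowhere zero real function $\eta$ let $\theta_\eta$ be the operator acting on forms of bidegree $(p,q)$ as multiplication by $\eta^p$, extended by linearity; let $D_\eta=\theta_\eta\,d\,\theta_\eta^{-1}$ and $d_\eta=\eta\,\partial+\bar\partial$. The conjugate $\overline A$ of an operator $A$ is defined by $\overline{Au}=\overline A(\bar u)$; thus $\overline D_{-\eta}$, $\bar d_{-\eta}$ are the conjugates of $D_{-\eta}$, $d_{-\eta}$. A superscript $\star$ is the formal adjoint with respect to the $L^2$ inner product induced by $\omega$ (for operators of order zero: the adjoint with respect to the pointwise inner product). Let $\Lambda=(\omega\wedge\cdot\,)^\star$, let $[A,B]=AB-(-1)^{ab}BA$ be the graded commutator of operators of degrees $a,b$, let $\tau_\eta=[\Lambda,\,D_\eta\omega\wedge\cdot\,]$, with $\overline\tau_{-\eta}$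 the conjugate of $\tau_{-\eta}$, and let $\Delta_\eta=[D_\eta,D_\eta^\star]=D_\eta D_\eta^\star+D_\eta^\star D_\eta$, with $\overline\Delta_{-\eta}$ the conjugate of $\Delta_{-\eta}$. Then the formal adjoints of $D_{\pm\eta}$ and the pointwise adjoints of $\omega\wedge\cdot$, $\tau_\eta$ and $\overline\tau_{-\eta}$ exist, and the following identity holds on the $C^\infty$ forms of every degree on $X$: $$\begin{aligned}\Delta_\eta=\overline\Delta_{-\eta}&+i\,\big[[D_\eta,\overline D_{-\eta}],\Lambda\big]+[\overline D_{-\eta},\overline\tau_{-\eta}^{\,\star}]-[D_\eta,\tau_\eta^\star]\\&+n\,\Big[D_\eta,\tfrac1\eta\,[\,i\,\bar d_{-\eta}\eta\wedge\cdot\,,\Lambda]\Big]+n\,\Big[\overline D_{-\eta},\tfrac1\eta\,[\,i\,d_\eta\eta\wedge\cdot\,,\Lambda]\Big].\end{aligned}$$ -/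

import Mathlib

open scoped ContDiff Manifold

noncomputable section

namespace EtaBKN

/-! ### Linear algebra on one tangent space -/

/-- The model space `ℂⁿ` of an `n`-dimensional complex manifold. Every tangent space
`TangentSpace 𝓘(ℝ, Model n) x` is by definition a copy of it (through the preferred chart at `x`),
and as the charts are holomorphic its complex structure `v ↦ I • v` is that of the manifold. -/
abbrev Model (n : ℕ) : Type := Fin n → ℂ

/-- `Λᵏ T*ₓX ⊗ ℂ`: complex valued, real-multilinear alternating forms of degree `k`. -/
abbrev Alt (n k : ℕ) : Type := Model n [⋀^Fin k]→L[ℝ] ℂ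

/-- The sum over all degrees `k` of `Λᵏ T*ₓX ⊗ ℂ` (which vanishes for `k > 2n`). -/
abbrev Cov (n : ℕ) : Type := (k : ℕ) → Alt n k

/-- The multilinear map `α ⊗ β`, with `α` evaluated on the first `i` and `β` on the last `j` of
`k = i + j` vectors. -/
def tensor {n i j k : ℕ} (h : i + j = k) (α : Alt n i) (β : Alt n j) :
    ContinuousMultilinearMap ℝ (fun _ : Fin k => Model n) ℂ where
  toMultilinearMap := ((LinearMap.mul' ℝ ℂ).compMultilinearMap
    (α.toMultilinearMap.domCoprod β.toMultilinearMap)).domDomCongr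
      (finSumFinEquiv.trans (finCongr h))
  cont := by
    change Continuous fun v : Fin k → Model n =>
      α (fun a => v ((finSumFinEquiv.trans (finCongr h)) (Sum.inl a))) *
      β (fun b => v ((finSumFinEquiv.trans (finCongr h)) (Sum.inr b)))
    fun_prop

open Nat in
/-- Exterior product: `α ∧ β = 1 / (i! j!) ∑_σ sgn(σ) (α ⊗ β) ∘ σ` for `α`, `β` of degrees `i`, `j`,
extended bilinearly. -/
def wedge {n : ℕ} (α β : Cov n) : Cov n := fun k =>
  ∑ i : Fin (k + 1), ((i.1 ! : ℂ) * ((k - i.1)! : ℂ))⁻¹ •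
    ContinuousMultilinearMap.alternatization
      (tensor (show i.1 + (k - i.1) = k by omega) (α i.1) (β (k - i.1)))

/-- Complex conjugation of forms. -/
def conjCov {n : ℕ} (α : Cov n) : Cov n := fun k =>
  (Complex.conjCLE : ℂ →L[ℝ] ℂ).compContinuousAlternatingMap (α k)


/-- The vectors `v` with `v a` replaced by `I • v a` for every slot `a ∈ T`. -/
def rotate {n k : ℕ} (T : Finset (Fin k)) (v : Fin k → Model n) : Fin k → Model n :=
  fun a => if a ∈ T then Complex.I • v a else v a

/-- Coefficients of the expansion of the slotwise projections
`v ↦ v' = (v - i Jv) / 2` (for the slots `a ∈ S`) and `v ↦ v'' = (v + i Jv) / 2` (for `a ∉ S`). -/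
def slotCoeff {k : ℕ} (S T : Finset (Fin k)) : ℂ :=
  ∏ a : Fin k, if a ∈ T then (if a ∈ S then -Complex.I / 2 else Complex.I / 2) else 1 / 2

/-- The value of the complex multilinear extension of `α` at the vectors `w a`, where `w a` is the
`(1,0)`-part `(v a - i J(v a)) / 2` of `v a` for `a ∈ S`, and the `(0,1)`-part
`(v a + i J(v a)) / 2` for `a ∉ S`, expanded by multilinearity (`J v = I • v`). -/
def slotPart {n k : ℕ} (α : Alt n k) (S : Finset (Fin k)) (v : Fin k → Model n) : ℂ :=
  ∑ T : Finset (Fin k), slotCoeff S T * α (rotate T v)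

theorem slotPart_swap {n k : ℕ} (α : Alt n k) (S : Finset (Fin k)) (v : Fin k → Model n)
    (i j : Fin k) (hv : v i = v j) (hij : i ≠ j) :
    slotPart α (S.map (Equiv.swap i j).toEmbedding) v = - slotPart α S v := by
  have hvs : ∀ a, v (Equiv.swap i j a) = v a := by
    intro a
    rcases eq_or_ne a i with rfl | h1
    · simp [hv]
    rcases eq_or_ne a j with rfl | h2
    · simp [hv]
    · rw [Equiv.swap_apply_of_ne_of_ne h1 h2]
  have hmem : ∀ (T : Finset (Fin k)) a, a ∈ T.map (Equiv.swap i j).toEmbedding ↔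
      Equiv.swap i j a ∈ T := by
    intro T a
    rw [Finset.mem_map_equiv, Equiv.symm_swap]
  unfold slotPart
  rw [← Finset.sum_neg_distrib]
  refine (Fintype.sum_equiv (Equiv.finsetCongr (Equiv.swap i j)) _ _ fun T => ?_).symm
  have h1 : rotate (T.map (Equiv.swap i j).toEmbedding) v = rotate T v ∘ Equiv.swap i j := by
    funext a
    simp only [rotate, hmem, Function.comp_apply, hvs]
  have h2 : slotCoeff (S.map (Equiv.swap i j).toEmbedding) (T.map (Equiv.swap i j).toEmbedding) =
      slotCoeff S T := by
    unfold slotCoeff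
    refine Fintype.prod_equiv (Equiv.swap i j) _ _ fun a => ?_
    simp only [hmem]
  rw [Equiv.finsetCongr_apply, h1, h2]
  have h3 : α (rotate T v ∘ Equiv.swap i j) = - α (rotate T v) :=
    α.toAlternatingMap.map_swap (rotate T v) hij
  rw [h3]
  ring

theorem rotate_update {n k : ℕ} (T : Finset (Fin k)) [DecidableEq (Fin k)] (v : Fin k → Model n)
    (a : Fin k) (x : Model n) :
    rotate T (Function.update v a x) =
      Function.update (rotate T v) a (if a ∈ T then Complex.I • x else x) := by
  funext b
  rcases eq_or_ne b a with rfl | h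
  · simp [rotate]
  · simp [rotate, h]

/-- The component of type `(p, k - p)` of a form of degree `k` (zero for `p > k`). -/
def typePart {n k : ℕ} (p : ℕ) (α : Alt n k) : Alt n k where
  toFun v := ∑ S ∈ Finset.powersetCard p (Finset.univ : Finset (Fin k)), slotPart α S v
  map_update_add' := by
    intro _ v a x y
    simp only [slotPart, ← Finset.sum_add_distrib, ← mul_add]
    refine Finset.sum_congr rfl fun S _ => Finset.sum_congr rfl fun T _ => ?_
    have h : (if a ∈ T then Complex.I • (x + y) else x + y) =
        (if a ∈ T then Complex.I • x else x) + (if a ∈ T then Complex.I • y else y) := by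
      split_ifs
      · rw [smul_add]
      · rfl
    rw [rotate_update, rotate_update, rotate_update, h, α.map_update_add]
  map_update_smul' := by
    intro _ v a c x
    simp only [slotPart, Finset.smul_sum, ← mul_smul_comm]
    refine Finset.sum_congr rfl fun S _ => Finset.sum_congr rfl fun T _ => ?_
    have h : (if a ∈ T then Complex.I • (c • x) else c • x) =
        c • (if a ∈ T then Complex.I • x else x) := by
      split_ifs
      · rw [smul_comm]
      · rfl
    rw [rotate_update, rotate_update, h, α.map_update_smul]
  cont := by
    change Continuous fun v : Fin k → Model n => ∑ S ∈ Finset.powersetCard p (Finset.univ : Finset (Fin k)), slotPart α S v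
    unfold slotPart rotate
    refine continuous_finsetSum _ fun S _ => continuous_finsetSum _ fun T _ =>
      continuous_const.mul (α.cont.comp (continuous_pi fun a => ?_))
    split_ifs <;> fun_prop
  map_eq_zero_of_eq' := by
    intro v i j hv hij
    have h : ∑ S ∈ Finset.powersetCard p (Finset.univ : Finset (Fin k)), slotPart α S v =
        ∑ S ∈ Finset.powersetCard p (Finset.univ : Finset (Fin k)), - slotPart α S v := by
      refine Finset.sum_equiv (Equiv.finsetCongr (Equiv.swap i j)) ?_ ?_
      · intro S
        simp [Finset.mem_powersetCard]
      · intro S _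
        rw [Equiv.finsetCongr_apply, slotPart_swap α S v i j hv hij, neg_neg]
    rw [Finset.sum_neg_distrib] at h
    exact self_eq_neg.mp h


/-- The operator multiplying the component of type `(p, q)` by `c ^ p`. -/
def thetaCov {n : ℕ} (c : ℝ) (α : Cov n) : Cov n := fun k =>
  ∑ p ∈ Finset.range (k + 1), ((c : ℂ) ^ p) • typePart p (α k)

theorem sum_slotPart {n k : ℕ} (α : Alt n k) (v : Fin k → Model n) :
    ∑ S : Finset (Fin k), slotPart α S v = α v := by
  have key : ∀ T : Finset (Fin k), ∑ S : Finset (Fin k), slotCoeff S T = if T = ∅ then 1 else 0 := by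
    intro T
    have h := Finset.prod_add (fun a : Fin k => if a ∈ T then -Complex.I / 2 else 1 / 2)
      (fun a : Fin k => if a ∈ T then Complex.I / 2 else 1 / 2) Finset.univ
    rw [Finset.powerset_univ] at h
    have h2 : ∀ S : Finset (Fin k), slotCoeff S T =
        (∏ a ∈ S, (if a ∈ T then -Complex.I / 2 else 1 / 2)) *
        ∏ a ∈ Finset.univ \ S, (if a ∈ T then Complex.I / 2 else 1 / 2) := by
      intro S
      rw [slotCoeff, ← Finset.prod_sdiff (Finset.subset_univ S), mul_comm]
      congr 1
      · exact Finset.prod_congr rfl fun a ha => by simp [ha]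
      · refine Finset.prod_congr rfl fun a ha => ?_
        have : a ∉ S := (Finset.mem_sdiff.mp ha).2
        simp [this]
    rw [Finset.sum_congr rfl fun S _ => h2 S, ← h]
    split_ifs with hT
    · subst hT
      exact Finset.prod_eq_one fun a _ => by norm_num
    · obtain ⟨a, ha⟩ := Finset.nonempty_iff_ne_empty.mpr hT
      exact Finset.prod_eq_zero (Finset.mem_univ a) (by simp [ha]; ring)
  unfold slotPart
  rw [Finset.sum_comm]
  simp_rw [← Finset.sum_mul, key]
  rw [Finset.sum_eq_single ∅]
  · rw [if_pos rfl, one_mul]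
    have h0 : rotate ∅ v = v := by funext a; simp [rotate]
    rw [h0]
  · intro T _ hT
    simp [hT]
  · simp

theorem thetaCov_apply {n : ℕ} (c : ℝ) (α : Cov n) (k : ℕ) (v : Fin k → Model n) :
    thetaCov c α k v = ∑ S : Finset (Fin k), (c : ℂ) ^ S.card * slotPart (α k) S v := by
  have h1 : thetaCov c α k v = ∑ p ∈ Finset.range (k + 1), (c : ℂ) ^ p *
      ∑ S ∈ Finset.powersetCard p (Finset.univ : Finset (Fin k)), slotPart (α k) S v := by
    simp only [thetaCov, ContinuousAlternatingMap.sum_apply, ContinuousAlternatingMap.smul_apply]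
    rfl
  rw [h1, ← Finset.powerset_univ, Finset.sum_powerset]
  simp only [Finset.card_univ, Fintype.card_fin]
  refine Finset.sum_congr rfl fun p _ => ?_
  rw [Finset.mul_sum]
  exact Finset.sum_congr rfl fun S hS => by rw [(Finset.mem_powersetCard.mp hS).2]

/-- Rotating one slot multiplies the `S`-part by `±i`. -/
theorem slotPart_update {n k : ℕ} (α : Alt n k) (S : Finset (Fin k)) (v : Fin k → Model n)
    (a : Fin k) :
    slotPart α S (Function.update v a (Complex.I • v a)) =
      (if a ∈ S then Complex.I else -Complex.I) * slotPart α S v := by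
  unfold slotPart
  rw [Finset.mul_sum]
  have hc : ∀ T : Finset (Fin k), slotCoeff S T =
      (if a ∈ T then (if a ∈ S then -Complex.I / 2 else Complex.I / 2) else 1 / 2) *
      ∏ b ∈ Finset.univ.erase a,
        (if b ∈ T then (if b ∈ S then -Complex.I / 2 else Complex.I / 2) else 1 / 2) := by
    intro T
    rw [slotCoeff]
    exact (Finset.mul_prod_erase _ _ (Finset.mem_univ a)).symm
  refine Fintype.sum_equiv (Equiv.ofBijective (fun T => symmDiff T {a}) ?_) _ _ fun T => ?_
  · exact Function.Involutive.bijective fun T => by simp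
  · have hmem : ∀ b, b ∈ symmDiff T {a} ↔ (b ∈ T ∧ b ≠ a ∨ b = a ∧ b ∉ T) := by
      intro b; simp [Finset.mem_symmDiff]
    have hprod : ∏ b ∈ Finset.univ.erase a, (if b ∈ symmDiff T {a} then
          (if b ∈ S then -Complex.I / 2 else Complex.I / 2) else (1 / 2 : ℂ)) =
        ∏ b ∈ Finset.univ.erase a, (if b ∈ T then
          (if b ∈ S then -Complex.I / 2 else Complex.I / 2) else 1 / 2) := by
      refine Finset.prod_congr rfl fun b hb => ?_
      have : b ≠ a := Finset.ne_of_mem_erase hb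
      simp [hmem, this]
    rw [Equiv.ofBijective_apply, hc T, hc (symmDiff T {a}), hprod, rotate_update]
    have hself : ∀ U : Finset (Fin k), Function.update (rotate U v) a (rotate U v a) = rotate U v :=
      fun U => Function.update_eq_self _ _
    have hoff : ∀ x : Model n, Function.update (rotate T v) a x =
        Function.update (rotate (symmDiff T {a}) v) a x := by
      intro x
      funext b
      rcases eq_or_ne b a with rfl | hb
      · simp
      · simp [rotate, hb, hmem]
    by_cases haT : a ∈ T
    · have haT' : a ∉ symmDiff T {a} := by simp [hmem, haT]
      have h1 : Complex.I • Complex.I • v a = (-1 : ℝ) • rotate (symmDiff T {a}) v a := by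
        rw [rotate, if_neg haT', smul_smul, Complex.I_mul_I]
        simp
      rw [if_pos haT, if_pos haT, if_neg haT', hoff, h1, α.map_update_smul, hself]
      have hI := Complex.I_mul_I
      split_ifs
      · simp only [Complex.real_smul]; push_cast; ring
      · simp only [Complex.real_smul]; push_cast; ring
    · have haT' : a ∈ symmDiff T {a} := by simp [hmem, haT]
      have h1 : Complex.I • v a = rotate (symmDiff T {a}) v a := by
        rw [rotate, if_pos haT']
      rw [if_neg haT, if_neg haT, if_pos haT', hoff, h1, hself]
      have hI := Complex.I_mul_I
      split_ifs
      · linear_combination (1 / 2) * (∏ b ∈ Finset.univ.erase a, if b ∈ T then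
          (if b ∈ S then -Complex.I / 2 else Complex.I / 2) else 1 / 2) *
          α (rotate (symmDiff T {a}) v) * hI
      · linear_combination (1 / 2) * (∏ b ∈ Finset.univ.erase a, if b ∈ T then
          (if b ∈ S then -Complex.I / 2 else Complex.I / 2) else 1 / 2) *
          α (rotate (symmDiff T {a}) v) * hI

theorem slotPart_rotate {n k : ℕ} (α : Alt n k) (S T : Finset (Fin k)) (v : Fin k → Model n) :
    slotPart α S (rotate T v) =
      (∏ a ∈ T, if a ∈ S then Complex.I else -Complex.I) * slotPart α S v := by
  induction T using Finset.induction_on with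
  | empty =>
    have : rotate ∅ v = v := by funext a; simp [rotate]
    rw [this]; simp
  | insert a T ha ih =>
    have : rotate (insert a T) v =
        Function.update (rotate T v) a (Complex.I • rotate T v a) := by
      funext b
      rcases eq_or_ne b a with rfl | hb
      · simp [rotate, ha]
      · simp [rotate, hb]
    rw [this, slotPart_update, ih, Finset.prod_insert ha, mul_assoc]

/-- The slot projections are orthogonal idempotents. -/
theorem sum_slotCoeff_mul {k : ℕ} (S S' : Finset (Fin k)) :
    ∑ T : Finset (Fin k), slotCoeff S T * (∏ a ∈ T, if a ∈ S' then Complex.I else -Complex.I) =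
      if S = S' then 1 else 0 := by
  have h := Finset.prod_add (fun a : Fin k => (if a ∈ S then -Complex.I / 2 else Complex.I / 2) *
      (if a ∈ S' then Complex.I else -Complex.I)) (fun _ => (1 / 2 : ℂ)) Finset.univ
  rw [Finset.powerset_univ] at h
  have h2 : ∀ T : Finset (Fin k),
      slotCoeff S T * (∏ a ∈ T, if a ∈ S' then Complex.I else -Complex.I) =
      (∏ a ∈ T, (if a ∈ S then -Complex.I / 2 else Complex.I / 2) *
        (if a ∈ S' then Complex.I else -Complex.I)) * ∏ _a ∈ Finset.univ \ T, (1 / 2 : ℂ) := by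
    intro T
    rw [slotCoeff, ← Finset.prod_sdiff (Finset.subset_univ T), Finset.prod_mul_distrib]
    have h3 : ∏ a ∈ Finset.univ \ T, (if a ∈ T then
        (if a ∈ S then -Complex.I / 2 else Complex.I / 2) else (1 / 2 : ℂ)) =
        ∏ _a ∈ Finset.univ \ T, (1 / 2 : ℂ) :=
      Finset.prod_congr rfl fun a ha => by simp [(Finset.mem_sdiff.mp ha).2]
    have h4 : ∏ a ∈ T, (if a ∈ T then
        (if a ∈ S then -Complex.I / 2 else Complex.I / 2) else (1 / 2 : ℂ)) =
        ∏ a ∈ T, (if a ∈ S then -Complex.I / 2 else Complex.I / 2) :=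
      Finset.prod_congr rfl fun a ha => by simp [ha]
    rw [h3, h4]
    ring
  rw [Finset.sum_congr rfl fun T _ => h2 T, ← h]
  have hI := Complex.I_mul_I
  split_ifs with hS
  · subst hS
    refine Finset.prod_eq_one fun a _ => ?_
    split_ifs <;> linear_combination (-1 / 2) * hI
  · obtain ⟨a, ha⟩ : ∃ a, ¬(a ∈ S ↔ a ∈ S') := by
      by_contra hcon
      push Not at hcon
      exact hS (Finset.ext hcon)
    refine Finset.prod_eq_zero (Finset.mem_univ a) ?_
    by_cases h1 : a ∈ S <;> by_cases h2 : a ∈ S'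
    · exact absurd (iff_of_true h1 h2) ha
    · rw [if_pos h1, if_neg h2]; linear_combination (1 / 2) * hI
    · rw [if_neg h1, if_pos h2]; linear_combination (1 / 2) * hI
    · exact absurd (iff_of_false h1 h2) ha

theorem slotPart_thetaCov {n : ℕ} (c : ℝ) (α : Cov n) (k : ℕ) (S : Finset (Fin k))
    (v : Fin k → Model n) :
    slotPart (thetaCov c α k) S v = (c : ℂ) ^ S.card * slotPart (α k) S v := by
  rw [slotPart]
  simp_rw [thetaCov_apply, slotPart_rotate, Finset.mul_sum]
  rw [Finset.sum_comm]
  have h : ∀ S' : Finset (Fin k), ∑ T : Finset (Fin k), slotCoeff S T * ((c : ℂ) ^ S'.card *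
      ((∏ a ∈ T, if a ∈ S' then Complex.I else -Complex.I) * slotPart (α k) S' v)) =
      (if S = S' then 1 else 0) * ((c : ℂ) ^ S'.card * slotPart (α k) S' v) := by
    intro S'
    rw [← sum_slotCoeff_mul, Finset.sum_mul]
    exact Finset.sum_congr rfl fun T _ => by ring
  rw [Finset.sum_congr rfl fun S' _ => h S']
  simp

/-- The inverse of `thetaCov c` is `thetaCov c⁻¹`. -/
theorem thetaCov_inv {n : ℕ} (c : ℝ) (hc : c ≠ 0) (α : Cov n) :
    thetaCov c⁻¹ (thetaCov c α) = α := by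
  funext k
  ext v
  rw [thetaCov_apply]
  simp_rw [slotPart_thetaCov, ← mul_assoc, ← mul_pow]
  rw [← sum_slotPart (α k) v]
  have : ((c⁻¹ : ℝ) : ℂ) * (c : ℂ) = 1 := by
    rw [← Complex.ofReal_mul, inv_mul_cancel₀ hc, Complex.ofReal_one]
  rw [this]
  simp


/-! ### Differential forms on a complex manifold -/

/-- A (not necessarily smooth, inhomogeneous, complex valued) differential form on `X`. -/
abbrev Form (n : ℕ) (X : Type*) : Type _ := X → Cov n

/-- Operators on differential forms. -/
abbrev Op (n : ℕ) (X : Type*) : Type _ := Form n X → Form n X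

/-- `θ_η`, multiplication by `η ^ p` on forms of type `(p, q)`. -/
def theta {n : ℕ} {X : Type*} (η : X → ℝ) : Op n X := fun u x => thetaCov (η x) (u x)

/-- `θ_η⁻¹ = θ_{1/η}`. -/
theorem theta_inv {n : ℕ} {X : Type*} (η : X → ℝ) (hη : ∀ x, η x ≠ 0) (u : Form n X) :
    theta η⁻¹ (theta η u) = u := by
  funext x
  exact thetaCov_inv (η x) (hη x) (u x)

section Manifold

variable {n : ℕ} {X : Type*} [TopologicalSpace X] [ChartedSpace (Model n) X]

/-- The degree `k` part of the pullback of a form to `ℂⁿ` by the inverse of the preferred chart at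
`x₀`; it is meaningful on the target of that chart. -/
def localRep (x₀ : X) (u : Form n X) (k : ℕ) : Model n → Alt n k := fun y =>
  (u ((chartAt (Model n) x₀).symm y) k).compContinuousLinearMap
    (mfderiv 𝓘(ℝ, Model n) 𝓘(ℝ, Model n) (chartAt (Model n) x₀).symm y)

/-- `C^∞` forms (in the real sense): those that are `C^∞` in the charts. -/
def IsSmoothForm (u : Form n X) : Prop :=
  ∀ (k : ℕ) (x₀ : X), ContDiffOn ℝ ∞ (localRep x₀ u k) (chartAt (Model n) x₀).target

/-- A homogeneous form of degree `k`, as an inhomogeneous form. -/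
def ofDegree (k : ℕ) (u : X → Alt n k) : Form n X := fun x => Pi.single k (u x)

/-- A real valued function as a form of degree `0`. -/
def ofFunction (f : X → ℝ) : Form n X :=
  ofDegree 0 fun x => ContinuousAlternatingMap.constOfIsEmpty ℝ (Model n) (Fin 0) (f x : ℂ)

/-- The exterior derivative `d`, computed at `x` in the preferred chart at `x`. -/
def extD : Op n X := fun u x k =>
  match k with
  | 0 => 0
  | k + 1 => (extDeriv (localRep x u k) (chartAt (Model n) x x)).compContinuousLinearMap
      (mfderiv 𝓘(ℝ, Model n) 𝓘(ℝ, Model n) (chartAt (Model n) x) x)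

/-- The component of type `(p, k - p)` of a form. -/
def component (p k : ℕ) (u : Form n X) : Form n X := ofDegree k fun x => typePart p (u x k)

/-- `∂`, on forms of type `(p, q)` the component of type `(p + 1, q)` of `d`. -/
def del : Op n X := fun u x k =>
  match k with
  | 0 => 0
  | k + 1 => ∑ p ∈ Finset.range (k + 1), typePart (p + 1) (extD (component p k u) x (k + 1))

/-- `∂̄`, on forms of type `(p, q)` the component of type `(p, q + 1)` of `d`. -/
def delbar : Op n X := fun u x k =>
  match k with
  | 0 => 0
  | k + 1 => ∑ p ∈ Finset.range (k + 1), typePart p (extD (component p k u) x (k + 1))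

/-- The operator `α ∧ ·`. -/
def wedgeOp (α : Form n X) : Op n X := fun u x => wedge (α x) (u x)

/-- Complex conjugate of a form. -/
def conjForm (u : Form n X) : Form n X := fun x => conjCov (u x)

/-- The conjugate `Ā` of an operator `A`, determined by `conj (A u) = Ā (conj u)`. -/
def conjOp (A : Op n X) : Op n X := fun u => conjForm (A (conjForm u))

/-- The operator `f A` for a real valued function `f`. -/
def mulFn (f : X → ℝ) (A : Op n X) : Op n X := fun u x => (f x : ℂ) • A u x

/-- The graded commutator `[A, B] = A B - (-1) ^ (a b) B A` of operators of degrees `a` and `b`. -/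
def bracket (a b : ℤ) (A B : Op n X) : Op n X := fun u =>
  A (B u) - ((-1 : ℤ) ^ (a * b).natAbs) • B (A u)

/-- `D_η = θ_η d θ_η⁻¹`, where `θ_η⁻¹ = θ_{1/η}`. -/
def twistedD (η : X → ℝ) : Op n X := fun u => theta η (extD (theta η⁻¹ u))

/-- `d_η = η ∂ + ∂̄`. -/
def dEta (η : X → ℝ) : Op n X := mulFn η del + delbar

/-! ### Hermitian metrics -/

/-- A Hermitian metric, given by its fundamental form `ω`: a smooth real positive definite form of
type `(1, 1)`. -/
structure HermitianMetric (n : ℕ) (X : Type*) [TopologicalSpace X] [ChartedSpace (Model n) X] where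
  /-- The fundamental form. -/
  form : X → Alt n 2
  /-- It is `C^∞`. -/
  smooth : IsSmoothForm (ofDegree 2 form)
  /-- It is real. -/
  real : ∀ x v, (form x v).im = 0
  /-- It is of type `(1, 1)`. -/
  invariant : ∀ x (v w : Model n),
    form x ![Complex.I • v, Complex.I • w] = form x ![v, w]
  /-- It is positive definite. -/
  pos : ∀ x (v : Model n), v ≠ 0 → 0 < (form x ![v, Complex.I • v]).re

/-- The fundamental form `ω` as an (inhomogeneous) form. -/
def HermitianMetric.omega (g : HermitianMetric n X) : Form n X := ofDegree 2 g.form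

/-- The Riemannian metric `g(v, w) = ω(v, J w)` of a Hermitian metric. -/
def HermitianMetric.riem (g : HermitianMetric n X) (x : X) (v w : Model n) : ℝ :=
  (g.form x ![v, Complex.I • w]).re

/-- The real basis `e₁, i e₁, …, eₙ, i eₙ` of `ℂⁿ`. -/
def realBasis (n : ℕ) (a : Fin n × Fin 2) : Model n :=
  Pi.single a.1 (if a.2 = 0 then 1 else Complex.I)

/-- The Gram matrix of the Riemannian metric in the tangent space at `x`. -/
def HermitianMetric.gram (g : HermitianMetric n X) (x : X) :
    Matrix (Fin n × Fin 2) (Fin n × Fin 2) ℝ :=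
  Matrix.of fun a b => g.riem x (realBasis n a) (realBasis n b)

open Nat in
/-- The pointwise inner product of forms induced by the metric: forms of different degrees are
orthogonal, and for forms of degree `k` it is
`1 / k! ∑ g^{i₁j₁} ⋯ g^{iₖjₖ} α_{i₁…iₖ} conj (β_{j₁…jₖ})` with `(g^{ij})` the inverse of the Gram
matrix. -/
def HermitianMetric.inner (g : HermitianMetric n X) (x : X) (α β : Cov n) : ℂ :=
  ∑ k ∈ Finset.range (2 * n + 1), ((k ! : ℂ))⁻¹ * ∑ i : Fin k → Fin n × Fin 2,
    ∑ j : Fin k → Fin n × Fin 2, ((∏ a, (g.gram x)⁻¹ (i a) (j a) : ℝ) : ℂ) *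
      (α k fun a => realBasis n (i a)) *
      (starRingEnd ℂ) (β k fun a => realBasis n (j a))

/-- `S` is the adjoint of the operator `T` of order zero for the pointwise inner product. -/
def IsPointwiseAdjoint (g : HermitianMetric n X) (T S : Op n X) : Prop :=
  ∀ u v x, g.inner x (T u x) (v x) = g.inner x (u x) (S v x)

open Classical in
/-- The pointwise adjoint `T⋆` of an operator `T` of order zero (it is unique; `0` if there is
none). -/
def pointwiseAdjoint (g : HermitianMetric n X) (T : Op n X) : Op n X :=
  if h : ∃ S, IsPointwiseAdjoint g T S then h.choose else 0

/-- `Λ`, the adjoint of the Lefschetz operator `ω ∧ ·`. -/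
def lambdaOp (g : HermitianMetric n X) : Op n X := pointwiseAdjoint g (wedgeOp g.omega)

/-- The `η`-torsion operator `τ_η = [Λ, D_η ω ∧ ·]`. -/
def tau (g : HermitianMetric n X) (η : X → ℝ) : Op n X :=
  bracket (-2) 3 (lambdaOp g) (wedgeOp (twistedD η g.omega))

/-- The density of the Riemannian volume with respect to Lebesgue measure on the target of the
preferred chart at `x₀`. -/
def HermitianMetric.density (g : HermitianMetric n X) (x₀ : X) (y : Model n) : ℝ :=
  Real.sqrt (Matrix.det (Matrix.of fun a b : Fin n × Fin 2 =>
    g.riem ((chartAt (Model n) x₀).symm y)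
      (mfderiv 𝓘(ℝ, Model n) 𝓘(ℝ, Model n) (chartAt (Model n) x₀).symm y (realBasis n a))
      (mfderiv 𝓘(ℝ, Model n) 𝓘(ℝ, Model n) (chartAt (Model n) x₀).symm y (realBasis n b))))

variable [MeasurableSpace X]

open MeasureTheory in
/-- The Riemannian volume measure of the domain of the preferred chart at `x₀`. -/
def HermitianMetric.chartVolume (g : HermitianMetric n X) (x₀ : X) : Measure X :=
  (((volume : Measure (Model n)).restrict (chartAt (Model n) x₀).target).withDensity
    fun y => ENNReal.ofReal (g.density x₀ y)).map (chartAt (Model n) x₀).symm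

/-- The Riemannian volume measure `dV_ω`: the chart volumes agree on overlaps, and this is the
measure on `X` (second countable) that restricts to each of them. -/
def HermitianMetric.vol (g : HermitianMetric n X) : MeasureTheory.Measure X :=
  ⨆ x₀ : X, g.chartVolume x₀

/-- The `L²` inner product `∫ ⟨u, v⟩ dV_ω`. -/
def HermitianMetric.l2inner (g : HermitianMetric n X) (u v : Form n X) : ℂ :=
  ∫ x, g.inner x (u x) (v x) ∂g.vol

/-- `Q` is the formal adjoint of the differential operator `P` on smooth forms. -/
def IsFormalAdjoint (g : HermitianMetric n X) (P Q : Op n X) : Prop :=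
  (∀ v, IsSmoothForm v → IsSmoothForm (Q v)) ∧
  ∀ u v, IsSmoothForm u → IsSmoothForm v → HasCompactSupport u →
    g.l2inner (P u) v = g.l2inner u (Q v)

open Classical in
/-- The formal adjoint `P⋆` of `P` (on smooth forms it is unique; `0` if there is none). -/
def formalAdjoint (g : HermitianMetric n X) (P : Op n X) : Op n X :=
  if h : ∃ Q, IsFormalAdjoint g P Q then h.choose else 0

/-- The Laplacian `Δ_η = D_η D_η⋆ + D_η⋆ D_η`. -/
def laplacian (g : HermitianMetric n X) (η : X → ℝ) : Op n X :=
  bracket 1 (-1) (twistedD η) (formalAdjoint g (twistedD η))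

end Manifold

end EtaBKN
end

open EtaBKN

section

set_option maxSynthPendingDepth 3

open scoped ContDiff Manifold

noncomputable section

namespace EtaBKN

/-! ### Contractions and the exterior product -/

/-! The twisted operators are conjugates of `d` by the type operators. As `θ_η` is real and
pointwise self-adjoint, `D_η⋆ = θ_η⁻¹ d⋆ θ_η`, so everything rests on a first-order relation for
`d⋆` on a Hermitian, not necessarily Kähler, manifold. With `dᶜ = i (∂ - ∂̄)` and `Λ` the adjoint of
`ω ∧ ·`, it is `d⋆ = [dᶜ, Λ] - [Λ, dω ∧ ·]⋆`.

This relation is proved in a chart without normal coordinates. In the real basis `d = ∑ eᵃ ∧ ∂ₐ` and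
`dᶜ = ∑ (eᵃ ∘ J) ∧ ∂ₐ`. Integration by parts needs the derivative, in each direction `a`, of the
inner product times the volume density; this derivative is the zero order operator `[Λ, ∂ₐω ∧ ·]`
(`hasDerivAt_innerP`, `hasDerivAt_sqrt_det`, `lam_mul_lef`). On the other side, `[Λ, (eᵃ ∘ J) ∧ ·]`
is contraction with the dual of `eᵃ` (`lam_mul_extJ`), and differentiating the coefficients of `Λ`
produces minus the adjoint of `∂ₐω ∧ ·` (`pd_lam`). The two computations differ exactly by the
adjoint of the torsion operator (`isAdj_flatTors`, `flatCod_eq`, `divergence`). The divergence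
integrates to zero, and a partition of unity globalizes the statement (`l2inner_extD`).

To bring in `η`, note that the conjugate of `θ_{-η}` multiplies type `(p, q)` by `(-η) ^ q`. Hence
`D̄_{-η}` is the `θ_η`-conjugate of `-i η dᶜ + i (dη ∘ J) ∧ N`, where `N` is the degree
(`conj_twistedD_neg`). Likewise `τ_η` is conjugate to `[Λ, dω ∧ ·] - η⁻¹ [Λ, dη ∧ ω ∧ ·]`
(`tau_eq`), and the adjoint of the second bracket follows from `[Λ, ω ∧ ·] = n - N`
(`wedgeTorsAdj_eq`). The contributions of `N` cancel and those of `n` survive (`codEta_apply`):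
`D_η⋆ = -i [Λ, D̄_{-η}] - τ_η⋆ + n η⁻¹ [i d̄_{-η} η ∧ ·, Λ]`. Conjugation and the change of `η` into
`-η` give the companion formula for the adjoint of `D̄_{-η}`. Inserting both into the two
Laplacians, the graded Jacobi identity turns the double commutators into `i [[D_η, D̄_{-η}], Λ]`,
and the rest matches term by term (`bochnerKodairaNakano`).

Two devices keep the algebra short. A form is determined by its component of degree zero and its
contractions, so identities of exterior algebra go by induction on the degree. Pointwise adjoints
are unique because the metric is positive definite, so the behaviour of `Λ` and of the torsion
adjoint under charts and type operators is inherited from the operators whose adjoints they are. -/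

theorem tensor_apply {n i j k : ℕ} (h : i + j = k) (α : Alt n i) (β : Alt n j)
    (x : Fin k → Model n) :
    tensor h α β x = α (fun a => x ⟨a.1, by omega⟩) * β (fun b => x ⟨i + b.1, by omega⟩) := by
  subst h
  rfl

/-- Contraction of a form with a real tangent vector, in the first slot. -/
def contr {n : ℕ} (v : Model n) : Cov n →ₗ[ℂ] Cov n where
  toFun α k := (α (k + 1)).curryLeft v
  map_add' α β := by funext k; ext w; simp
  map_smul' c α := by funext k; ext w; simp

theorem contr_apply {n : ℕ} (v : Model n) (α : Cov n) (k : ℕ) (w : Fin k → Model n) :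
    contr v α k w = α (k + 1) (Fin.cons v w) := rfl

theorem contr_add {n : ℕ} (v w : Model n) : contr (v + w) = contr v + contr w := by
  ext α k x; simp [contr]

theorem contr_smul {n : ℕ} (r : ℝ) (v : Model n) : contr (r • v) = (r : ℂ) • contr v := by
  ext α k x; simp [contr]

theorem contr_zero {n : ℕ} : contr (0 : Model n) = 0 := by
  ext α k x; simp [contr]

theorem contr_neg {n : ℕ} (v : Model n) : contr (-v) = -contr v := by
  ext α k x; simp [contr]

theorem contr_contr {n : ℕ} (v w : Model n) (α : Cov n) :
    contr v (contr w α) = - contr w (contr v α) := by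
  funext k
  ext x
  have := (α (k + 2)).toAlternatingMap.map_swap (Fin.cons w (Fin.cons v x)) (i := 0) (j := 1)
    (by simp)
  simp only [contr_apply, ContinuousAlternatingMap.neg_apply, Pi.neg_apply]
  rw [show (Fin.cons v (Fin.cons w x) : Fin (k + 2) → Model n) =
    (Fin.cons w (Fin.cons v x) : Fin (k + 2) → Model n) ∘ Equiv.swap 0 1 from ?_] at *
  · rw [neg_eq_iff_eq_neg.symm]
    have h2 := (α (k + 2)).toAlternatingMap.map_swap (Fin.cons w (Fin.cons v x)) (i := 0) (j := 1)
      (by simp)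
    simp only [ContinuousAlternatingMap.coe_toAlternatingMap] at h2
    rw [h2]
  · funext a
    refine Fin.cases ?_ (fun a => ?_) a
    · simp
    · refine Fin.cases ?_ (fun a => ?_) a
      · simp
      · have h1 : (a.succ.succ : Fin (k + 2)) ≠ 0 := Fin.succ_ne_zero _
        have h2 : (a.succ.succ : Fin (k + 2)) ≠ 1 := by
          intro h; simp [Fin.ext_iff] at h
        simp [Equiv.swap_apply_of_ne_of_ne h1 h2]

/-- In positive degree a form is recovered from its contractions by feeding it its first argument.
With its degreewise version `alt_succ_ext`, this is the device behind most identities of exterior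
algebra below. -/
theorem cov_ext_contr {n : ℕ} {α β : Cov n} (h0 : α 0 = β 0)
    (h : ∀ v, contr v α = contr v β) : α = β := by
  funext k
  cases k with
  | zero => exact h0
  | succ k =>
    ext v
    have := congrFun (congrArg DFunLike.coe (congrFun (h (v 0)) k)) (Fin.tail v)
    simpa [contr_apply, Fin.cons_self_tail] using this

/-- The permutations of `Fin (k + 1)` are the products of an extended permutation of `Fin k` and
a cycle. -/
theorem bijective_cycle {k : ℕ} : Function.Bijective
    (fun q : Fin (k + 1) × Equiv.Perm (Fin k) =>
      Equiv.Perm.decomposeFin.symm (0, q.2) * Fin.cycleRange q.1) := by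
  rw [Fintype.bijective_iff_injective_and_card]
  constructor
  · rintro ⟨p, e⟩ ⟨q, f⟩ h
    simp only at h
    have hz : ∀ e : Equiv.Perm (Fin k), Equiv.Perm.decomposeFin.symm (0, e) 0 = 0 := by
      intro e; simp
    -- The extended permutation fixes `0` and the cycle sends `p` to `0`, so `p` is the only index
    -- sent to `0` by the product.
    have hp : p = q := by
      have h1 := DFunLike.congr_fun h p
      simp only [Equiv.Perm.mul_apply, Fin.cycleRange_self, hz] at h1
      have h2 := (Equiv.Perm.decomposeFin.symm (0, f)).injective
        (h1.symm.trans (hz f).symm)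
      rw [← Fin.cycleRange_self q] at h2
      exact (Fin.cycleRange q).injective h2
    subst hp
    have h3 := mul_right_cancel h
    have h4 := Equiv.Perm.decomposeFin.symm.injective h3
    simp only [Prod.mk.injEq, true_and] at h4
    rw [h4]
  · simp [Fintype.card_prod, Fintype.card_perm, Nat.factorial_succ]

/-- The permutations are sorted by the slot `p` that receives the distinguished vector; `(-1) ^ p`
is the sign of the cycle bringing that slot to the front. -/
theorem alternatization_cons {n k : ℕ}
    (f : ContinuousMultilinearMap ℝ (fun _ : Fin (k + 1) => Model n) ℂ)
    (v : Model n) (w : Fin k → Model n) :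
    ContinuousMultilinearMap.alternatization f (Fin.cons v w) =
      ∑ p : Fin (k + 1), (-1 : ℂ) ^ p.1 * ∑ e : Equiv.Perm (Fin k),
        (Equiv.Perm.sign e : ℤ) * f (p.insertNth v (w ∘ e)) := by
  rw [ContinuousMultilinearMap.alternatization_apply_apply]
  rw [← (Equiv.ofBijective _ (bijective_cycle (k := k))).sum_comp, Fintype.sum_prod_type]
  refine Finset.sum_congr rfl fun p _ => ?_
  rw [Finset.mul_sum]
  refine Finset.sum_congr rfl fun e _ => ?_
  have hx : (Fin.cons v w : Fin (k + 1) → Model n) ∘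
      ⇑(Equiv.Perm.decomposeFin.symm (0, e) * Fin.cycleRange p) =
      p.insertNth v (w ∘ e) := by
    rw [← Fin.cons_comp_cycleRange]
    funext i
    simp only [Equiv.Perm.mul_apply, Function.comp_apply]
    refine Fin.cases ?_ (fun a => ?_) (Fin.cycleRange p i)
    · simp
    · simp
  simp only [Equiv.ofBijective_apply]
  rw [show (Equiv.Perm.sign (Equiv.Perm.decomposeFin.symm (0, e) * Fin.cycleRange p)) =
    Equiv.Perm.sign e * (-1) ^ p.1 by simp [Equiv.Perm.sign_mul]]
  rw [hx]
  simp [Units.smul_def, mul_comm, mul_assoc]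

theorem alt_insertNth {n k : ℕ} (α : Alt n (k + 1)) (p : Fin (k + 1)) (v : Model n)
    (w : Fin k → Model n) :
    α (p.insertNth v w) = (-1 : ℂ) ^ p.1 * α (Fin.cons v w) := by
  have := α.map_insertNth p v w
  rw [this]
  simp [Matrix.vecCons]

/-- A vector inserted among the first `i + 1` slots is seen by `α` only, and moving it to the front
of `α` costs `(-1) ^ p`. -/
theorem tensor_insertNth_left {n i j k : ℕ} (h : i + 1 + j = k + 1) (h' : i + j = k)
    (α : Cov n) (β : Cov n) (p : Fin (k + 1)) (hp : p.1 < i + 1) (v : Model n)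
    (w : Fin k → Model n) :
    tensor h (α (i + 1)) (β j) (p.insertNth v w) =
      (-1 : ℂ) ^ p.1 * tensor h' (contr v α i) (β j) w := by
  have e1 : (fun a : Fin (i + 1) => (p.insertNth v w : Fin (k + 1) → Model n) ⟨a.1, by omega⟩) =
      (⟨p.1, hp⟩ : Fin (i + 1)).insertNth v (fun a : Fin i => w ⟨a.1, by omega⟩) := by
    rw [Fin.eq_insertNth_iff]
    constructor
    · simp
    · funext a
      simp only [Fin.removeNth]
      have : (⟨((⟨p.1, hp⟩ : Fin (i + 1)).succAbove a).1, by omega⟩ : Fin (k + 1)) =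
          p.succAbove ⟨a.1, by omega⟩ := by
        ext
        simp only [Fin.succAbove, Fin.lt_def]
        simp only [Fin.val_castSucc]
        split_ifs <;> simp
      rw [this, Fin.insertNth_apply_succAbove]
  have e2 : (fun b : Fin j => (p.insertNth v w : Fin (k + 1) → Model n) ⟨i + 1 + b.1, by omega⟩) =
      fun b : Fin j => w ⟨i + b.1, by omega⟩ := by
    funext b
    have : (⟨i + 1 + b.1, by omega⟩ : Fin (k + 1)) = p.succAbove ⟨i + b.1, by omega⟩ := by
      ext
      rw [Fin.succAbove_of_le_castSucc _ _ (by rw [Fin.le_def]; simp; omega)]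
      simp; omega
    rw [this, Fin.insertNth_apply_succAbove]
  rw [tensor_apply, e1, e2, alt_insertNth, tensor_apply, contr_apply, mul_assoc]

/-- Here the vector sits `p - i` slots into the argument list of `β`, whence the exponent. -/
theorem tensor_insertNth_right {n i j k : ℕ} (h : i + (j + 1) = k + 1) (h' : i + j = k)
    (α : Cov n) (β : Cov n) (p : Fin (k + 1)) (hp : i ≤ p.1) (v : Model n)
    (w : Fin k → Model n) :
    tensor h (α i) (β (j + 1)) (p.insertNth v w) =
      (-1 : ℂ) ^ (p.1 - i) * tensor h' (α i) (contr v β j) w := by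
  have e1 : (fun a : Fin (j + 1) => (p.insertNth v w : Fin (k + 1) → Model n) ⟨i + a.1, by omega⟩) =
      (⟨p.1 - i, by omega⟩ : Fin (j + 1)).insertNth v (fun a : Fin j => w ⟨i + a.1, by omega⟩) := by
    rw [Fin.eq_insertNth_iff]
    constructor
    · have : (⟨i + (p.1 - i), by omega⟩ : Fin (k + 1)) = p := by ext; simp; omega
      simp [this]
    · funext a
      simp only [Fin.removeNth]
      have : (⟨i + ((⟨p.1 - i, by omega⟩ : Fin (j + 1)).succAbove a).1, by omega⟩ : Fin (k + 1)) =
          p.succAbove ⟨i + a.1, by omega⟩ := by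
        ext
        simp only [Fin.succAbove, Fin.lt_def]
        simp only [Fin.val_castSucc]
        split_ifs <;> simp <;> omega
      rw [this, Fin.insertNth_apply_succAbove]
  have e2 : (fun b : Fin i => (p.insertNth v w : Fin (k + 1) → Model n) ⟨b.1, by omega⟩) =
      fun b : Fin i => w ⟨b.1, by omega⟩ := by
    funext b
    have : (⟨b.1, by omega⟩ : Fin (k + 1)) = p.succAbove ⟨b.1, by omega⟩ := by
      ext
      rw [Fin.succAbove_of_castSucc_lt _ _ (by rw [Fin.lt_def]; simp; omega)]
      simp
    rw [this, Fin.insertNth_apply_succAbove]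
  rw [tensor_apply, e1, e2, alt_insertNth, tensor_apply, contr_apply]
  ring

/-- The antisymmetrization of `α ⊗ β` for the components of degrees `i`, `j`, as a function. -/
def altTensor {n : ℕ} (i j k : ℕ) (α β : Cov n) (w : Fin k → Model n) : ℂ :=
  if h : i + j = k then ContinuousMultilinearMap.alternatization (tensor h (α i) (β j)) w else 0

theorem altTensor_eq {n i j k : ℕ} (h : i + j = k) (α β : Cov n) (w : Fin k → Model n) :
    altTensor i j k α β w = ∑ e : Equiv.Perm (Fin k), (Equiv.Perm.sign e : ℤ) *
      tensor h (α i) (β j) (w ∘ e) := by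
  rw [altTensor, dif_pos h, ContinuousMultilinearMap.alternatization_apply_apply]
  simp [Units.smul_def]

/-- Of the `k + 1` slots `i` belong to `α` and `j` to `β`. All slots of one factor contribute the
same term, since the sign of the insertion cancels that of the cycle, up to the `(-1) ^ i` needed to
cross `α`. The truncated subtractions are harmless: for `i = 0` or `j = 0` the coefficient in front
is zero. -/
theorem altTensor_cons {n i j k : ℕ} (h : i + j = k + 1) (α β : Cov n) (v : Model n)
    (w : Fin k → Model n) :
    altTensor i j (k + 1) α β (Fin.cons v w) =
      i * altTensor (i - 1) j k (contr v α) β w +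
      (-1) ^ i * (j * altTensor i (j - 1) k α (contr v β) w) := by
  rw [altTensor, dif_pos h, alternatization_cons]
  have key : ∀ p : Fin (k + 1), (-1 : ℂ) ^ p.1 * ∑ e : Equiv.Perm (Fin k),
        (Equiv.Perm.sign e : ℤ) * tensor h (α i) (β j) (p.insertNth v (w ∘ e)) =
      if p.1 < i then altTensor (i - 1) j k (contr v α) β w
      else (-1) ^ i * altTensor i (j - 1) k α (contr v β) w := by
    intro p
    split_ifs with hp
    · obtain ⟨i, rfl⟩ : ∃ i', i = i' + 1 := ⟨i - 1, by omega⟩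
      simp only [Nat.add_sub_cancel]
      rw [altTensor_eq (by omega), Finset.mul_sum]
      refine Finset.sum_congr rfl fun e _ => ?_
      rw [tensor_insertNth_left h (by omega) α β p hp]
      have : ((-1 : ℂ) ^ p.1) * (-1) ^ p.1 = 1 := by rw [← mul_pow]; simp
      linear_combination ((Equiv.Perm.sign e : ℤ) : ℂ) *
        tensor (by omega : i + j = k) (contr v α i) (β j) (w ∘ e) * this
    · have := p.2
      obtain ⟨j, rfl⟩ : ∃ j', j = j' + 1 := ⟨j - 1, by omega⟩
      simp only [Nat.add_sub_cancel]
      rw [altTensor_eq (by omega), Finset.mul_sum, Finset.mul_sum]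
      refine Finset.sum_congr rfl fun e _ => ?_
      rw [tensor_insertNth_right h (by omega) α β p (by omega)]
      have : ((-1 : ℂ) ^ p.1) * (-1) ^ (p.1 - i) = (-1) ^ i := by
        obtain ⟨r, hr⟩ : ∃ r, p.1 = i + r := ⟨p.1 - i, by omega⟩
        rw [hr, Nat.add_sub_cancel_left, pow_add, mul_assoc, ← mul_pow]; simp
      linear_combination ((Equiv.Perm.sign e : ℤ) : ℂ) *
        tensor (by omega : i + j = k) (α i) (contr v β j) (w ∘ e) * this
  rw [Finset.sum_congr rfl fun p _ => key p]
  rw [Fin.sum_univ_eq_sum_range (fun p => if p < i then altTensor (i - 1) j k (contr v α) β w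
      else (-1) ^ i * altTensor i (j - 1) k α (contr v β) w), ← h, Finset.sum_range_add]
  rw [Finset.sum_congr rfl fun p hp => if_pos (Finset.mem_range.mp hp)]
  simp
  ring

open Nat in
theorem wedge_apply {n : ℕ} (α β : Cov n) (k : ℕ) (w : Fin k → Model n) :
    wedge α β k w = ∑ q ∈ Finset.HasAntidiagonal.antidiagonal k, ((q.1 ! : ℂ) * (q.2 ! : ℂ))⁻¹ *
      altTensor q.1 q.2 k α β w := by
  rw [Finset.Nat.sum_antidiagonal_eq_sum_range_succ (fun i j => ((i ! : ℂ) * (j ! : ℂ))⁻¹ *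
      altTensor i j k α β w), ← Fin.sum_univ_eq_sum_range (fun i => ((i ! : ℂ) * ((k - i) ! : ℂ))⁻¹ *
      altTensor i (k - i) k α β w)]
  simp only [wedge, ContinuousAlternatingMap.sum_apply, ContinuousAlternatingMap.smul_apply,
    smul_eq_mul]
  refine Finset.sum_congr rfl fun i _ => ?_
  rw [altTensor, dif_pos]

/-- The grading automorphism `(-1) ^ k` on forms of degree `k`. -/
def gradeInv {n : ℕ} : Cov n →ₗ[ℂ] Cov n where
  toFun α k := (-1 : ℂ) ^ k • α k
  map_add' α β := by funext k; simp
  map_smul' c α := by funext k; simp [smul_comm c]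

theorem gradeInv_apply {n : ℕ} (α : Cov n) (k : ℕ) : gradeInv α k = (-1 : ℂ) ^ k • α k := rfl

theorem altTensor_gradeInv {n i j k : ℕ} (α β : Cov n) (w : Fin k → Model n) :
    altTensor i j k (gradeInv α) β w = (-1) ^ i * altTensor i j k α β w := by
  by_cases h : i + j = k
  · rw [altTensor_eq h, altTensor_eq h, Finset.mul_sum]
    refine Finset.sum_congr rfl fun e _ => ?_
    rw [tensor_apply, tensor_apply, gradeInv_apply, ContinuousAlternatingMap.smul_apply, smul_eq_mul]
    ring
  · simp [altTensor, h]

/-- Contraction is an antiderivation. -/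
theorem contr_wedge {n : ℕ} (v : Model n) (α β : Cov n) :
    contr v (wedge α β) = wedge (contr v α) β + wedge (gradeInv α) (contr v β) := by
  funext k
  ext w
  rw [contr_apply, wedge_apply, Pi.add_apply, ContinuousAlternatingMap.add_apply, wedge_apply,
    wedge_apply]
  rw [Finset.sum_congr rfl fun q hq => by
    rw [altTensor_cons (Finset.HasAntidiagonal.mem_antidiagonal.mp hq), mul_add]]
  rw [Finset.sum_add_distrib]
  congr 1
  -- The coefficient `i` kills the end term `i = 0` and otherwise removes one factor from `i !`, so
  -- an index shift produces the normalization of the shorter product. The second half is the same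
  -- at the other end of the antidiagonal.
  · rw [Finset.Nat.antidiagonal_succ, Finset.sum_cons, Finset.sum_map]
    simp only [Nat.cast_zero, zero_mul, mul_zero, zero_add]
    refine Finset.sum_congr rfl fun q _ => ?_
    simp only [Function.Embedding.prodMap, Function.Embedding.coeFn_mk, Prod.map,
      Function.Embedding.refl_apply, Nat.succ_eq_add_one, Nat.add_sub_cancel, Nat.factorial_succ]
    have : ((q.1 : ℂ) + 1) ≠ 0 := by exact_mod_cast Nat.succ_ne_zero q.1
    have h1 : (q.1.factorial : ℂ) ≠ 0 := by exact_mod_cast Nat.factorial_ne_zero _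
    have h2 : (q.2.factorial : ℂ) ≠ 0 := by exact_mod_cast Nat.factorial_ne_zero _
    push_cast
    field_simp
  · rw [Finset.Nat.antidiagonal_succ', Finset.sum_cons, Finset.sum_map]
    simp only [Nat.cast_zero, zero_mul, mul_zero, zero_add]
    refine Finset.sum_congr rfl fun q _ => ?_
    simp only [Function.Embedding.prodMap, Function.Embedding.coeFn_mk, Prod.map,
      Function.Embedding.refl_apply, Nat.succ_eq_add_one, Nat.add_sub_cancel, Nat.factorial_succ,
      altTensor_gradeInv]
    have : ((q.2 : ℂ) + 1) ≠ 0 := by exact_mod_cast Nat.succ_ne_zero q.2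
    have h1 : (q.1.factorial : ℂ) ≠ 0 := by exact_mod_cast Nat.factorial_ne_zero _
    have h2 : (q.2.factorial : ℂ) ≠ 0 := by exact_mod_cast Nat.factorial_ne_zero _
    push_cast
    field_simp

theorem wedge_zero_apply {n : ℕ} (α β : Cov n) (w : Fin 0 → Model n) :
    wedge α β 0 w = α 0 w * β 0 w := by
  rw [wedge_apply]
  simp [altTensor, ContinuousMultilinearMap.alternatization_apply_apply, tensor_apply]

/-! ### The exterior algebra of a tangent space -/

theorem altTensor_add_left {n i j k : ℕ} (α α' β : Cov n) (w : Fin k → Model n) :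
    altTensor i j k (α + α') β w = altTensor i j k α β w + altTensor i j k α' β w := by
  by_cases h : i + j = k
  · simp only [altTensor_eq h, tensor_apply, ← Finset.sum_add_distrib, Pi.add_apply,
      ContinuousAlternatingMap.add_apply, add_mul, mul_add]
  · simp [altTensor, h]

theorem altTensor_add_right {n i j k : ℕ} (α β β' : Cov n) (w : Fin k → Model n) :
    altTensor i j k α (β + β') w = altTensor i j k α β w + altTensor i j k α β' w := by
  by_cases h : i + j = k
  · simp only [altTensor_eq h, tensor_apply, ← Finset.sum_add_distrib, Pi.add_apply,
      ContinuousAlternatingMap.add_apply, mul_add]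
  · simp [altTensor, h]

theorem altTensor_smul_left {n i j k : ℕ} (c : ℂ) (α β : Cov n) (w : Fin k → Model n) :
    altTensor i j k (c • α) β w = c * altTensor i j k α β w := by
  by_cases h : i + j = k
  · simp only [altTensor_eq h, tensor_apply, Finset.mul_sum, Pi.smul_apply,
      ContinuousAlternatingMap.smul_apply, smul_eq_mul]
    exact Finset.sum_congr rfl fun e _ => by ring
  · simp [altTensor, h]

theorem altTensor_smul_right {n i j k : ℕ} (c : ℂ) (α β : Cov n) (w : Fin k → Model n) :
    altTensor i j k α (c • β) w = c * altTensor i j k α β w := by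
  by_cases h : i + j = k
  · simp only [altTensor_eq h, tensor_apply, Finset.mul_sum, Pi.smul_apply,
      ContinuousAlternatingMap.smul_apply, smul_eq_mul]
    exact Finset.sum_congr rfl fun e _ => by ring
  · simp [altTensor, h]

/-- The exterior product as a bilinear map. -/
def wedgeL {n : ℕ} : Cov n →ₗ[ℂ] Cov n →ₗ[ℂ] Cov n :=
  LinearMap.mk₂ ℂ wedge
    (fun α α' β => by
      funext k; ext w
      simp only [wedge_apply, Pi.add_apply, ContinuousAlternatingMap.add_apply, altTensor_add_left,
        mul_add, Finset.sum_add_distrib])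
    (fun c α β => by
      funext k; ext w
      simp only [wedge_apply, Pi.smul_apply, ContinuousAlternatingMap.smul_apply,
        altTensor_smul_left, smul_eq_mul, Finset.mul_sum]
      exact Finset.sum_congr rfl fun e _ => by ring)
    (fun α β β' => by
      funext k; ext w
      simp only [wedge_apply, Pi.add_apply, ContinuousAlternatingMap.add_apply, altTensor_add_right,
        mul_add, Finset.sum_add_distrib])
    (fun c α β => by
      funext k; ext w
      simp only [wedge_apply, Pi.smul_apply, ContinuousAlternatingMap.smul_apply,
        altTensor_smul_right, smul_eq_mul, Finset.mul_sum]
      exact Finset.sum_congr rfl fun e _ => by ring)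

theorem wedgeL_apply {n : ℕ} (α β : Cov n) : wedgeL α β = wedge α β := rfl

theorem alt_zero_ext {n : ℕ} {α β : Alt n 0} (h : ∀ w, α w = β w) : α = β := by
  ext w; exact h w

theorem alt_succ_ext {n k : ℕ} {α β : Cov n} (h : ∀ v, contr v α k = contr v β k) :
    α (k + 1) = β (k + 1) := by
  ext v
  have := congrArg (fun f : Alt n k => f (Fin.tail v)) (h (v 0))
  simpa [contr_apply, Fin.cons_self_tail] using this

/-- A number as a form of degree `0`. -/
def scalar {n : ℕ} (c : ℂ) : Cov n :=
  Pi.single 0 (ContinuousAlternatingMap.constOfIsEmpty ℝ (Model n) (Fin 0) c)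

/-- A covector as a form of degree `1`. -/
def oneForm {n : ℕ} : (Model n →L[ℝ] ℂ) →ₗ[ℂ] Cov n where
  toFun ξ := Pi.single 1 (ContinuousAlternatingMap.ofSubsingleton ℝ (Model n) ℂ (0 : Fin 1) ξ)
  map_add' ξ ζ := by rw [← Pi.single_add]; congr 1
  map_smul' c ξ := by rw [← Pi.single_smul]; congr 1

theorem oneForm_def {n : ℕ} (ξ : Model n →L[ℝ] ℂ) : oneForm ξ =
  Pi.single 1 (ContinuousAlternatingMap.ofSubsingleton ℝ (Model n) ℂ (0 : Fin 1) ξ) := rfl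

theorem contr_single_succ {n k : ℕ} (v : Model n) (α : Alt n (k + 1)) :
    contr v (Pi.single (k + 1) α : Cov n) = Pi.single k (α.curryLeft v) := by
  funext j
  by_cases h : j = k
  · subst h; simp [contr]
  · simp [contr, h]

theorem contr_single_zero {n : ℕ} (v : Model n) (α : Alt n 0) :
    contr v (Pi.single 0 α : Cov n) = 0 := by
  funext j
  simp [contr]

theorem contr_scalar {n : ℕ} (v : Model n) (c : ℂ) : contr v (scalar c) = 0 :=
  contr_single_zero _ _

theorem contr_oneForm {n : ℕ} (v : Model n) (ξ : Model n →L[ℝ] ℂ) :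
    contr v (oneForm ξ) = scalar (ξ v) := by
  rw [oneForm_def, contr_single_succ, scalar]
  congr 1

theorem gradeInv_single {n k : ℕ} (α : Alt n k) :
    gradeInv (Pi.single k α : Cov n) = (-1 : ℂ) ^ k • Pi.single k α := by
  funext j
  by_cases h : j = k
  · subst h; simp [gradeInv_apply]
  · rw [gradeInv_apply, Pi.smul_apply, Pi.single_eq_of_ne h]
    exact (smul_zero _).trans (smul_zero _).symm

theorem gradeInv_contr {n : ℕ} (v : Model n) (α : Cov n) :
    gradeInv (contr v α) = - contr v (gradeInv α) := by
  funext k; ext w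
  simp [gradeInv_apply, contr_apply, pow_succ]

theorem gradeInv_gradeInv {n : ℕ} (α : Cov n) : gradeInv (gradeInv α) = α := by
  funext k
  rw [gradeInv_apply, gradeInv_apply, smul_smul, ← mul_pow]
  simp

theorem scalar_wedge {n : ℕ} (c : ℂ) (β : Cov n) : wedge (scalar c) β = c • β := by
  have : ∀ k, ∀ β : Cov n, wedge (scalar c) β k = (c • β) k := by
    intro k
    induction k with
    | zero =>
      intro β
      refine alt_zero_ext fun w => ?_
      rw [wedge_zero_apply]
      simp [scalar]
    | succ k ih =>
      intro β
      refine alt_succ_ext fun v => ?_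
      rw [contr_wedge, contr_scalar, scalar, gradeInv_single, ← wedgeL_apply, ← wedgeL_apply,
        map_zero, pow_zero, one_smul, LinearMap.zero_apply, zero_add, wedgeL_apply, map_smul]
      exact ih _
  exact funext fun k => this k β

/-- Exterior multiplication by a covector. -/
def ext {n : ℕ} (ξ : Model n →L[ℝ] ℂ) : Cov n →ₗ[ℂ] Cov n := wedgeL (oneForm ξ)

theorem ext_smul {n : ℕ} (c : ℂ) (ξ : Model n →L[ℝ] ℂ) : ext (c • ξ) = c • ext ξ := by
  simp [ext]

theorem ext_apply {n : ℕ} (ξ : Model n →L[ℝ] ℂ) (α : Cov n) : ext ξ α = wedge (oneForm ξ) α := rfl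

theorem gradeInv_oneForm {n : ℕ} (ξ : Model n →L[ℝ] ℂ) :
    gradeInv (oneForm ξ) = - oneForm ξ := by
  rw [oneForm_def, gradeInv_single, pow_one]; exact neg_one_smul ℂ _

/-- The antiderivation property for a factor of degree one. This canonical anticommutation relation
is the source of the commutators of `Λ` with exterior multiplications. -/
theorem contr_ext {n : ℕ} (v : Model n) (ξ : Model n →L[ℝ] ℂ) (α : Cov n) :
    contr v (ext ξ α) = ξ v • α - ext ξ (contr v α) := by
  rw [ext_apply, contr_wedge, contr_oneForm, scalar_wedge, gradeInv_oneForm, ← wedgeL_apply,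
    map_neg, sub_eq_add_neg]
  rfl

theorem ext_zero_deg {n : ℕ} (ξ : Model n →L[ℝ] ℂ) (α : Cov n) : ext ξ α 0 = 0 := by
  refine alt_zero_ext fun w => ?_
  rw [ext_apply, wedge_zero_apply]
  simp [oneForm_def]

theorem gradeInv_wedge {n : ℕ} (α β : Cov n) :
    gradeInv (wedge α β) = wedge (gradeInv α) (gradeInv β) := by
  have : ∀ k, ∀ α β : Cov n, gradeInv (wedge α β) k = wedge (gradeInv α) (gradeInv β) k := by
    intro k
    induction k with
    | zero =>
      intro α β
      refine alt_zero_ext fun w => ?_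
      simp [wedge_zero_apply, gradeInv_apply]
    | succ k ih =>
      intro α β
      refine alt_succ_ext fun v => ?_
      have h1 : contr v (gradeInv (wedge α β)) = -gradeInv (contr v (wedge α β)) := by
        rw [gradeInv_contr, neg_neg]
      have h2 : ∀ γ : Cov n, contr v (gradeInv γ) = -gradeInv (contr v γ) := by
        intro γ; rw [gradeInv_contr, neg_neg]
      rw [h1, contr_wedge, contr_wedge, h2, h2, map_add, gradeInv_gradeInv]
      simp only [← wedgeL_apply, map_neg, LinearMap.neg_apply, Pi.add_apply, Pi.neg_apply]
      simp only [wedgeL_apply, ih, gradeInv_gradeInv]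
      abel
  exact funext fun k => this k α β

/-- Contraction acts by the same Leibniz rule on both sides, so degree `k + 1` reduces to degree `k`
and no shuffles of permutations are needed. -/
theorem wedge_assoc {n : ℕ} (α β γ : Cov n) :
    wedge (wedge α β) γ = wedge α (wedge β γ) := by
  have : ∀ k, ∀ α β γ : Cov n, wedge (wedge α β) γ k = wedge α (wedge β γ) k := by
    intro k
    induction k with
    | zero =>
      intro α β γ
      refine alt_zero_ext fun w => ?_
      simp [wedge_zero_apply, mul_assoc]
    | succ k ih =>
      intro α β γ
      refine alt_succ_ext fun v => ?_
      simp only [contr_wedge, gradeInv_wedge]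
      simp only [← wedgeL_apply, map_add, LinearMap.add_apply, Pi.add_apply]
      simp only [wedgeL_apply, ih]
      abel
  exact funext fun k => this k α β γ

/-- Two linear operators are equal if they agree in degree zero and satisfy the same commutation
relations with the contractions. -/
theorem op_ext {n : ℕ} {T S : Cov n →ₗ[ℂ] Cov n} (h0 : ∀ α, T α 0 = S α 0)
    (h : ∀ k, (∀ α, T α k = S α k) → ∀ v α, contr v (T α) k = contr v (S α) k) : T = S := by
  have : ∀ k, ∀ α, T α k = S α k := by
    intro k
    induction k with
    | zero => exact h0
    | succ k ih => exact fun α => alt_succ_ext fun v => h k ih v α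
  exact LinearMap.ext fun α => funext fun k => this k α

/-! ### Pullback, conjugation, and the type operators -/

/-- Pullback of forms by a linear map. -/
def pullback {n : ℕ} (A : Model n →L[ℝ] Model n) : Cov n →ₗ[ℂ] Cov n where
  toFun α k := (α k).compContinuousLinearMap A
  map_add' α β := by funext k; ext w; simp
  map_smul' c α := by funext k; ext w; simp

theorem pullback_apply {n : ℕ} (A : Model n →L[ℝ] Model n) (α : Cov n) (k : ℕ)
    (w : Fin k → Model n) : pullback A α k w = α k (A ∘ w) := rfl

theorem contr_pullback {n : ℕ} (A : Model n →L[ℝ] Model n) (v : Model n) (α : Cov n) :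
    contr v (pullback A α) = pullback A (contr (A v) α) := by
  funext k; ext w
  rw [contr_apply, pullback_apply, pullback_apply, contr_apply]
  congr 1
  funext a
  refine Fin.cases ?_ (fun a => ?_) a <;> simp

theorem gradeInv_pullback {n : ℕ} (A : Model n →L[ℝ] Model n) (α : Cov n) :
    gradeInv (pullback A α) = pullback A (gradeInv α) := by
  funext k; ext w; simp [gradeInv_apply, pullback_apply]

theorem pullback_wedge {n : ℕ} (A : Model n →L[ℝ] Model n) (α β : Cov n) :
    pullback A (wedge α β) = wedge (pullback A α) (pullback A β) := by
  have : ∀ k, ∀ α β : Cov n, pullback A (wedge α β) k = wedge (pullback A α) (pullback A β) k := by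
    intro k
    induction k with
    | zero =>
      intro α β
      refine alt_zero_ext fun w => ?_
      simp [wedge_zero_apply, pullback_apply]
    | succ k ih =>
      intro α β
      refine alt_succ_ext fun v => ?_
      rw [contr_pullback, contr_wedge, contr_wedge, map_add, contr_pullback, contr_pullback,
        gradeInv_pullback, Pi.add_apply, Pi.add_apply, ih, ih]
  exact funext fun k => this k α β

theorem pullback_comp {n : ℕ} (A B : Model n →L[ℝ] Model n) (α : Cov n) :
    pullback B (pullback A α) = pullback (A.comp B) α := by
  funext k; ext w; rfl

theorem pullback_id {n : ℕ} (α : Cov n) :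
    pullback (ContinuousLinearMap.id ℝ (Model n)) α = α := by
  funext k; ext w; simp [pullback_apply]

theorem conjCov_apply {n : ℕ} (α : Cov n) (k : ℕ) (w : Fin k → Model n) :
    conjCov α k w = (starRingEnd ℂ) (α k w) := rfl

theorem conjCov_add {n : ℕ} (α β : Cov n) : conjCov (α + β) = conjCov α + conjCov β := by
  funext k; ext w; simp [conjCov_apply]

theorem conjCov_smul {n : ℕ} (c : ℂ) (α : Cov n) :
    conjCov (c • α) = (starRingEnd ℂ) c • conjCov α := by
  funext k; ext w; simp [conjCov_apply]

theorem conjCov_sub {n : ℕ} (α β : Cov n) : conjCov (α - β) = conjCov α - conjCov β := by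
  funext k; ext w; simp [conjCov_apply]

theorem conjCov_sum {n : ℕ} {ι : Type*} (s : Finset ι) (f : ι → Cov n) :
    conjCov (∑ i ∈ s, f i) = ∑ i ∈ s, conjCov (f i) := by
  classical
  induction s using Finset.induction_on with
  | empty => funext k; ext w; simp [conjCov_apply]
  | insert a s ha ih => rw [Finset.sum_insert ha, Finset.sum_insert ha, conjCov_add, ih]

theorem conjCov_conjCov {n : ℕ} (α : Cov n) : conjCov (conjCov α) = α := by
  funext k; ext w; simp [conjCov_apply]

theorem contr_conjCov {n : ℕ} (v : Model n) (α : Cov n) :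
    contr v (conjCov α) = conjCov (contr v α) := rfl

theorem conjCov_gradeInv {n : ℕ} (α : Cov n) : conjCov (gradeInv α) = gradeInv (conjCov α) := by
  funext k; ext w; simp [conjCov_apply, gradeInv_apply]

theorem conjCov_wedge {n : ℕ} (α β : Cov n) :
    conjCov (wedge α β) = wedge (conjCov α) (conjCov β) := by
  have : ∀ k, ∀ α β : Cov n, conjCov (wedge α β) k = wedge (conjCov α) (conjCov β) k := by
    intro k
    induction k with
    | zero =>
      intro α β
      refine alt_zero_ext fun w => ?_
      simp [wedge_zero_apply, conjCov_apply]
    | succ k ih =>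
      intro α β
      refine alt_succ_ext fun v => ?_
      rw [contr_conjCov, contr_wedge, contr_wedge, conjCov_add, contr_conjCov, contr_conjCov,
        ← conjCov_gradeInv, Pi.add_apply, Pi.add_apply, ih, ih]
  exact funext fun k => this k α β

/-- Subsets of `Fin (k + 1)`, by whether they contain `0` and what they contain of the rest. -/
def liftSet {k : ℕ} (b : Bool) (S : Finset (Fin k)) : Finset (Fin (k + 1)) :=
  Finset.univ.filter fun a =>
    Fin.cases (motive := fun _ => Bool) b (fun a => decide (a ∈ S)) a = true

theorem zero_mem_liftSet {k : ℕ} (b : Bool) (S : Finset (Fin k)) :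
    (0 : Fin (k + 1)) ∈ liftSet b S ↔ b = true := by
  simp [liftSet]

theorem succ_mem_liftSet {k : ℕ} (b : Bool) (S : Finset (Fin k)) (a : Fin k) :
    a.succ ∈ liftSet b S ↔ a ∈ S := by
  simp [liftSet]

theorem sum_liftSet {k : ℕ} (F : Finset (Fin (k + 1)) → ℂ) :
    ∑ S, F S = ∑ S, F (liftSet false S) + ∑ S, F (liftSet true S) := by
  have hb : Function.Bijective (fun q : Bool × Finset (Fin k) => liftSet q.1 q.2) := by
    rw [Fintype.bijective_iff_injective_and_card]
    constructor
    · rintro ⟨b, S⟩ ⟨b', S'⟩ h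
      simp only at h
      ext1
      · have : (b = true) ↔ (b' = true) := by
          rw [← zero_mem_liftSet b S, ← zero_mem_liftSet b' S', h]
        exact Bool.eq_iff_iff.mpr this
      · ext a
        rw [← succ_mem_liftSet b S, ← succ_mem_liftSet b' S', h]
    · simp [pow_succ, mul_comm]
  rw [← (Equiv.ofBijective _ hb).sum_comp, Fintype.sum_prod_type]
  simp [add_comm]

theorem card_liftSet {k : ℕ} (b : Bool) (S : Finset (Fin k)) :
    (liftSet b S).card = S.card + (if b then 1 else 0) := by
  have h : ∀ {m : ℕ} (T : Finset (Fin m)), T.card = ∑ a, if a ∈ T then 1 else 0 := by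
    intro m T; simp
  rw [h, Fin.sum_univ_succ]
  simp only [zero_mem_liftSet, succ_mem_liftSet]
  rw [← h, add_comm]

theorem rotate_liftSet {n k : ℕ} (b : Bool) (T : Finset (Fin k)) (v : Model n)
    (w : Fin k → Model n) : rotate (liftSet b T) (Fin.cons v w : Fin (k + 1) → Model n) =
      Fin.cons (if b then Complex.I • v else v) (rotate T w) := by
  funext a
  refine Fin.cases ?_ (fun a => ?_) a
  · simp [rotate, zero_mem_liftSet]
  · simp [rotate, succ_mem_liftSet]

theorem slotCoeff_liftSet {k : ℕ} (b c : Bool) (S T : Finset (Fin k)) :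
    slotCoeff (liftSet b S) (liftSet c T) =
      (if c then (if b then -Complex.I / 2 else Complex.I / 2) else 1 / 2) * slotCoeff S T := by
  rw [slotCoeff, Fin.prod_univ_succ]
  simp only [zero_mem_liftSet, succ_mem_liftSet]
  rfl

/-- The first slot is projected to type `(1, 0)` or `(0, 1)` according to `b`, independently of the
others; this is what makes induction on the degree possible for the type operators. -/
theorem slotPart_liftSet {n k : ℕ} (α : Cov n) (b : Bool) (S : Finset (Fin k)) (v : Model n)
    (w : Fin k → Model n) :
    slotPart (α (k + 1)) (liftSet b S) (Fin.cons v w) =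
      1 / 2 * slotPart (contr v α k) S w +
      (if b then -Complex.I / 2 else Complex.I / 2) *
        slotPart (contr (Complex.I • v) α k) S w := by
  rw [slotPart, sum_liftSet]
  simp only [slotCoeff_liftSet, rotate_liftSet, slotPart, contr_apply, Finset.mul_sum]
  congr 1 <;> refine Finset.sum_congr rfl fun T _ => ?_ <;> simp [mul_assoc]

theorem slotPart_add {n k : ℕ} (α β : Alt n k) (S : Finset (Fin k)) (v : Fin k → Model n) :
    slotPart (α + β) S v = slotPart α S v + slotPart β S v := by
  simp [slotPart, mul_add, Finset.sum_add_distrib]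

theorem slotPart_smul {n k : ℕ} (c : ℂ) (α : Alt n k) (S : Finset (Fin k)) (v : Fin k → Model n) :
    slotPart (c • α) S v = c * slotPart α S v := by
  simp only [slotPart, Finset.mul_sum, ContinuousAlternatingMap.smul_apply, smul_eq_mul]
  exact Finset.sum_congr rfl fun T _ => by ring

/-- `thetaCov c` as a linear map. -/
def thetaL {n : ℕ} (c : ℝ) : Cov n →ₗ[ℂ] Cov n where
  toFun := thetaCov c
  map_add' α β := by
    funext k; ext w
    simp only [Pi.add_apply, ContinuousAlternatingMap.add_apply, thetaCov_apply, slotPart_add,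
      mul_add, Finset.sum_add_distrib]
  map_smul' a α := by
    funext k; ext w
    simp only [Pi.smul_apply, ContinuousAlternatingMap.smul_apply, thetaCov_apply, slotPart_smul,
      smul_eq_mul, Finset.mul_sum, RingHom.id_apply]
    exact Finset.sum_congr rfl fun e _ => by ring

theorem thetaL_apply {n : ℕ} (c : ℝ) (α : Cov n) : thetaL c α = thetaCov c α := rfl

theorem thetaL_zero_deg {n : ℕ} (c : ℝ) (α : Cov n) : thetaL c α 0 = α 0 := by
  refine alt_zero_ext fun w => ?_
  rw [thetaL_apply, thetaCov_apply, ← sum_slotPart (α 0) w]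
  refine Finset.sum_congr rfl fun S _ => ?_
  have : S = ∅ := Subsingleton.elim _ _
  subst this; simp

/-- `c v' + v''` contracted with a form, where `v = v' + v''` with `v'` of type `(1, 0)` and `v''`
of type `(0, 1)`. -/
def contrTheta {n : ℕ} (c : ℝ) (v : Model n) : Cov n →ₗ[ℂ] Cov n :=
  (((c : ℂ) + 1) / 2) • contr v - (Complex.I * ((c : ℂ) - 1) / 2) • contr (Complex.I • v)

/-- `θ_c` is the pullback by the endomorphism `v' + v'' ↦ c v' + v''` of the complexified tangent
space, so a contraction passes through it with its vector transformed. -/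
theorem contr_thetaL {n : ℕ} (c : ℝ) (v : Model n) (α : Cov n) :
    contr v (thetaL c α) = thetaL c (contrTheta c v α) := by
  funext k; ext w
  rw [contr_apply, thetaL_apply, thetaCov_apply, thetaL_apply, thetaCov_apply, sum_liftSet,
    ← Finset.sum_add_distrib]
  refine Finset.sum_congr rfl fun S _ => ?_
  have : contrTheta c v α k = (((c : ℂ) + 1) / 2) • contr v α k +
      (-(Complex.I * ((c : ℂ) - 1) / 2)) • contr (Complex.I • v) α k := by
    simp [contrTheta, sub_eq_add_neg]
  rw [slotPart_liftSet, slotPart_liftSet, card_liftSet, card_liftSet, this, slotPart_add,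
    slotPart_smul, slotPart_smul]
  simp only [if_true, Bool.false_eq_true, if_false, add_zero, pow_succ]
  ring

theorem thetaL_gradeInv {n : ℕ} (c : ℝ) (α : Cov n) :
    thetaL c (gradeInv α) = gradeInv (thetaL c α) := by
  funext k; ext w
  simp only [thetaL_apply, gradeInv_apply, ContinuousAlternatingMap.smul_apply, thetaCov_apply,
    slotPart_smul, smul_eq_mul, Finset.mul_sum]
  exact Finset.sum_congr rfl fun e _ => by ring

theorem contrTheta_wedge {n : ℕ} (c : ℝ) (v : Model n) (α β : Cov n) :
    contrTheta c v (wedge α β) = wedge (contrTheta c v α) β +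
      wedge (gradeInv α) (contrTheta c v β) := by
  simp only [contrTheta, LinearMap.sub_apply, LinearMap.smul_apply, contr_wedge]
  simp only [← wedgeL_apply, map_sub, map_smul, LinearMap.sub_apply, LinearMap.smul_apply]
  module

/-- Types add under the exterior product. In the induction this appears as the fact that `contrTheta
c v` is again an antiderivation. -/
theorem thetaL_wedge {n : ℕ} (c : ℝ) (α β : Cov n) :
    thetaL c (wedge α β) = wedge (thetaL c α) (thetaL c β) := by
  have : ∀ k, ∀ α β : Cov n, thetaL c (wedge α β) k = wedge (thetaL c α) (thetaL c β) k := by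
    intro k
    induction k with
    | zero =>
      intro α β
      refine alt_zero_ext fun w => ?_
      rw [thetaL_zero_deg]
      simp [wedge_zero_apply, thetaL_zero_deg]
    | succ k ih =>
      intro α β
      refine alt_succ_ext fun v => ?_
      rw [contr_thetaL, contrTheta_wedge, contr_wedge, map_add, contr_thetaL, contr_thetaL,
        ← thetaL_gradeInv, Pi.add_apply, Pi.add_apply, ih, ih]
  exact funext fun k => this k α β

theorem thetaL_inv_apply {n : ℕ} (c : ℝ) (hc : c ≠ 0) (α : Cov n) :
    thetaL c⁻¹ (thetaL c α) = α := thetaCov_inv c hc α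

theorem thetaL_apply_inv {n : ℕ} (c : ℝ) (hc : c ≠ 0) (α : Cov n) :
    thetaL c (thetaL c⁻¹ α) = α := by
  have := thetaCov_inv c⁻¹ (inv_ne_zero hc) α
  rwa [inv_inv] at this

theorem contrTheta_pullback {n : ℕ} (A : Model n →L[ℝ] Model n)
    (hA : ∀ v, A (Complex.I • v) = Complex.I • A v) (c : ℝ) (v : Model n) (α : Cov n) :
    contrTheta c v (pullback A α) = pullback A (contrTheta c (A v) α) := by
  simp only [contrTheta, LinearMap.sub_apply, LinearMap.smul_apply, contr_pullback, hA, map_sub,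
    map_smul]

theorem thetaL_pullback {n : ℕ} (A : Model n →L[ℝ] Model n)
    (hA : ∀ v, A (Complex.I • v) = Complex.I • A v) (c : ℝ) (α : Cov n) :
    thetaL c (pullback A α) = pullback A (thetaL c α) := by
  have : ∀ k, ∀ α : Cov n, thetaL c (pullback A α) k = pullback A (thetaL c α) k := by
    intro k
    induction k with
    | zero =>
      intro α
      refine alt_zero_ext fun w => ?_
      rw [thetaL_zero_deg]
      simp [pullback_apply, thetaL_zero_deg]
    | succ k ih =>
      intro α
      refine alt_succ_ext fun v => ?_
      rw [contr_thetaL, contrTheta_pullback A hA, contr_pullback, contr_thetaL, ih]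
  exact funext fun k => this k α

/-! ### Hermitian linear algebra in the real basis -/

/-- Index set of the real basis of `ℂⁿ`. -/
abbrev Idx (n : ℕ) : Type := Fin n × Fin 2

/-- The partner of a basis vector under the complex structure. -/
def partner {n : ℕ} (a : Idx n) : Idx n := (a.1, if a.2 = 0 then 1 else 0)

/-- The sign with which the complex structure maps a basis vector to its partner. -/
def partnerSign {n : ℕ} (a : Idx n) : ℝ := if a.2 = 0 then 1 else -1

theorem partner_partner {n : ℕ} (a : Idx n) : partner (partner a) = a := by
  obtain ⟨j, s⟩ := a
  fin_cases s <;> simp [partner]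

theorem partner_involutive {n : ℕ} : Function.Involutive (partner (n := n)) := partner_partner

theorem partnerSign_partner {n : ℕ} (a : Idx n) : partnerSign (partner a) = -partnerSign a := by
  obtain ⟨j, s⟩ := a
  fin_cases s <;> simp [partner, partnerSign]

theorem partnerSign_mul_self {n : ℕ} (a : Idx n) : partnerSign a * partnerSign a = 1 := by
  obtain ⟨j, s⟩ := a
  fin_cases s <;> simp [partnerSign]

theorem sum_partner {n : ℕ} {V : Type*} [AddCommMonoid V] (f : Idx n → V) :
    ∑ a, f (partner a) = ∑ a, f a :=
  (Equiv.ofBijective _ partner_involutive.bijective).sum_comp f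

theorem I_smul_realBasis {n : ℕ} (a : Idx n) :
    Complex.I • realBasis n a = partnerSign a • realBasis n (partner a) := by
  obtain ⟨j, s⟩ := a
  fin_cases s
  · simp [realBasis, partner, partnerSign, ← Pi.single_smul]
  · simp [realBasis, partner, partnerSign, ← Pi.single_smul, ← Pi.single_neg]

/-- The coordinates with respect to the real basis, as complex valued covectors. -/
def coord {n : ℕ} (a : Idx n) : Model n →L[ℝ] ℂ :=
  Complex.ofRealCLM.comp ((if a.2 = 0 then Complex.reCLM else Complex.imCLM).comp
    (ContinuousLinearMap.proj a.1))

/-- The real coordinates with respect to the real basis. -/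
def coordR {n : ℕ} (a : Idx n) (v : Model n) : ℝ := if a.2 = 0 then (v a.1).re else (v a.1).im

theorem coord_apply {n : ℕ} (a : Idx n) (v : Model n) : coord a v = (coordR a v : ℂ) := by
  obtain ⟨j, s⟩ := a
  fin_cases s <;> simp [coord, coordR]

theorem coordR_realBasis {n : ℕ} (a b : Idx n) :
    coordR a (realBasis n b) = if a = b then 1 else 0 := by
  obtain ⟨j, s⟩ := a
  obtain ⟨j', s'⟩ := b
  by_cases hj : j = j'
  · subst hj
    fin_cases s <;> fin_cases s' <;> simp [coordR, realBasis]
  · fin_cases s <;> fin_cases s' <;> simp [coordR, realBasis, hj]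

theorem sum_coordR {n : ℕ} (v : Model n) : ∑ a, coordR a v • realBasis n a = v := by
  rw [Fintype.sum_prod_type]
  funext j
  rw [Finset.sum_apply, Finset.sum_eq_single j]
  · rw [Fin.sum_univ_two]
    apply Complex.ext <;> simp [coordR, realBasis]
  · intro b _ hb
    rw [Fin.sum_univ_two]
    simp [realBasis, Pi.single_eq_of_ne hb.symm]
  · simp

theorem contr_expand {n : ℕ} (v : Model n) :
    contr v = ∑ a, coord a v • contr (realBasis n a) := by
  conv_lhs => rw [← sum_coordR v]
  have : ∀ s : Finset (Idx n), contr (∑ a ∈ s, coordR a v • realBasis n a) =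
      ∑ a ∈ s, coord a v • contr (realBasis n a) := by
    intro s
    induction s using Finset.induction_on with
    | empty => simp [contr_zero]
    | insert a s ha ih =>
      rw [Finset.sum_insert ha, Finset.sum_insert ha, contr_add, ih, contr_smul, coord_apply]
  exact this _

theorem covector_expand {n : ℕ} (ξ : Model n →L[ℝ] ℂ) :
    ξ = ∑ a, ξ (realBasis n a) • coord a := by
  ext v
  conv_lhs => rw [← sum_coordR v, map_sum]
  simp [coord_apply, mul_comm]

/-- Exterior multiplication by the dual basis covectors. -/
def extB {n : ℕ} (a : Idx n) : Module.End ℂ (Cov n) := ext (coord a)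

/-- Contraction with the basis vectors. -/
def contrB {n : ℕ} (a : Idx n) : Module.End ℂ (Cov n) := contr (realBasis n a)

/-- Contraction with the complex structure applied to the basis vectors. -/
def contrJ {n : ℕ} (a : Idx n) : Module.End ℂ (Cov n) := contr (Complex.I • realBasis n a)

theorem contrJ_eq {n : ℕ} (a : Idx n) :
    contrJ a = (partnerSign a : ℂ) • contrB (partner a) := by
  rw [contrJ, I_smul_realBasis, contr_smul, contrB]

theorem contr_mul_ext {n : ℕ} (v : Model n) (ξ : Model n →L[ℝ] ℂ) :
    (contr v * ext ξ : Module.End ℂ (Cov n)) = ξ v • (1 : Module.End ℂ (Cov n)) - ext ξ * contr v :=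
  LinearMap.ext fun α => contr_ext v ξ α

/-- Contraction with the vector dual to a covector, for the inverse Gram matrix `P`. -/
def sharp {n : ℕ} (P : Matrix (Idx n) (Idx n) ℝ) (ξ : Model n →L[ℝ] ℂ) : Module.End ℂ (Cov n) :=
  ∑ a, ∑ b, ((P a b : ℂ) * ξ (realBasis n b)) • contrB a

theorem sharp_smul {n : ℕ} (P : Matrix (Idx n) (Idx n) ℝ) (c : ℂ) (ξ : Model n →L[ℝ] ℂ) :
    sharp P (c • ξ) = c • sharp P ξ := by
  simp only [sharp, Finset.smul_sum, smul_smul, smul_apply, smul_eq_mul]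
  refine Finset.sum_congr rfl fun a _ => Finset.sum_congr rfl fun b _ => ?_
  congr 1; ring

/-- `sharp` for the dual basis. -/
def sharpB {n : ℕ} (P : Matrix (Idx n) (Idx n) ℝ) (a : Idx n) : Module.End ℂ (Cov n) :=
  ∑ c, (P c a : ℂ) • contrB c

theorem coord_realBasis {n : ℕ} (a b : Idx n) :
    coord a (realBasis n b) = if a = b then 1 else 0 := by
  rw [coord_apply, coordR_realBasis]; split_ifs <;> simp

theorem sharp_coord {n : ℕ} (P : Matrix (Idx n) (Idx n) ℝ) (a : Idx n) :
    sharp P (coord a) = sharpB P a := by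
  simp [sharp, sharpB, coord_realBasis]

/-- Multiplication by `i` as a real linear map. -/
def cplx {n : ℕ} : Model n →L[ℝ] Model n :=
  (Complex.I • ContinuousLinearMap.id ℂ (Model n)).restrictScalars ℝ

/-- The covector `ξ ∘ J`. -/
def compJ {n : ℕ} (ξ : Model n →L[ℝ] ℂ) : Model n →L[ℝ] ℂ := ξ.comp cplx

theorem compJ_apply {n : ℕ} (ξ : Model n →L[ℝ] ℂ) (v : Model n) : compJ ξ v = ξ (Complex.I • v) :=
  rfl

theorem compJ_compJ {n : ℕ} (ξ : Model n →L[ℝ] ℂ) : compJ (compJ ξ) = -ξ := by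
  ext v
  rw [compJ_apply, compJ_apply, smul_smul, Complex.I_mul_I]
  simp

theorem compJ_coord {n : ℕ} (a : Idx n) :
    compJ (coord a) = -(partnerSign a : ℂ) • coord (partner a) := by
  ext v
  obtain ⟨j, s⟩ := a
  rw [compJ_apply, smul_apply, coord_apply, coord_apply]
  fin_cases s <;> simp [coordR, partner, partnerSign]

/-! ### Compatibility with the complex structure -/

/-- A matrix in the real basis which is invariant under the complex structure. -/
def JInvariant {n : ℕ} (P : Matrix (Idx n) (Idx n) ℝ) : Prop :=
  ∀ a b, P (partner a) (partner b) = partnerSign a * partnerSign b * P a b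

/-- `P` is invariant under `J` and `J² = -1`, so `J` can be moved from the first index to the second
at the cost of a sign. -/
theorem JInvariant.sum_left {n : ℕ} {P : Matrix (Idx n) (Idx n) ℝ} (hP : JInvariant P)
    {V : Type*} [AddCommGroup V] [Module ℂ V] (f : Idx n → Idx n → V) :
    ∑ a, ∑ b, ((P a b : ℂ) * partnerSign a) • f (partner a) b =
      -∑ a, ∑ b, ((P a b : ℂ) * partnerSign b) • f a (partner b) := by
  rw [← sum_partner, ← Finset.sum_neg_distrib]
  refine Finset.sum_congr rfl fun a _ => ?_
  rw [← sum_partner, ← Finset.sum_neg_distrib]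
  refine Finset.sum_congr rfl fun b _ => ?_
  rw [partner_partner, hP, partnerSign_partner, ← neg_smul]
  congr 1
  have := partnerSign_mul_self a
  push_cast
  have h : (partnerSign a : ℂ) * partnerSign a = 1 := by exact_mod_cast this
  linear_combination -(partnerSign b : ℂ) * P a b * h

/-- The transform of `P` by `J` is also a left inverse of `G`, hence equal to `P`. -/
theorem JInvariant.inv {n : ℕ} {P G : Matrix (Idx n) (Idx n) ℝ} (hG : JInvariant G)
    (hPG : P * G = 1) : JInvariant P := by
  have hGP : G * P = 1 := mul_eq_one_comm.mp hPG
  let P' : Matrix (Idx n) (Idx n) ℝ := Matrix.of fun a b =>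
    partnerSign a * partnerSign b * P (partner a) (partner b)
  have h : P' * G = 1 := by
    ext a c
    have h1 := congrFun (congrFun hPG (partner a)) (partner c)
    rw [Matrix.mul_apply] at h1 ⊢
    rw [← sum_partner] at h1
    have h2 : ∀ b, P' a b * G b c = partnerSign a * partnerSign c *
        (P (partner a) (partner b) * G (partner b) (partner c)) := by
      intro b
      rw [hG b c]
      simp only [P', Matrix.of_apply]
      have := partnerSign_mul_self b
      have := partnerSign_mul_self c
      linear_combination -partnerSign a * partnerSign b * P (partner a) (partner b) * G b c * this
    rw [Finset.sum_congr rfl fun b _ => h2 b, ← Finset.mul_sum, h1, Matrix.one_apply,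
      Matrix.one_apply]
    by_cases hac : a = c
    · subst hac; simp [partnerSign_mul_self]
    · have : partner a ≠ partner c := fun h => hac (partner_involutive.injective h)
      simp [hac, this]
  have hP : P' = P := by
    calc P' = P' * (G * P) := by rw [hGP, mul_one]
      _ = P := by rw [← mul_assoc, h, one_mul]
  intro a b
  have := congrFun (congrFun hP a) b
  simp only [P', Matrix.of_apply] at this
  rw [← this]
  have h1 := partnerSign_mul_self a
  have h2 := partnerSign_mul_self b
  linear_combination -(P (partner a) (partner b)) * partnerSign b * partnerSign b * h1 -
    P (partner a) (partner b) * h2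

/-- The contraction operator `Λ` of the metric with inverse Gram matrix `P`. -/
def lam {n : ℕ} (P : Matrix (Idx n) (Idx n) ℝ) : Module.End ℂ (Cov n) :=
  (1 / 2 : ℂ) • ∑ a, ∑ b, (P a b : ℂ) • (contrJ a * contrB b)

/-- The commutator of `Λ` and the exterior multiplication by a covector. -/
theorem lam_mul_ext {n : ℕ} {P : Matrix (Idx n) (Idx n) ℝ} (hP : JInvariant P) (hs : P.IsSymm)
    (ξ : Model n →L[ℝ] ℂ) :
    lam P * ext ξ = ext ξ * lam P - sharp P (compJ ξ) := by
  have h1 : ∀ a b, (contrJ a * contrB b) * ext ξ = ext ξ * (contrJ a * contrB b) +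
      (ξ (realBasis n b) • contrJ a - compJ ξ (realBasis n a) • contrB b) := by
    intro a b
    rw [mul_assoc, contrB, contr_mul_ext, mul_sub, ← mul_assoc, contrJ, contr_mul_ext, compJ_apply]
    simp only [sub_mul, mul_smul_comm, smul_mul_assoc, one_mul, mul_one, mul_assoc]
    abel
  -- By invariance under `J`, either of the two contractions in `Λ` can absorb `ξ` with the same
  -- result; this compensates for the factor `1 / 2` in `lam`.
  have h2 : ∑ a, ∑ b, (P a b : ℂ) • (ξ (realBasis n b) • contrJ a) = -sharp P (compJ ξ) := by
    have := hP.sum_left (fun a b => ξ (realBasis n b) • (contrB a : Module.End ℂ (Cov n)))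
    rw [sharp]
    convert this using 1
    · refine Finset.sum_congr rfl fun a _ => Finset.sum_congr rfl fun b _ => ?_
      rw [contrJ_eq, smul_smul, smul_smul, smul_smul]
      congr 1; ring
    · congr 1
      refine Finset.sum_congr rfl fun a _ => Finset.sum_congr rfl fun b _ => ?_
      rw [compJ_apply, I_smul_realBasis, map_smul, smul_smul, Complex.real_smul]
      congr 1; ring
  have h3 : ∑ a, ∑ b, (P a b : ℂ) • (compJ ξ (realBasis n a) • contrB b) = sharp P (compJ ξ) := by
    rw [Finset.sum_comm, sharp]
    refine Finset.sum_congr rfl fun a _ => Finset.sum_congr rfl fun b _ => ?_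
    rw [smul_smul, hs.apply]
  rw [lam, smul_mul_assoc, Finset.sum_mul, mul_smul_comm, Finset.mul_sum]
  simp only [Finset.sum_mul, Finset.mul_sum, smul_mul_assoc, mul_smul_comm, h1, smul_add, smul_sub,
    Finset.sum_add_distrib, Finset.sum_sub_distrib, h2, h3]
  module

/-- The exterior multiplication by the `(1, 1)`-form with Gram matrix `G`. -/
def lef {n : ℕ} (G : Matrix (Idx n) (Idx n) ℝ) : Module.End ℂ (Cov n) :=
  (1 / 2 : ℂ) • ∑ a, ∑ b, ((G a b : ℂ) * partnerSign b) • (extB a * extB (partner b))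

/-- The Gram matrix of the symmetric form `w(·, J ·)`. -/
def gramOf {n : ℕ} (w : Alt n 2) : Matrix (Idx n) (Idx n) ℝ :=
  Matrix.of fun a b => (w ![realBasis n a, Complex.I • realBasis n b]).re

theorem alt_two_neg {n : ℕ} (w : Alt n 2) (v u : Model n) : w ![v, u] = - w ![u, v] := by
  have := w.toAlternatingMap.map_swap ![u, v] (i := 0) (j := 1) (by simp)
  have h : (![u, v] ∘ Equiv.swap 0 1 : Fin 2 → Model n) = ![v, u] := by
    funext a; fin_cases a <;> rfl
  rw [h] at this
  exact this

/-- A real form of type `(1, 1)`. -/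
structure IsReal11 {n : ℕ} (w : Alt n 2) : Prop where
  real : ∀ v, (w v).im = 0
  invariant : ∀ v u : Model n, w ![Complex.I • v, Complex.I • u] = w ![v, u]

theorem IsReal11.gramOf_coe {n : ℕ} {w : Alt n 2} (hw : IsReal11 w) (a b : Idx n) :
    (gramOf w a b : ℂ) = w ![realBasis n a, Complex.I • realBasis n b] := by
  apply Complex.ext
  · simp [gramOf]
  · simp [hw.real]

theorem alt_two_smul_right {n : ℕ} (w : Alt n 2) (r : ℝ) (v u : Model n) :
    w ![v, r • u] = r * w ![v, u] := by
  have := w.map_update_smul ![v, u] 1 r u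
  have h1 : ∀ x, Function.update ![v, u] 1 x = ![v, x] := by
    intro x; funext a; fin_cases a <;> simp
  rw [h1, h1] at this
  rw [this, Complex.real_smul]

theorem IsReal11.symm {n : ℕ} {w : Alt n 2} (hw : IsReal11 w) : (gramOf w).IsSymm := by
  ext a b
  rw [Matrix.transpose_apply]
  have : (gramOf w b a : ℂ) = gramOf w a b := by
    rw [hw.gramOf_coe, hw.gramOf_coe, ← hw.invariant, smul_smul, Complex.I_mul_I]
    have h : (-1 : ℂ) • realBasis n a = (-1 : ℝ) • realBasis n a := by simp
    rw [h, alt_two_smul_right, alt_two_neg]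
    simp
  exact_mod_cast this

theorem IsReal11.jInvariant {n : ℕ} {w : Alt n 2} (hw : IsReal11 w) : JInvariant (gramOf w) := by
  intro a b
  have h : ∀ a b, (gramOf w (partner a) b : ℝ) = -partnerSign a * partnerSign b *
      gramOf w a (partner b) := by
    intro a b
    have : (gramOf w (partner a) b : ℂ) = -partnerSign a * partnerSign b *
      gramOf w a (partner b) := by
      rw [hw.gramOf_coe, hw.gramOf_coe, I_smul_realBasis, I_smul_realBasis, partner_partner,
        alt_two_smul_right, alt_two_smul_right, ← hw.invariant, I_smul_realBasis,
        I_smul_realBasis, partner_partner, alt_two_smul_right, alt_two_neg, alt_two_smul_right,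
        alt_two_neg]
      rw [partner_partner, partnerSign_partner, partnerSign_partner]
      push_cast
      ring
    exact_mod_cast this
  rw [h a, partner_partner, partnerSign_partner]
  ring

/-- Writes multiplication by a `(1, 1)`-form as a quadratic expression in the `eᵃ ∧ ·`. Both
operators have no component of degree zero in their values and the same commutators with
contractions, which is the criterion of `op_ext`. -/
theorem wedgeL_single_two {n : ℕ} {w : Alt n 2} (hw : IsReal11 w) :
    wedgeL (Pi.single 2 w : Cov n) = lef (gramOf w) := by
  have hval : ∀ a b, (w ![realBasis n a, realBasis n b] : ℂ) =
      -partnerSign b * gramOf w a (partner b) := by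
    intro a b
    rw [hw.gramOf_coe, I_smul_realBasis, partner_partner, alt_two_smul_right, partnerSign_partner]
    have h1 : (partnerSign b : ℂ) * partnerSign b = 1 := by
      exact_mod_cast partnerSign_mul_self b
    push_cast
    linear_combination -w ![realBasis n a, realBasis n b] * h1
  have hlef : lef (gramOf w) = (1 / 2 : ℂ) • ∑ a, ∑ b,
      w ![realBasis n a, realBasis n b] • (extB a * extB b) := by
    rw [lef]
    congr 1
    refine Finset.sum_congr rfl fun a _ => ?_
    rw [← sum_partner]
    refine Finset.sum_congr rfl fun b _ => ?_
    rw [hval, partner_partner, partnerSign_partner]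
    congr 1
    push_cast; ring
  have hcurry : ∀ v, contr v (Pi.single 2 w : Cov n) =
      oneForm (∑ b, (∑ a, coord a v * w ![realBasis n a, realBasis n b]) • coord b) := by
    intro v
    have h1 : ∀ v, contr v (Pi.single 2 w : Cov n) =
        oneForm ((ContinuousAlternatingMap.ofSubsingleton ℝ (Model n) ℂ (0 : Fin 1)).symm
          (w.curryLeft v)) := by
      intro v
      rw [oneForm_def, Equiv.apply_symm_apply, contr_single_succ]
    have h2 : ∀ v u, (ContinuousAlternatingMap.ofSubsingleton ℝ (Model n) ℂ (0 : Fin 1)).symm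
          (w.curryLeft v) u = w ![v, u] := by
      intro v u
      change w (Matrix.vecCons v _) = w ![v, u]
      congr 2
      funext a
      fin_cases a
      rfl
    have h3 : ∀ v u, w ![v, u] = ∑ b, w ![v, realBasis n b] * coord b u := by
      intro v u
      have := congrArg (fun ξ : Model n →L[ℝ] ℂ => ξ u) (covector_expand
        ((ContinuousAlternatingMap.ofSubsingleton ℝ (Model n) ℂ (0 : Fin 1)).symm
          (w.curryLeft v)))
      simpa [h2, sum_apply] using this
    rw [h1, covector_expand ((ContinuousAlternatingMap.ofSubsingleton ℝ (Model n) ℂ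
      (0 : Fin 1)).symm (w.curryLeft v))]
    congr 1
    refine Finset.sum_congr rfl fun b _ => ?_
    rw [h2, alt_two_neg, h3, ← Finset.sum_neg_distrib]
    congr 1
    refine Finset.sum_congr rfl fun a _ => ?_
    rw [alt_two_neg w (realBasis n a)]
    ring
  have hcomm : ∀ v, (contr v : Module.End ℂ (Cov n)) * ((1 / 2 : ℂ) • ∑ a, ∑ b,
      w ![realBasis n a, realBasis n b] • (extB a * extB b)) =
      ext (∑ b, (∑ a, coord a v * w ![realBasis n a, realBasis n b]) • coord b) +
      ((1 / 2 : ℂ) • ∑ a, ∑ b, w ![realBasis n a, realBasis n b] • (extB a * extB b)) *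
        contr v := by
    intro v
    have h1 : ∀ a b, (contr v : Module.End ℂ (Cov n)) * (extB a * extB b) =
        coord a v • extB b - coord b v • extB a + (extB a * extB b) * contr v := by
      intro a b
      rw [← mul_assoc, extB, contr_mul_ext, sub_mul, mul_assoc, extB, contr_mul_ext, mul_sub,
        smul_mul_assoc, one_mul, mul_smul_comm, mul_one, mul_assoc]
      abel
    have h2 : ∑ a, ∑ b, w ![realBasis n a, realBasis n b] • (coord b v • (extB a : Module.End ℂ (Cov n))) =
        - ∑ a, ∑ b, w ![realBasis n a, realBasis n b] • (coord a v • extB b) := by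
      rw [Finset.sum_comm, ← Finset.sum_neg_distrib]
      refine Finset.sum_congr rfl fun a _ => ?_
      rw [← Finset.sum_neg_distrib]
      refine Finset.sum_congr rfl fun b _ => ?_
      rw [alt_two_neg, neg_smul]
    have h3 : (ext (∑ b, (∑ a, coord a v * w ![realBasis n a, realBasis n b]) • coord b) :
        Module.End ℂ (Cov n)) =
        ∑ a, ∑ b, w ![realBasis n a, realBasis n b] • (coord a v • extB b) := by
      rw [ext, map_sum, map_sum, Finset.sum_comm]
      refine Finset.sum_congr rfl fun b _ => ?_
      rw [map_smul, map_smul, Finset.sum_smul]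
      refine Finset.sum_congr rfl fun a _ => ?_
      rw [smul_smul, mul_comm]
      rfl
    rw [h3, mul_smul_comm, smul_mul_assoc]
    simp only [Finset.sum_mul, Finset.mul_sum, mul_smul_comm, smul_mul_assoc, h1, smul_add,
      smul_sub, Finset.sum_add_distrib, Finset.sum_sub_distrib, h2]
    module
  rw [hlef]
  refine op_ext ?_ ?_
  · intro α
    refine alt_zero_ext fun x => ?_
    rw [wedgeL_apply, wedge_zero_apply]
    simp [extB, ext_zero_deg]
  · intro k ih v α
    have h1 := LinearMap.congr_fun (hcomm v) α
    simp only [Module.End.mul_apply, LinearMap.add_apply] at h1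
    rw [h1, wedgeL_apply, contr_wedge, hcurry, gradeInv_single, neg_one_sq, one_smul,
      ← wedgeL_apply (Pi.single 2 w), Pi.add_apply, Pi.add_apply, ih]
    rfl

/-- The adjoint of `lef G` for the metric with inverse Gram matrix `P`. -/
def lefAdj {n : ℕ} (P G : Matrix (Idx n) (Idx n) ℝ) : Module.End ℂ (Cov n) :=
  (1 / 2 : ℂ) • ∑ a, ∑ b, ((G a b : ℂ) * partnerSign b) • (sharpB P (partner b) * sharpB P a)

theorem sharpB_partner {n : ℕ} {P : Matrix (Idx n) (Idx n) ℝ} (hP : JInvariant P) (b : Idx n) :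
    sharpB P (partner b) = (partnerSign b : ℂ) • ∑ c, (P c b : ℂ) • contrJ c := by
  rw [sharpB, ← sum_partner, Finset.smul_sum]
  refine Finset.sum_congr rfl fun c _ => ?_
  rw [hP, contrJ_eq, smul_smul, smul_smul]
  congr 1
  push_cast; ring

/-- The two factors `sharpB` raise both indices of `G`, and the partner and sign in `lef` become `J`
on a raised index. If `G` is the derivative of the Gram matrix, `P * G * P` is minus the derivative
of its inverse; this links the derivative of `Λ` with the adjoint of `∂ₐω ∧ ·`. -/
theorem lefAdj_eq {n : ℕ} {P G : Matrix (Idx n) (Idx n) ℝ} (hP : JInvariant P) (hs : P.IsSymm)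
    (hG : G.IsSymm) : lefAdj P G = lam (P * G * P) := by
  rw [lefAdj, lam]
  congr 1
  have h : ∀ a b, ((G a b : ℂ) * partnerSign b) • (sharpB P (partner b) * sharpB P a) =
      ∑ c, ∑ d, ((P c b * G b a * P a d : ℝ) : ℂ) • (contrJ c * contrB d) := by
    intro a b
    rw [sharpB_partner hP, sharpB, smul_mul_assoc, smul_smul, Finset.sum_mul]
    have h1 : (partnerSign b : ℂ) * partnerSign b = 1 := by
      exact_mod_cast partnerSign_mul_self b
    rw [mul_assoc, h1, Finset.smul_sum]
    refine Finset.sum_congr rfl fun c _ => ?_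
    rw [Finset.mul_sum, Finset.smul_sum]
    refine Finset.sum_congr rfl fun d _ => ?_
    rw [smul_mul_assoc, mul_smul_comm, smul_smul, smul_smul, hG.apply, hs.apply a d]
    congr 1
    push_cast; ring
  simp only [h]
  have h2 : ∀ F : Idx n → Idx n → Idx n → Idx n → Module.End ℂ (Cov n),
      ∑ a, ∑ b, ∑ c, ∑ d, F a b c d = ∑ c, ∑ d, ∑ a, ∑ b, F a b c d := by
    intro F
    have h3 : ∀ a, ∑ b, ∑ c, ∑ d, F a b c d = ∑ c, ∑ d, ∑ b, F a b c d := by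
      intro a
      rw [Finset.sum_comm]
      exact Finset.sum_congr rfl fun c _ => Finset.sum_comm
    rw [Finset.sum_congr rfl fun a _ => h3 a, Finset.sum_comm]
    exact Finset.sum_congr rfl fun c _ => Finset.sum_comm
  rw [h2]
  refine Finset.sum_congr rfl fun c _ => Finset.sum_congr rfl fun d _ => ?_
  simp only [← Finset.sum_smul]
  congr 1
  rw [Matrix.mul_apply]
  push_cast
  refine Finset.sum_congr rfl fun a _ => ?_
  rw [Matrix.mul_apply]
  push_cast
  rw [Finset.sum_mul]

theorem lam_mul_extB {n : ℕ} {P : Matrix (Idx n) (Idx n) ℝ} (hP : JInvariant P) (hs : P.IsSymm)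
    (a : Idx n) :
    lam P * extB a = extB a * lam P + (partnerSign a : ℂ) • sharpB P (partner a) := by
  rw [extB, lam_mul_ext hP hs, compJ_coord, sharp_smul, sharp_coord, neg_smul, sub_neg_eq_add]

theorem sharpB_mul_extB {n : ℕ} (P : Matrix (Idx n) (Idx n) ℝ) (a b : Idx n) :
    sharpB P a * extB b = (P b a : ℂ) • (1 : Module.End ℂ (Cov n)) - extB b * sharpB P a := by
  simp only [sharpB, Finset.sum_mul, Finset.mul_sum, smul_mul_assoc, mul_smul_comm, contrB, extB,
    contr_mul_ext, smul_sub, Finset.sum_sub_distrib, coord_realBasis]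
  congr 1
  simp [ite_smul]

/-- The commutator of `Λ` with the exterior multiplication by a `(1, 1)`-form. -/
def lefBracket {n : ℕ} (P G : Matrix (Idx n) (Idx n) ℝ) : Module.End ℂ (Cov n) :=
  ((1 / 2 : ℂ) * ((P * G).trace : ℝ)) • (1 : Module.End ℂ (Cov n)) -
    ∑ a, ∑ b, (G a b : ℂ) • (extB a * sharpB P b)

/-- Two applications of `lam_mul_extB`. Moving contractions to the right leaves the trace as a
scalar term, and the two remaining sums coincide by invariance under `J`. -/
theorem lam_mul_lef {n : ℕ} {P G : Matrix (Idx n) (Idx n) ℝ} (hP : JInvariant P) (hs : P.IsSymm)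
    (hG : JInvariant G) (hGs : G.IsSymm) :
    lam P * lef G = lef G * lam P + lefBracket P G := by
  have h : ∀ a b, lam P * (extB a * extB (partner b)) = (extB a * extB (partner b)) * lam P +
      ((partnerSign a : ℂ) * P (partner b) (partner a)) • (1 : Module.End ℂ (Cov n)) -
      (partnerSign a : ℂ) • (extB (partner b) * sharpB P (partner a)) -
      (partnerSign b : ℂ) • (extB a * sharpB P b) := by
    intro a b
    rw [← mul_assoc, lam_mul_extB hP hs, add_mul, smul_mul_assoc, sharpB_mul_extB, mul_assoc,
      lam_mul_extB hP hs, partner_partner, partnerSign_partner, smul_sub, smul_smul, mul_add,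
      mul_smul_comm]
    push_cast
    rw [neg_smul, mul_assoc]
    abel
  have hb : ∀ b : Idx n, (partnerSign b : ℂ) * partnerSign b = 1 := fun b => by
    exact_mod_cast partnerSign_mul_self b
  have t1 : ∑ a, ∑ b, ((G a b : ℂ) * partnerSign b) • (((partnerSign a : ℂ) *
      P (partner b) (partner a)) • (1 : Module.End ℂ (Cov n))) =
      (((P * G).trace : ℝ) : ℂ) • (1 : Module.End ℂ (Cov n)) := by
    rw [Matrix.trace, Finset.sum_comm]
    simp only [smul_smul, ← Finset.sum_smul, Matrix.diag_apply, Matrix.mul_apply]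
    congr 1
    push_cast
    refine Finset.sum_congr rfl fun b _ => Finset.sum_congr rfl fun a _ => ?_
    rw [hP]
    push_cast
    linear_combination ((G a b : ℂ) * P b a * partnerSign b * partnerSign b) * hb a +
      (G a b : ℂ) * P b a * hb b
  have t2 : ∑ a, ∑ b, ((G a b : ℂ) * partnerSign b) • ((partnerSign a : ℂ) •
      (extB (partner b) * sharpB P (partner a))) = ∑ a, ∑ b, (G a b : ℂ) • (extB a * sharpB P b) := by
    rw [Finset.sum_comm]
    conv_rhs => rw [← sum_partner]
    refine Finset.sum_congr rfl fun b _ => ?_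
    conv_rhs => rw [← sum_partner]
    refine Finset.sum_congr rfl fun a _ => ?_
    rw [hG, smul_smul, hGs.apply b a]
    congr 1
    push_cast; ring
  have t3 : ∑ a, ∑ b, ((G a b : ℂ) * partnerSign b) • ((partnerSign b : ℂ) •
      (extB a * sharpB P b)) = ∑ a, ∑ b, (G a b : ℂ) • (extB a * sharpB P b) := by
    refine Finset.sum_congr rfl fun b _ => Finset.sum_congr rfl fun a _ => ?_
    rw [smul_smul, mul_assoc, hb, mul_one]
  rw [lef, mul_smul_comm, smul_mul_assoc]
  simp only [Finset.sum_mul, Finset.mul_sum, mul_smul_comm, smul_mul_assoc, h, smul_add, smul_sub,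
    Finset.sum_add_distrib, Finset.sum_sub_distrib, t1, t2, t3, lefBracket]
  module

/-! ### The induced inner product on forms -/

open Nat in
/-- The inner product of the components of degree `k`, for the inverse Gram matrix `P`. -/
def innerDeg {n : ℕ} (P : Matrix (Idx n) (Idx n) ℝ) (k : ℕ) : Cov n →ₗ[ℂ] Cov n →ₗ⋆[ℂ] ℂ :=
  LinearMap.mk₂'ₛₗ (RingHom.id ℂ) (starRingEnd ℂ)
    (fun α β => ((k ! : ℂ))⁻¹ * ∑ i : Fin k → Idx n, ∑ j : Fin k → Idx n,
      ((∏ a, P (i a) (j a) : ℝ) : ℂ) * (α k fun a => realBasis n (i a)) *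
        (starRingEnd ℂ) (β k fun a => realBasis n (j a)))
    (fun α α' β => by
      simp only [Pi.add_apply, ContinuousAlternatingMap.add_apply, mul_add, add_mul,
        Finset.sum_add_distrib])
    (fun c α β => by
      simp only [Pi.smul_apply, ContinuousAlternatingMap.smul_apply, smul_eq_mul, Finset.mul_sum,
        RingHom.id_apply]
      exact Finset.sum_congr rfl fun i _ => Finset.sum_congr rfl fun j _ => by ring)
    (fun α β β' => by
      simp only [Pi.add_apply, ContinuousAlternatingMap.add_apply, mul_add, map_add,
        Finset.sum_add_distrib])
    (fun c α β => by
      simp only [Pi.smul_apply, ContinuousAlternatingMap.smul_apply, smul_eq_mul, Finset.mul_sum,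
        map_mul]
      exact Finset.sum_congr rfl fun i _ => Finset.sum_congr rfl fun j _ => by ring)

open Nat in
theorem innerDeg_apply {n : ℕ} (P : Matrix (Idx n) (Idx n) ℝ) (k : ℕ) (α β : Cov n) :
    innerDeg P k α β = ((k ! : ℂ))⁻¹ * ∑ i : Fin k → Idx n, ∑ j : Fin k → Idx n,
      ((∏ a, P (i a) (j a) : ℝ) : ℂ) * (α k fun a => realBasis n (i a)) *
        (starRingEnd ℂ) (β k fun a => realBasis n (j a)) := rfl

theorem innerDeg_congr {n : ℕ} (P : Matrix (Idx n) (Idx n) ℝ) (k : ℕ) {α α' β β' : Cov n}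
    (h : α k = α' k) (h' : β k = β' k) : innerDeg P k α β = innerDeg P k α' β' := by
  rw [innerDeg_apply, innerDeg_apply, h, h']

theorem innerDeg_zero {n : ℕ} (P : Matrix (Idx n) (Idx n) ℝ) (α β : Cov n) (w : Fin 0 → Model n) :
    innerDeg P 0 α β = α 0 w * (starRingEnd ℂ) (β 0 w) := by
  have : ∀ w', w' = w := fun w' => Subsingleton.elim _ _
  rw [innerDeg_apply]
  simp [this]

theorem sum_fin_cons {ι : Type*} [Fintype ι] {V : Type*} [AddCommMonoid V] {k : ℕ}
    (F : (Fin (k + 1) → ι) → V) : ∑ i, F i = ∑ a, ∑ i : Fin k → ι, F (Fin.cons a i) := by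
  rw [← (Fin.consEquiv (fun _ : Fin (k + 1) => ι)).sum_comp, Fintype.sum_prod_type]
  rfl

/-- The first slot is peeled off, and `(k + 1)⁻¹` is the quotient of the factorials. The properties
of the inner product below are proved by induction along this recursion. -/
theorem innerDeg_succ {n : ℕ} (P : Matrix (Idx n) (Idx n) ℝ) (k : ℕ) (α β : Cov n) :
    innerDeg P (k + 1) α β = ((k : ℂ) + 1)⁻¹ * ∑ a, ∑ b, (P a b : ℂ) *
      innerDeg P k (contrB a α) (contrB b β) := by
  simp only [innerDeg_apply]
  simp only [sum_fin_cons, Nat.factorial_succ]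
  push_cast
  rw [mul_inv, mul_assoc, Finset.mul_sum]
  congr 1
  refine Finset.sum_congr rfl fun a _ => ?_
  rw [Finset.sum_comm, Finset.mul_sum]
  refine Finset.sum_congr rfl fun b _ => ?_
  rw [mul_left_comm (P a b : ℂ)]
  congr 1
  rw [Finset.mul_sum]
  refine Finset.sum_congr rfl fun i _ => ?_
  rw [Finset.mul_sum]
  refine Finset.sum_congr rfl fun j _ => ?_
  have h : ∀ (c : Idx n) (l : Fin k → Idx n) (γ : Cov n),
      γ (k + 1) (fun x => realBasis n ((Fin.cons c l : Fin (k + 1) → Idx n) x)) =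
      contrB c γ k (fun x => realBasis n (l x)) := by
    intro c l γ
    rw [contrB, contr_apply]
    congr 1
    funext x
    refine Fin.cases ?_ (fun x => ?_) x <;> simp
  rw [h, h, Fin.prod_univ_succ]
  simp only [Fin.cons_zero, Fin.cons_succ]
  ring

theorem innerDeg_symm {n : ℕ} {P : Matrix (Idx n) (Idx n) ℝ} (hs : P.IsSymm) (k : ℕ)
    (α β : Cov n) : innerDeg P k β α = (starRingEnd ℂ) (innerDeg P k α β) := by
  rw [innerDeg_apply, innerDeg_apply, map_mul, map_sum, Finset.sum_comm]
  congr 1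
  · simp
  · refine Finset.sum_congr rfl fun i _ => ?_
    rw [map_sum]
    refine Finset.sum_congr rfl fun j _ => ?_
    simp only [map_mul, Complex.conj_conj, Complex.conj_ofReal, hs.apply]
    ring

theorem innerDeg_conjCov {n : ℕ} (P : Matrix (Idx n) (Idx n) ℝ) (k : ℕ) (α β : Cov n) :
    innerDeg P k (conjCov α) (conjCov β) = (starRingEnd ℂ) (innerDeg P k α β) := by
  rw [innerDeg_apply, innerDeg_apply, map_mul, map_sum]
  congr 1
  · simp
  · refine Finset.sum_congr rfl fun i _ => ?_
    rw [map_sum]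
    refine Finset.sum_congr rfl fun j _ => ?_
    simp only [map_mul, Complex.conj_conj, Complex.conj_ofReal, conjCov_apply]

/-- A covector with real values. -/
def IsRealCovector {n : ℕ} (ξ : Model n →L[ℝ] ℂ) : Prop := ∀ v, (starRingEnd ℂ) (ξ v) = ξ v

theorem isRealCovector_coord {n : ℕ} (a : Idx n) : IsRealCovector (coord a) := by
  intro v; rw [coord_apply, Complex.conj_ofReal]

theorem sharp_contrB {n : ℕ} (P : Matrix (Idx n) (Idx n) ℝ) (ξ : Model n →L[ℝ] ℂ) (b : Idx n)
    (β : Cov n) : sharp P ξ (contrB b β) = -contrB b (sharp P ξ β) := by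
  simp only [sharp, LinearMap.sum_apply, LinearMap.smul_apply, map_sum, map_smul,
    ← Finset.sum_neg_distrib]
  refine Finset.sum_congr rfl fun a _ => Finset.sum_congr rfl fun c _ => ?_
  rw [contrB, contrB, contr_contr, smul_neg]

theorem contrB_ext {n : ℕ} (a : Idx n) (ξ : Model n →L[ℝ] ℂ) (α : Cov n) :
    contrB a (ext ξ α) = ξ (realBasis n a) • α - ext ξ (contrB a α) := contr_ext _ _ _

/-- Contracting `ξ ∧ α` gives a term where `ξ` is hit and one where `α` is. The former yields the
right-hand side once; the latter, by induction and because `sharp P ξ` anticommutes with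
contractions, `k + 1` more times in degree `k + 2`. The normalization `(k + 2)⁻¹` absorbs the total.
-/
theorem innerDeg_ext {n : ℕ} {P : Matrix (Idx n) (Idx n) ℝ} (hs : P.IsSymm)
    {ξ : Model n →L[ℝ] ℂ} (hξ : IsRealCovector ξ) (k : ℕ) (α β : Cov n) :
    innerDeg P (k + 1) (ext ξ α) β = innerDeg P k α (sharp P ξ β) := by
  have hsharp : ∀ k, ∀ α β : Cov n, ∑ a, ∑ b, (P a b : ℂ) * (ξ (realBasis n a) *
      innerDeg P k α (contrB b β)) = innerDeg P k α (sharp P ξ β) := by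
    intro k α β
    simp only [sharp, LinearMap.sum_apply, LinearMap.smul_apply, map_sum, map_smulₛₗ]
    rw [Finset.sum_comm]
    refine Finset.sum_congr rfl fun a _ => Finset.sum_congr rfl fun b _ => ?_
    rw [map_mul, hξ, Complex.conj_ofReal, hs.apply, smul_eq_mul, mul_assoc]
  induction k generalizing α β with
  | zero =>
    rw [innerDeg_succ, ← hsharp]
    have h0 : ∀ a b, innerDeg P 0 (ext ξ (contrB a α)) (contrB b β) = 0 := by
      intro a b
      rw [innerDeg_zero P _ _ Fin.elim0, ext_zero_deg]
      simp
    simp only [contrB_ext, map_sub, map_smul, LinearMap.sub_apply, LinearMap.smul_apply, h0]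
    simp
  | succ k ih =>
    rw [innerDeg_succ]
    have h1 : ∀ a b, innerDeg P (k + 1) (contrB a (ext ξ α)) (contrB b β) =
        ξ (realBasis n a) * innerDeg P (k + 1) α (contrB b β) +
        innerDeg P k (contrB a α) (contrB b (sharp P ξ β)) := by
      intro a b
      rw [contrB_ext, map_sub, map_smul, LinearMap.sub_apply, LinearMap.smul_apply, ih,
        sharp_contrB, map_neg, smul_eq_mul, sub_neg_eq_add]
    simp only [h1, mul_add, Finset.sum_add_distrib]
    rw [← mul_add, hsharp]
    have h2 := innerDeg_succ P k α (sharp P ξ β)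
    have hk : ((k : ℂ) + 1) ≠ 0 := by exact_mod_cast Nat.succ_ne_zero k
    have hk2 : ((k : ℂ) + 1 + 1) ≠ 0 := by exact_mod_cast Nat.succ_ne_zero (k + 1)
    have h3 : ∑ a, ∑ b, (P a b : ℂ) * innerDeg P k (contrB a α) (contrB b (sharp P ξ β)) =
        ((k : ℂ) + 1) * innerDeg P (k + 1) α (sharp P ξ β) := by
      rw [h2, mul_inv_cancel_left₀ hk]
    rw [h3]
    push_cast
    field_simp
    ring

theorem finrank_model (n : ℕ) : Module.finrank ℝ (Model n) = 2 * n := by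
  rw [Module.finrank_pi_fintype]
  simp [Complex.finrank_real_complex, mul_comm]

theorem alt_eq_zero_of_lt {n k : ℕ} (h : 2 * n < k) (α : Alt n k) : α = 0 := by
  ext v
  have : ¬ LinearIndependent ℝ v := by
    intro hv
    have := hv.fintype_card_le_finrank
    rw [finrank_model, Fintype.card_fin] at this
    omega
  exact α.toAlternatingMap.map_linearDependent v this

/-- The inner product on forms of all degrees, for the inverse Gram matrix `P`. -/
def innerP {n : ℕ} (P : Matrix (Idx n) (Idx n) ℝ) : Cov n →ₗ[ℂ] Cov n →ₗ⋆[ℂ] ℂ :=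
  ∑ k ∈ Finset.range (2 * n + 1), innerDeg P k

theorem innerP_apply {n : ℕ} (P : Matrix (Idx n) (Idx n) ℝ) (α β : Cov n) :
    innerP P α β = ∑ k ∈ Finset.range (2 * n + 1), innerDeg P k α β := by
  simp [innerP, LinearMap.sum_apply]

theorem innerP_symm {n : ℕ} {P : Matrix (Idx n) (Idx n) ℝ} (hs : P.IsSymm)
    (α β : Cov n) : innerP P β α = (starRingEnd ℂ) (innerP P α β) := by
  rw [innerP_apply, innerP_apply, map_sum]
  exact Finset.sum_congr rfl fun k _ => innerDeg_symm hs k α β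

theorem innerP_conjCov {n : ℕ} (P : Matrix (Idx n) (Idx n) ℝ) (α β : Cov n) :
    innerP P (conjCov α) (conjCov β) = (starRingEnd ℂ) (innerP P α β) := by
  rw [innerP_apply, innerP_apply, map_sum]
  exact Finset.sum_congr rfl fun k _ => innerDeg_conjCov P k α β

theorem innerDeg_eq_zero_of_lt {n k : ℕ} (P : Matrix (Idx n) (Idx n) ℝ) (h : 2 * n < k)
    (α β : Cov n) : innerDeg P k α β = 0 := by
  rw [innerDeg_congr P k (α' := 0) (β' := β) (alt_eq_zero_of_lt h _) rfl]
  simp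

theorem innerP_ext {n : ℕ} {P : Matrix (Idx n) (Idx n) ℝ} (hs : P.IsSymm)
    {ξ : Model n →L[ℝ] ℂ} (hξ : IsRealCovector ξ) (α β : Cov n) :
    innerP P (ext ξ α) β = innerP P α (sharp P ξ β) := by
  -- The shift of degree does no harm at the ends of the range: `ξ ∧ α` has no component of degree
  -- `0`, and nothing lives in degree `2 n + 1`.
  rw [innerP_apply, innerP_apply, Finset.sum_range_succ', Finset.sum_range_succ]
  rw [innerDeg_zero P _ _ Fin.elim0, ext_zero_deg]
  rw [Finset.sum_congr rfl fun k _ => innerDeg_ext hs hξ k α β]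
  rw [← innerDeg_ext hs hξ, innerDeg_eq_zero_of_lt P (by omega : 2 * n < 2 * n + 1)]
  simp

/-- `S` is the adjoint of `T` for the inner product with inverse Gram matrix `P`. -/
def IsAdj {n : ℕ} (P : Matrix (Idx n) (Idx n) ℝ) (T S : Module.End ℂ (Cov n)) : Prop :=
  ∀ α β, innerP P (T α) β = innerP P α (S β)

theorem conj_half : (starRingEnd ℂ) (1 / 2 : ℂ) = 1 / 2 := by
  norm_num [Complex.ext_iff]

section IsAdj

variable {n : ℕ} {P : Matrix (Idx n) (Idx n) ℝ} {T S T' S' : Module.End ℂ (Cov n)}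

theorem IsAdj.symm (hs : P.IsSymm) (h : IsAdj P T S) : IsAdj P S T := by
  intro α β
  rw [innerP_symm hs, innerP_symm hs (T β), h]

theorem IsAdj.sub (h : IsAdj P T S) (h' : IsAdj P T' S') : IsAdj P (T - T') (S - S') := by
  intro α β
  simp only [LinearMap.sub_apply, map_sub, h α β, h' α β]

theorem IsAdj.mul (h : IsAdj P T S) (h' : IsAdj P T' S') : IsAdj P (T * T') (S' * S) := by
  intro α β
  rw [Module.End.mul_apply, h, h', Module.End.mul_apply]

theorem IsAdj.smul (c : ℂ) (h : IsAdj P T S) : IsAdj P (c • T) ((starRingEnd ℂ) c • S) := by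
  intro α β
  simp only [LinearMap.smul_apply, map_smul, map_smulₛₗ, h α β, Complex.conj_conj]

theorem IsAdj.smul_real {c : ℂ} (hc : (starRingEnd ℂ) c = c) (h : IsAdj P T S) :
    IsAdj P (c • T) (c • S) := by
  have := h.smul c
  rwa [hc] at this

theorem isAdj_one : IsAdj P 1 1 := fun _ _ => rfl

theorem IsAdj.sum {ι : Type*} {s : Finset ι} {F F' : ι → Module.End ℂ (Cov n)}
    (h : ∀ i ∈ s, IsAdj P (F i) (F' i)) : IsAdj P (∑ i ∈ s, F i) (∑ i ∈ s, F' i) := by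
  intro α β
  simp only [LinearMap.sum_apply, map_sum]
  exact Finset.sum_congr rfl fun i hi => h i hi α β

theorem isAdj_extB (hs : P.IsSymm) (a : Idx n) : IsAdj P (extB a) (sharpB P a) := by
  intro α β
  rw [← sharp_coord]
  exact innerP_ext hs (isRealCovector_coord a) α β

theorem isAdj_ext (hs : P.IsSymm) {ξ : Model n →L[ℝ] ℂ} (hξ : IsRealCovector ξ) :
    IsAdj P (ext ξ) (sharp P ξ) := fun α β => innerP_ext hs hξ α β

theorem isAdj_lef (hs : P.IsSymm) (G : Matrix (Idx n) (Idx n) ℝ) :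
    IsAdj P (lef G) (lefAdj P G) := by
  refine IsAdj.smul_real conj_half (IsAdj.sum fun a _ => IsAdj.sum fun b _ => ?_)
  exact IsAdj.smul_real (by simp) ((isAdj_extB hs a).mul (isAdj_extB hs (partner b)))

/-- Taking adjoints exchanges the indices of `eᵃ ∧ ·` and `sharpB P b`, and `G` is symmetric. -/
theorem isAdj_lefBracket (hs : P.IsSymm) {G : Matrix (Idx n) (Idx n) ℝ} (hG : G.IsSymm) :
    IsAdj P (lefBracket P G) (lefBracket P G) := by
  have h : IsAdj P (∑ a, ∑ b, (G a b : ℂ) • (extB a * sharpB P b))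
      (∑ a, ∑ b, (G a b : ℂ) • (extB b * sharpB P a)) :=
    IsAdj.sum fun a _ => IsAdj.sum fun b _ => IsAdj.smul_real (by simp)
      ((isAdj_extB hs a).mul ((isAdj_extB hs b).symm hs))
  have h2 : ∑ a, ∑ b, (G a b : ℂ) • (extB b * sharpB P a) =
      ∑ a, ∑ b, (G a b : ℂ) • (extB a * sharpB P b) := by
    rw [Finset.sum_comm]
    refine Finset.sum_congr rfl fun a _ => Finset.sum_congr rfl fun b _ => ?_
    rw [hG.apply]
  rw [h2] at h
  exact (isAdj_one.smul_real (by rw [map_mul, conj_half, Complex.conj_ofReal])).sub h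

end IsAdj

/-! ### Positivity and uniqueness of adjoints -/

/-- With the inverse Gram matrix written as `CᵀC`, the recursion `innerDeg_succ` is a sum of squares
of the forms `X c`, and the invertibility of `C` recovers all contractions of `α` from them. -/
theorem innerDeg_self {n : ℕ} {C : Matrix (Idx n) (Idx n) ℝ} (hC : IsUnit C.det) (k : ℕ)
    (α : Cov n) : ∃ r : ℝ, 0 ≤ r ∧ innerDeg (C.transpose * C) k α α = r ∧ (r = 0 → α k = 0) := by
  induction k generalizing α with
  | zero =>
    refine ⟨‖α 0 Fin.elim0‖ ^ 2, by positivity, ?_, ?_⟩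
    · rw [innerDeg_zero _ _ _ Fin.elim0, Complex.mul_conj, Complex.normSq_eq_norm_sq]
    · intro h
      refine alt_zero_ext fun w => ?_
      rw [Subsingleton.elim w Fin.elim0]
      simpa using h
  | succ k ih =>
    let X : Idx n → Cov n := fun c => ∑ a, (C c a : ℂ) • contrB a α
    have hsum : innerDeg (C.transpose * C) (k + 1) α α =
        ((k : ℂ) + 1)⁻¹ * ∑ c, innerDeg (C.transpose * C) k (X c) (X c) := by
      rw [innerDeg_succ]
      congr 1
      have : ∀ c, innerDeg (C.transpose * C) k (X c) (X c) = ∑ a, ∑ b, ((C c a : ℂ) * C c b) *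
          innerDeg (C.transpose * C) k (contrB a α) (contrB b α) := by
        intro c
        simp only [X, map_sum, map_smul, map_smulₛₗ, LinearMap.sum_apply, LinearMap.smul_apply,
          Complex.conj_ofReal, smul_eq_mul]
        rw [Finset.sum_comm]
        refine Finset.sum_congr rfl fun a _ => ?_
        rw [Finset.mul_sum]
        exact Finset.sum_congr rfl fun b _ => by ring
      simp only [this]
      rw [Finset.sum_comm (γ := Idx n) (s := Finset.univ) (t := Finset.univ)
        (f := fun c a => ∑ b, ((C c a : ℂ) * C c b) *
          innerDeg (C.transpose * C) k (contrB a α) (contrB b α))]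
      refine Finset.sum_congr rfl fun a _ => ?_
      rw [Finset.sum_comm]
      refine Finset.sum_congr rfl fun b _ => ?_
      rw [← Finset.sum_mul, Matrix.mul_apply]
      push_cast
      rfl
    choose r hr0 hr hr1 using fun c => ih (X c)
    have hk : (0 : ℝ) < (k : ℝ) + 1 := by positivity
    refine ⟨((k : ℝ) + 1)⁻¹ * ∑ c, r c, ?_, ?_, ?_⟩
    · exact mul_nonneg (by positivity) (Finset.sum_nonneg fun c _ => hr0 c)
    · rw [hsum]
      simp only [hr]
      push_cast
      rfl
    · intro h
      have h1 : ∑ c, r c = 0 := by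
        rcases mul_eq_zero.mp h with h | h
        · exact absurd h (by positivity)
        · exact h
      have h2 := (Finset.sum_eq_zero_iff_of_nonneg fun c _ => hr0 c).mp h1
      have h3 : ∀ c, X c k = 0 := fun c => hr1 c (h2 c (Finset.mem_univ c))
      have h4 : ∀ a, contrB a α k = 0 := by
        intro a
        have h5 : contrB a α = ∑ c, ((C⁻¹ a c : ℝ) : ℂ) • X c := by
          simp only [X, Finset.smul_sum, smul_smul]
          rw [Finset.sum_comm]
          simp only [← Finset.sum_smul]
          have : ∀ b, ∑ c, ((C⁻¹ a c : ℝ) : ℂ) * (C c b : ℂ) = if a = b then 1 else 0 := by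
            intro b
            have := congrFun (congrFun (Matrix.nonsing_inv_mul C hC) a) b
            rw [Matrix.mul_apply, Matrix.one_apply] at this
            have h := congrArg (fun r : ℝ => (r : ℂ)) this
            push_cast at h
            rw [h]
            split_ifs <;> simp
          simp [this, ite_smul]
        rw [h5, Finset.sum_apply]
        exact Finset.sum_eq_zero fun c _ => by rw [Pi.smul_apply, h3, smul_zero]
      refine alt_succ_ext (β := 0) fun v => ?_
      rw [contr_expand, map_zero, LinearMap.sum_apply, Finset.sum_apply]
      exact Finset.sum_eq_zero fun a _ => by
        rw [LinearMap.smul_apply, Pi.smul_apply]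
        erw [h4 a]
        exact smul_zero _

open scoped MatrixOrder Matrix.Norms.L2Operator in
theorem exists_factor {n : ℕ} {P : Matrix (Idx n) (Idx n) ℝ} (hP : P.PosDef) :
    ∃ C : Matrix (Idx n) (Idx n) ℝ, IsUnit C.det ∧ P = C.transpose * C := by
  obtain ⟨C, hC⟩ := CStarAlgebra.nonneg_iff_eq_star_mul_self.mp hP.posSemidef.nonneg
  refine ⟨C, ?_, hC⟩
  have := hP.det_pos
  rw [hC, Matrix.det_mul] at this
  exact isUnit_iff_ne_zero.mpr (right_ne_zero_of_mul this.ne')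

theorem innerP_self {n : ℕ} {P : Matrix (Idx n) (Idx n) ℝ} (hP : P.PosDef) (α : Cov n) :
    ∃ r : ℝ, 0 ≤ r ∧ innerP P α α = r ∧ (r = 0 → α = 0) := by
  obtain ⟨C, hC, rfl⟩ := exists_factor hP
  choose r hr0 hr hr1 using fun k => innerDeg_self hC k α
  refine ⟨∑ k ∈ Finset.range (2 * n + 1), r k, Finset.sum_nonneg fun c _ => hr0 c, ?_, ?_⟩
  · rw [innerP_apply]
    simp only [hr]
    push_cast
    rfl
  · intro h
    have h2 := (Finset.sum_eq_zero_iff_of_nonneg fun c _ => hr0 c).mp h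
    funext k
    by_cases hk : k < 2 * n + 1
    · exact hr1 k (h2 k (Finset.mem_range.mpr hk))
    · exact alt_eq_zero_of_lt (by omega) _

theorem eq_zero_of_innerP {n : ℕ} {P : Matrix (Idx n) (Idx n) ℝ} (hP : P.PosDef) {α : Cov n}
    (h : innerP P α α = 0) : α = 0 := by
  obtain ⟨r, -, hr, hr1⟩ := innerP_self hP α
  rw [h] at hr
  exact hr1 (by exact_mod_cast hr.symm)

theorem eq_of_innerP {n : ℕ} {P : Matrix (Idx n) (Idx n) ℝ} (hP : P.PosDef) {β γ : Cov n}
    (h : ∀ α, innerP P α β = innerP P α γ) : β = γ := by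
  rw [← sub_eq_zero]
  refine eq_zero_of_innerP hP ?_
  rw [map_sub, h, sub_self]

/-- A positive definite inner product separates forms. Identities between adjoints are obtained from
this by proving the corresponding identity for the operators themselves. -/
theorem IsAdj.unique {n : ℕ} {P : Matrix (Idx n) (Idx n) ℝ} (hP : P.PosDef)
    {T S S' : Module.End ℂ (Cov n)} (h : IsAdj P T S) (h' : IsAdj P T S') : S = S' :=
  LinearMap.ext fun β => eq_of_innerP hP fun α => by rw [← h, ← h']

/-! ### The inner product and pullbacks, type operators -/

/-- The matrix of a real linear map in the real basis. -/
def realMatrix {n : ℕ} (A : Model n →L[ℝ] Model n) : Matrix (Idx n) (Idx n) ℝ :=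
  Matrix.of fun c a => coordR c (A (realBasis n a))

theorem contr_apply_realBasis {n : ℕ} (A : Model n →L[ℝ] Model n) (a : Idx n) :
    contr (A (realBasis n a)) = ∑ c, (realMatrix A c a : ℂ) • contrB c := by
  rw [contr_expand]
  exact Finset.sum_congr rfl fun c _ => by rw [coord_apply]; rfl

/-- The inverse Gram matrix is a contravariant tensor: pulling both forms back by `A` amounts to
pushing `P` forward by `A`. -/
theorem innerDeg_pullback {n : ℕ} (P : Matrix (Idx n) (Idx n) ℝ) (A : Model n →L[ℝ] Model n)
    (k : ℕ) (α β : Cov n) : innerDeg P k (pullback A α) (pullback A β) =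
      innerDeg (realMatrix A * P * (realMatrix A).transpose) k α β := by
  induction k generalizing α β with
  | zero =>
    rw [innerDeg_zero _ _ _ Fin.elim0, innerDeg_zero _ _ _ Fin.elim0, pullback_apply,
      pullback_apply]
    have : A ∘ (Fin.elim0 : Fin 0 → Model n) = Fin.elim0 := Subsingleton.elim _ _
    rw [this]
  | succ k ih =>
    rw [innerDeg_succ, innerDeg_succ]
    congr 1
    simp only [contrB, contr_pullback, ih]
    simp only [contr_apply_realBasis, LinearMap.sum_apply, map_sum, LinearMap.smul_apply, map_smul,
      map_smulₛₗ, Complex.conj_ofReal, smul_eq_mul, Finset.mul_sum]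
    have h2 : ∀ F : Idx n → Idx n → Idx n → Idx n → ℂ,
        ∑ a, ∑ b, ∑ c, ∑ d, F a b c d = ∑ d, ∑ c, ∑ a, ∑ b, F a b c d := by
      intro F
      have h3 : ∀ a, ∑ b, ∑ c, ∑ d, F a b c d = ∑ c, ∑ d, ∑ b, F a b c d := by
        intro a
        rw [Finset.sum_comm]
        exact Finset.sum_congr rfl fun c _ => Finset.sum_comm
      rw [Finset.sum_congr rfl fun a _ => h3 a, Finset.sum_comm, Finset.sum_comm]
      rw [Finset.sum_comm]
      conv_rhs => rw [Finset.sum_comm]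
      exact Finset.sum_congr rfl fun c _ => Finset.sum_comm
    rw [h2]
    refine Finset.sum_congr rfl fun d _ => Finset.sum_congr rfl fun c _ => ?_
    rw [Matrix.mul_apply]
    push_cast
    rw [Finset.sum_mul, Finset.sum_comm]
    refine Finset.sum_congr rfl fun b _ => ?_
    rw [Matrix.mul_apply]
    push_cast
    rw [Finset.sum_mul, Finset.sum_mul]
    refine Finset.sum_congr rfl fun a _ => ?_
    rw [Matrix.transpose_apply]
    simp only [contrB]
    ring

theorem innerP_pullback {n : ℕ} (P : Matrix (Idx n) (Idx n) ℝ) (A : Model n →L[ℝ] Model n)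
    (α β : Cov n) : innerP P (pullback A α) (pullback A β) =
      innerP (realMatrix A * P * (realMatrix A).transpose) α β := by
  rw [innerP_apply, innerP_apply]
  exact Finset.sum_congr rfl fun k _ => innerDeg_pullback P A k α β

/-- A `J`-invariant metric makes different types orthogonal, and `c` is real. In the induction the
terms with `J` come with opposite signs on the two sides, because the second argument conjugates
`i`; `JInvariant.sum_left` supplies the matching sign. -/
theorem innerDeg_thetaL {n : ℕ} {P : Matrix (Idx n) (Idx n) ℝ} (hP : JInvariant P) (c : ℝ)
    (k : ℕ) (α β : Cov n) : innerDeg P k (thetaL c α) β = innerDeg P k α (thetaL c β) := by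
  induction k generalizing α β with
  | zero => exact innerDeg_congr P 0 (by rw [thetaL_zero_deg]) (by rw [thetaL_zero_deg])
  | succ k ih =>
    rw [innerDeg_succ, innerDeg_succ]
    refine congrArg (fun z => ((k : ℂ) + 1)⁻¹ * z) ?_
    have hJ := hP.sum_left (V := ℂ) (fun a b => innerDeg P k (contrB a α) (thetaL c (contrB b β)))
    have e1 : ∀ a b, (P a b : ℂ) * innerDeg P k (contrB a (thetaL c α)) (contrB b β) =
        (P a b : ℂ) * (((c : ℂ) + 1) / 2 * innerDeg P k (contrB a α) (thetaL c (contrB b β))) -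
        (Complex.I * ((c : ℂ) - 1) / 2) * (((P a b : ℂ) * partnerSign a) •
          innerDeg P k (contrB (partner a) α) (thetaL c (contrB b β))) := by
      intro a b
      have : contrB a (thetaL c α) = thetaL c (contrTheta c (realBasis n a) α) := contr_thetaL _ _ _
      rw [this, ih, contrTheta, LinearMap.sub_apply, map_sub, LinearMap.sub_apply,
        LinearMap.smul_apply, LinearMap.smul_apply, map_smul, map_smul, LinearMap.smul_apply,
        LinearMap.smul_apply]
      have hJ' : contr (Complex.I • realBasis n a) α =
        (partnerSign a : ℂ) • contrB (partner a) α := LinearMap.congr_fun (contrJ_eq a) α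
      rw [hJ', map_smul, LinearMap.smul_apply]
      simp only [smul_eq_mul, contrB]
      ring
    have e2 : ∀ a b, (P a b : ℂ) * innerDeg P k (contrB a α) (contrB b (thetaL c β)) =
        (P a b : ℂ) * (((c : ℂ) + 1) / 2 * innerDeg P k (contrB a α) (thetaL c (contrB b β))) +
        (Complex.I * ((c : ℂ) - 1) / 2) * (((P a b : ℂ) * partnerSign b) •
          innerDeg P k (contrB a α) (thetaL c (contrB (partner b) β))) := by
      intro a b
      have : contrB b (thetaL c β) = thetaL c (contrTheta c (realBasis n b) β) := contr_thetaL _ _ _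
      have q : ∀ (z : ℂ) (γ : Cov n), innerDeg P k (contrB a α) (thetaL c (z • γ)) =
          (starRingEnd ℂ) z * innerDeg P k (contrB a α) (thetaL c γ) := by
        intro z γ
        rw [(thetaL c).map_smul, LinearMap.map_smulₛₗ, smul_eq_mul]
      have hJ' : contr (Complex.I • realBasis n b) β =
        (partnerSign b : ℂ) • contrB (partner b) β := LinearMap.congr_fun (contrJ_eq b) β
      rw [this, contrTheta, LinearMap.sub_apply, map_sub, map_sub,
        LinearMap.smul_apply, LinearMap.smul_apply, q, q, hJ', q]
      simp only [smul_eq_mul, contrB, map_div₀, map_add, map_sub, map_mul, Complex.conj_ofReal,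
        map_one, Complex.conj_I, map_ofNat]
      ring
    simp only [e1, e2, Finset.sum_add_distrib, Finset.sum_sub_distrib, ← Finset.mul_sum]
    rw [hJ]
    ring

theorem innerP_thetaL {n : ℕ} {P : Matrix (Idx n) (Idx n) ℝ} (hP : JInvariant P) (c : ℝ)
    (α β : Cov n) : innerP P (thetaL c α) β = innerP P α (thetaL c β) := by
  rw [innerP_apply, innerP_apply]
  exact Finset.sum_congr rfl fun k _ => innerDeg_thetaL hP c k α β

/-! ### Derivatives along curves -/

/-- `u'` is the derivative at `t` of the curve `u` of forms. -/
def HasCovDeriv {n : ℕ} (u : ℝ → Cov n) (u' : Cov n) (t : ℝ) : Prop :=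
  ∀ k w, HasDerivAt (fun s => u s k w) (u' k w) t

section CovDeriv

variable {n : ℕ} {u v : ℝ → Cov n} {u' v' : Cov n} {t : ℝ}

theorem HasCovDeriv.unique (h : HasCovDeriv u u' t) (h' : HasCovDeriv u v' t) : u' = v' := by
  funext k; ext w
  exact (h k w).unique (h' k w)

theorem HasCovDeriv.add (h : HasCovDeriv u u' t) (h' : HasCovDeriv v v' t) :
    HasCovDeriv (fun s => u s + v s) (u' + v') t := fun k w => (h k w).add (h' k w)

theorem HasCovDeriv.sum {ι : Type*} {s : Finset ι} {F : ι → ℝ → Cov n} {F' : ι → Cov n}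
    (h : ∀ i ∈ s, HasCovDeriv (F i) (F' i) t) :
    HasCovDeriv (fun r => ∑ i ∈ s, F i r) (∑ i ∈ s, F' i) t := by
  intro k w
  simp only [Finset.sum_apply, ContinuousAlternatingMap.sum_apply]
  exact HasDerivAt.fun_sum fun i hi => h i hi k w

theorem HasCovDeriv.smul {c : ℝ → ℂ} {c' : ℂ} (hc : HasDerivAt c c' t) (h : HasCovDeriv u u' t) :
    HasCovDeriv (fun s => c s • u s) (c' • u t + c t • u') t := fun k w => hc.mul (h k w)

theorem HasCovDeriv.contr (h : HasCovDeriv u u' t) (x : Model n) :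
    HasCovDeriv (fun s => contr x (u s)) (contr x u') t := fun k w => h (k + 1) (Fin.cons x w)

end CovDeriv

/-- `T'` is the derivative at `t` of the curve `T` of operators. -/
def HasOpDeriv {n : ℕ} (T : ℝ → Module.End ℂ (Cov n)) (T' : Module.End ℂ (Cov n)) (t : ℝ) : Prop :=
  ∀ u u', HasCovDeriv u u' t → HasCovDeriv (fun s => T s (u s)) (T' (u t) + T t u') t

section OpDeriv

variable {n : ℕ} {T S : ℝ → Module.End ℂ (Cov n)} {T' S' : Module.End ℂ (Cov n)} {t : ℝ}

theorem HasOpDeriv.sum {ι : Type*} {s : Finset ι} {F : ι → ℝ → Module.End ℂ (Cov n)}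
    {F' : ι → Module.End ℂ (Cov n)} (h : ∀ i ∈ s, HasOpDeriv (F i) (F' i) t) :
    HasOpDeriv (fun r => ∑ i ∈ s, F i r) (∑ i ∈ s, F' i) t := by
  intro u u' hu
  simp only [LinearMap.sum_apply, ← Finset.sum_add_distrib]
  exact HasCovDeriv.sum fun i hi => h i hi u u' hu

theorem HasOpDeriv.smul {c : ℝ → ℂ} {c' : ℂ} (hc : HasDerivAt c c' t) {T : Module.End ℂ (Cov n)}
    (h : HasOpDeriv (fun _ => T) 0 t) : HasOpDeriv (fun s => c s • T) (c' • T) t := by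
  intro u u' hu
  have := HasCovDeriv.smul hc (h u u' hu)
  simpa using this

theorem hasOpDeriv_contr (x : Model n) : HasOpDeriv (fun _ => contr x) 0 t := by
  intro u u' hu
  simpa using hu.contr x

theorem HasOpDeriv.mul_const {T S : Module.End ℂ (Cov n)} (h : HasOpDeriv (fun _ => T) 0 t)
    (h' : HasOpDeriv (fun _ => S) 0 t) : HasOpDeriv (fun _ => T * S) 0 t := by
  intro u u' hu
  have := h _ _ (h' _ _ hu)
  simpa using this

variable {P : ℝ → Matrix (Idx n) (Idx n) ℝ} {P' : Matrix (Idx n) (Idx n) ℝ}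

theorem hasOpDeriv_lam (hP : ∀ a b, HasDerivAt (fun s => P s a b) (P' a b) t) :
    HasOpDeriv (fun s => lam (P s)) (lam P') t := by
  have h : HasOpDeriv (fun s => ∑ a, ∑ b, ((1 / 2 : ℂ) * (P s a b : ℂ)) • (contrJ a * contrB b))
      (∑ a, ∑ b, ((1 / 2 : ℂ) * (P' a b : ℂ)) • (contrJ a * contrB b)) t :=
    HasOpDeriv.sum fun a _ => HasOpDeriv.sum fun b _ => HasOpDeriv.smul
      ((hP a b).ofReal_comp.const_mul _) ((hasOpDeriv_contr _).mul_const (hasOpDeriv_contr _))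
  simpa only [lam, Finset.smul_sum, smul_smul] using h

theorem hasOpDeriv_sharpB (hP : ∀ a b, HasDerivAt (fun s => P s a b) (P' a b) t) (a : Idx n) :
    HasOpDeriv (fun s => sharpB (P s) a) (sharpB P' a) t :=
  HasOpDeriv.sum fun b _ => HasOpDeriv.smul (hP b a).ofReal_comp (hasOpDeriv_contr _)

end OpDeriv

/-! ### The derivative of the inner product and of the volume density -/

/-- The derivative of the inner products when the derivative of the Gram matrix is `G`. -/
def gramDeriv {n : ℕ} (P G : Matrix (Idx n) (Idx n) ℝ) : Module.End ℂ (Cov n) :=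
  -∑ a, ∑ b, (G a b : ℂ) • (extB a * sharpB P b)

theorem contrB_sharpB {n : ℕ} (P : Matrix (Idx n) (Idx n) ℝ) (a b : Idx n) (α : Cov n) :
    contrB a (sharpB P b α) = - sharpB P b (contrB a α) := by
  simp only [sharpB, LinearMap.sum_apply, map_sum, LinearMap.smul_apply, map_smul,
    ← Finset.sum_neg_distrib, ← smul_neg]
  exact Finset.sum_congr rfl fun c _ => congrArg _ (contr_contr _ _ _)

/-- Separates the slot in which `G` meets the contracted vector from the others; this is the Leibniz
rule that `gramDeriv` needs in order to follow the recursion of the inner product. -/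
theorem contrB_gramDeriv {n : ℕ} (P G : Matrix (Idx n) (Idx n) ℝ) (b : Idx n) (α : Cov n) :
    contrB b (gramDeriv P G α) =
      gramDeriv P G (contrB b α) - ∑ d, (G b d : ℂ) • sharpB P d α := by
  have h : ∀ c d, contrB b (extB c (sharpB P d α)) =
      (if c = b then (1 : ℂ) else 0) • sharpB P d α + extB c (sharpB P d (contrB b α)) := by
    intro c d
    rw [extB, contrB_ext, contrB_sharpB, coord_realBasis, map_neg, sub_neg_eq_add]
  simp only [gramDeriv, LinearMap.neg_apply, LinearMap.sum_apply, map_neg, map_sum,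
    LinearMap.smul_apply, map_smul, Module.End.mul_apply, h, smul_add, Finset.sum_add_distrib]
  rw [neg_add, add_comm, sub_eq_add_neg]
  congr 2
  rw [Finset.sum_comm]
  refine Finset.sum_congr rfl fun d _ => ?_
  simp [ite_smul]

/-- Differentiating the inverse Gram matrix contributes `-P G P` in each slot. The first slot is
accounted for by the extra term of `contrB_gramDeriv`, the others by induction, and together they
form `gramDeriv`. -/
theorem hasDerivAt_innerDeg {n : ℕ} {P : ℝ → Matrix (Idx n) (Idx n) ℝ}
    {G : Matrix (Idx n) (Idx n) ℝ} {t : ℝ} (hs : (P t).IsSymm)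
    (hP : ∀ a b, HasDerivAt (fun s => P s a b) ((-(P t * G * P t)) a b) t) (k : ℕ)
    {u v : ℝ → Cov n} {u' v' : Cov n} (hu : HasCovDeriv u u' t) (hv : HasCovDeriv v v' t) :
    HasDerivAt (fun s => innerDeg (P s) k (u s) (v s))
      (innerDeg (P t) k u' (v t) + innerDeg (P t) k (u t) v' +
        innerDeg (P t) k (u t) (gramDeriv (P t) G (v t))) t := by
  induction k generalizing u v u' v' with
  | zero =>
    have h0 : gramDeriv (P t) G (v t) 0 = 0 := by
      simp [gramDeriv, LinearMap.sum_apply, extB, ext_zero_deg]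
    have h1 : (0 : Alt n 0) Fin.elim0 = 0 := rfl
    simp only [innerDeg_zero _ _ _ Fin.elim0, h0, h1, map_zero, mul_zero, add_zero]
    exact (hu 0 _).mul ((Complex.conjCLE : ℂ →L[ℝ] ℂ).hasFDerivAt.comp_hasDerivAt t (hv 0 _))
  | succ k ih =>
    simp only [innerDeg_succ]
    have hd := fun a b => ((hP a b).ofReal_comp).mul (ih (hu.contr (realBasis n a))
      (hv.contr (realBasis n b)))
    have hd2 := (HasDerivAt.fun_sum (u := Finset.univ) fun a (_ : a ∈ Finset.univ) =>
      HasDerivAt.fun_sum (u := Finset.univ) fun b (_ : b ∈ Finset.univ) => hd a b).const_mul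
        ((k : ℂ) + 1)⁻¹
    refine hd2.congr_deriv ?_
    rw [← mul_add, ← mul_add]
    refine congrArg (fun z => ((k : ℂ) + 1)⁻¹ * z) ?_
    simp only [contrB_gramDeriv, map_sub, mul_sub, mul_add, Finset.sum_sub_distrib,
      Finset.sum_add_distrib]
    have e : ∑ a, ∑ b, ((P t a b : ℝ) : ℂ) * innerDeg (P t) k (contrB a (u t))
        (∑ d, (G b d : ℂ) • sharpB (P t) d (v t)) =
        ∑ a, ∑ b, ((P t * G * P t) a b : ℂ) * innerDeg (P t) k (contrB a (u t))
          (contrB b (v t)) := by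
      have q : ∀ a b, ((P t a b : ℝ) : ℂ) * innerDeg (P t) k (contrB a (u t))
          (∑ d, (G b d : ℂ) • sharpB (P t) d (v t)) = ∑ e, ((P t a b * (G * P t) b e : ℝ) : ℂ) *
            innerDeg (P t) k (contrB a (u t)) (contrB e (v t)) := by
        intro a b
        have : ∑ d, (G b d : ℂ) • sharpB (P t) d (v t) =
            ∑ e, ((G * P t) b e : ℂ) • contrB e (v t) := by
          simp only [sharpB, LinearMap.sum_apply, LinearMap.smul_apply, Finset.smul_sum, smul_smul]
          rw [Finset.sum_comm]
          refine Finset.sum_congr rfl fun e _ => ?_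
          rw [← Finset.sum_smul, Matrix.mul_apply]
          push_cast
          refine congrArg (fun z : ℂ => z • contrB e (v t)) ?_
          exact Finset.sum_congr rfl fun d _ => by rw [hs.apply]
        rw [this, map_sum, Finset.mul_sum]
        refine Finset.sum_congr rfl fun e _ => ?_
        rw [LinearMap.map_smulₛₗ, Complex.conj_ofReal, smul_eq_mul]
        push_cast; ring
      refine Finset.sum_congr rfl fun a _ => ?_
      rw [Finset.sum_congr rfl fun b _ => q a b, Finset.sum_comm]
      refine Finset.sum_congr rfl fun e _ => ?_
      rw [← Finset.sum_mul, Matrix.mul_assoc, Matrix.mul_apply]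
      push_cast
      rfl
    rw [e]
    simp only [Matrix.neg_apply, Complex.ofReal_neg, neg_mul, Finset.sum_neg_distrib, contrB]
    ring

theorem hasDerivAt_innerP {n : ℕ} {P : ℝ → Matrix (Idx n) (Idx n) ℝ}
    {G : Matrix (Idx n) (Idx n) ℝ} {t : ℝ} (hs : (P t).IsSymm)
    (hP : ∀ a b, HasDerivAt (fun s => P s a b) ((-(P t * G * P t)) a b) t)
    {u v : ℝ → Cov n} {u' v' : Cov n} (hu : HasCovDeriv u u' t) (hv : HasCovDeriv v v' t) :
    HasDerivAt (fun s => innerP (P s) (u s) (v s))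
      (innerP (P t) u' (v t) + innerP (P t) (u t) v' +
        innerP (P t) (u t) (gramDeriv (P t) G (v t))) t := by
  simp only [innerP_apply, ← Finset.sum_add_distrib]
  exact HasDerivAt.fun_sum fun k _ => hasDerivAt_innerDeg hs hP k hu hv

/-- Jacobi's formula. -/
theorem hasDerivAt_det {ι : Type*} [Fintype ι] [DecidableEq ι] {G : ℝ → Matrix ι ι ℝ}
    {G' : Matrix ι ι ℝ} {t : ℝ} (hG : ∀ a b, HasDerivAt (fun s => G s a b) (G' a b) t) :
    HasDerivAt (fun s => (G s).det) (((G t).adjugate * G').trace) t := by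
  -- The determinant as a multilinear function of the rows: its derivative replaces one row at a
  -- time by the corresponding row of `G'`, and Cramer's rule evaluates the result.
  let f : ContinuousMultilinearMap ℝ (fun _ : ι => ι → ℝ) ℝ :=
    { (Matrix.detRowAlternating (n := ι) (R := ℝ)).toMultilinearMap with
      cont := Continuous.matrix_det continuous_id }
  have hG' : HasDerivAt (fun s => (G s : ι → ι → ℝ)) G' t :=
    hasDerivAt_pi.2 fun a => hasDerivAt_pi.2 fun b => hG a b
  have h := (f.hasFDerivAt (G t)).comp_hasDerivAt t hG'
  refine h.congr_deriv ((ContinuousMultilinearMap.linearDeriv_apply f _ _).trans ?_)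
  rw [Matrix.trace]
  simp only [Matrix.diag_apply, Matrix.mul_apply]
  rw [Finset.sum_comm]
  refine Finset.sum_congr rfl fun i _ => ?_
  have e : f (Function.update (G t) i (G' i)) = ((G t).updateRow i (G' i)).det := rfl
  rw [e]
  have := Matrix.cramer_transpose_apply (G t) (G' i) i
  rw [← this, Matrix.cramer_eq_adjugate_mulVec, ← Matrix.adjugate_transpose, Matrix.mulVec,
    dotProduct]
  rfl

/-- The logarithmic derivative `1 / 2 * tr (G⁻¹ G')` of the volume density is the scalar term of
`lefBracket`, while `gramDeriv` is its other term. -/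
theorem hasDerivAt_sqrt_det {ι : Type*} [Fintype ι] [DecidableEq ι] {G : ℝ → Matrix ι ι ℝ}
    {G' : Matrix ι ι ℝ} {t : ℝ} (hG : ∀ a b, HasDerivAt (fun s => G s a b) (G' a b) t)
    (hpos : 0 < (G t).det) :
    HasDerivAt (fun s => Real.sqrt (G s).det)
      (1 / 2 * ((G t)⁻¹ * G').trace * Real.sqrt (G t).det) t := by
  refine ((hasDerivAt_det hG).sqrt hpos.ne').congr_deriv ?_
  rw [Matrix.inv_def, Ring.inverse_eq_inv', Matrix.smul_mul, Matrix.trace_smul, smul_eq_mul]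
  have h1 := Real.sqrt_pos.2 hpos
  have h2 := Real.mul_self_sqrt hpos.le
  field_simp
  rw [sq, h2]

/-! ### Smooth families of forms on open subsets of the model space -/

theorem alt_ext_realBasis {n k : ℕ} {α β : Cov n}
    (h : ∀ i : Fin k → Idx n, α k (fun a => realBasis n (i a)) = β k (fun a => realBasis n (i a))) :
    α k = β k := by
  induction k generalizing α β with
  | zero =>
    refine alt_zero_ext fun w => ?_
    have := h Fin.elim0
    rwa [Subsingleton.elim w fun a => realBasis n (Fin.elim0 a)]
  | succ k ih =>
    refine alt_succ_ext fun v => ?_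
    have hb : ∀ a, contr (realBasis n a) α k = contr (realBasis n a) β k := by
      intro a
      refine ih fun i => ?_
      have := h (Fin.cons a i)
      have e : (fun b => realBasis n ((Fin.cons a i : Fin (k + 1) → Idx n) b)) =
          Fin.cons (realBasis n a) (fun b => realBasis n (i b)) := by
        funext b
        refine Fin.cases ?_ (fun b => ?_) b <;> simp
      rw [e] at this
      exact this
    rw [contr_expand]
    simp only [LinearMap.sum_apply, LinearMap.smul_apply, Finset.sum_apply, Pi.smul_apply]
    exact Finset.sum_congr rfl fun a _ => congrArg _ (hb a)

/-- The values of an alternating map on the basis vectors. -/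
def basisEval (n k : ℕ) : Alt n k →L[ℝ] ((Fin k → Idx n) → ℂ) :=
  ContinuousLinearMap.pi fun i =>
    ContinuousAlternatingMap.apply ℝ (Model n) ℂ (fun a => realBasis n (i a))

theorem basisEval_apply {n k : ℕ} (α : Alt n k) (i : Fin k → Idx n) :
    basisEval n k α i = α (fun a => realBasis n (i a)) := rfl

theorem basisEval_injective (n k : ℕ) : Function.Injective (basisEval n k) := by
  intro α β h
  have := alt_ext_realBasis (α := (Pi.single k α : Cov n)) (β := Pi.single k β) (k := k) (by
    intro i
    have := congrFun h i
    simpa [basisEval_apply] using this)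
  simpa using this

/-- A family of forms all of whose components are smooth on `s`. -/
def FSmooth {n : ℕ} (u : Model n → Cov n) (s : Set (Model n)) : Prop :=
  ∀ k w, ContDiffOn ℝ ∞ (fun y => u y k w) s

/-- Evaluation on basis vectors is an injective linear map into a finite-dimensional space. It has a
linear left inverse, through which smoothness of the values gives smoothness of the form. -/
theorem contDiffOn_alt {n k : ℕ} {s : Set (Model n)} {f : Model n → Alt n k}
    (h : ∀ w, ContDiffOn ℝ ∞ (fun y => f y w) s) : ContDiffOn ℝ ∞ f s := by
  have hinj := basisEval_injective n k
  have : FiniteDimensional ℝ (Alt n k) :=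
    Module.Finite.of_injective (basisEval n k).toLinearMap hinj
  obtain ⟨l, hl⟩ := (basisEval n k).toLinearMap.exists_leftInverse_of_injective
    (LinearMap.ker_eq_bot.2 hinj)
  have e : f = fun y => LinearMap.toContinuousLinearMap l (basisEval n k (f y)) := by
    funext y
    exact (LinearMap.congr_fun hl (f y)).symm
  rw [e]
  refine (LinearMap.toContinuousLinearMap l).contDiff.comp_contDiffOn ?_
  exact contDiffOn_pi.2 fun i => h _

theorem contDiffOn_alt_apply {n k : ℕ} {s : Set (Model n)} {f : Model n → Alt n k}
    (h : ContDiffOn ℝ ∞ f s) (w : Fin k → Model n) : ContDiffOn ℝ ∞ (fun y => f y w) s :=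
  (ContinuousAlternatingMap.apply ℝ (Model n) ℂ w).contDiff.comp_contDiffOn h

section FSmooth

variable {n : ℕ} {u v : Model n → Cov n} {s : Set (Model n)}

theorem FSmooth.contDiffOn (h : FSmooth u s) (k : ℕ) : ContDiffOn ℝ ∞ (fun y => u y k) s :=
  contDiffOn_alt (h k)

theorem FSmooth.congr (h : FSmooth u s) (e : ∀ y ∈ s, v y = u y) : FSmooth v s :=
  fun k w => (h k w).congr fun y hy => by rw [e y hy]

theorem FSmooth.add (h : FSmooth u s) (h' : FSmooth v s) : FSmooth (fun y => u y + v y) s :=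
  fun k w => (h k w).add (h' k w)

theorem FSmooth.sub (h : FSmooth u s) (h' : FSmooth v s) : FSmooth (fun y => u y - v y) s :=
  fun k w => (h k w).sub (h' k w)

theorem FSmooth.smul {c : Model n → ℂ} (hc : ContDiffOn ℝ ∞ c s) (h : FSmooth u s) :
    FSmooth (fun y => c y • u y) s := fun k w => hc.mul (h k w)

theorem FSmooth.sum {ι : Type*} {t : Finset ι} {F : ι → Model n → Cov n}
    (h : ∀ i ∈ t, FSmooth (F i) s) : FSmooth (fun y => ∑ i ∈ t, F i y) s := by
  intro k w
  simp only [Finset.sum_apply, ContinuousAlternatingMap.sum_apply]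
  exact ContDiffOn.sum fun i hi => h i hi k w

theorem FSmooth.contr (h : FSmooth u s) (x : Model n) : FSmooth (fun y => contr x (u y)) s :=
  fun k w => h (k + 1) (Fin.cons x w)

theorem ext_succ_apply {n : ℕ} (ξ : Model n →L[ℝ] ℂ) (α : Cov n) (k : ℕ)
    (w : Fin (k + 1) → Model n) : ext ξ α (k + 1) w =
      ξ (w 0) * α k (Fin.tail w) - ext ξ (EtaBKN.contr (w 0) α) k (Fin.tail w) := by
  have := congrArg (fun β : Cov n => β k (Fin.tail w)) (contr_ext (w 0) ξ α)
  simp only [contr_apply, Fin.cons_self_tail] at this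
  exact this

theorem FSmooth.ext (h : FSmooth u s) (ξ : Model n →L[ℝ] ℂ) : FSmooth (fun y => ext ξ (u y)) s := by
  intro k
  induction k generalizing u with
  | zero =>
    intro w
    simp only [ext_zero_deg]
    exact contDiffOn_const
  | succ k ih =>
    intro w
    simp only [ext_succ_apply]
    exact (contDiffOn_const.mul (h k (Fin.tail w))).sub (ih (h.contr (w 0)) (Fin.tail w))

theorem FSmooth.thetaL {c : Model n → ℝ} (hc : ContDiffOn ℝ ∞ c s) (h : FSmooth u s) :
    FSmooth (fun y => thetaL (c y) (u y)) s := by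
  intro k w
  simp only [thetaL_apply, thetaCov_apply, slotPart]
  refine ContDiffOn.sum fun S _ => ((Complex.ofRealCLM.contDiff.comp_contDiffOn hc).pow _).mul ?_
  exact ContDiffOn.sum fun T _ => contDiffOn_const.mul (h k _)

theorem FSmooth.conj (h : FSmooth u s) : FSmooth (fun y => conjCov (u y)) s :=
  fun k w => (Complex.conjCLE : ℂ →L[ℝ] ℂ).contDiff.comp_contDiffOn (h k w)

end FSmooth

/-- A family of operators which preserves the smooth families of forms. -/
def OpSmooth {n : ℕ} (T : Model n → Module.End ℂ (Cov n)) (s : Set (Model n)) : Prop :=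
  ∀ u, FSmooth u s → FSmooth (fun y => T y (u y)) s

section OpSmooth

variable {n : ℕ} {T S : Model n → Module.End ℂ (Cov n)} {s : Set (Model n)}

theorem opSmooth_contr (x : Model n) : OpSmooth (fun _ => contr x) s := fun _ h => h.contr x

theorem opSmooth_ext (ξ : Model n →L[ℝ] ℂ) : OpSmooth (fun _ => ext ξ) s := fun _ h => h.ext ξ

theorem opSmooth_one : OpSmooth (n := n) (fun _ => 1) s := fun _ h => h

theorem OpSmooth.mul (h : OpSmooth T s) (h' : OpSmooth S s) : OpSmooth (fun y => T y * S y) s :=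
  fun _ hu => h _ (h' _ hu)

theorem OpSmooth.sub (h : OpSmooth T s) (h' : OpSmooth S s) : OpSmooth (fun y => T y - S y) s :=
  fun _ hu => (h _ hu).sub (h' _ hu)

theorem OpSmooth.smul {c : Model n → ℂ} (hc : ContDiffOn ℝ ∞ c s) (h : OpSmooth T s) :
    OpSmooth (fun y => c y • T y) s := fun _ hu => (h _ hu).smul hc

theorem OpSmooth.sum {ι : Type*} {t : Finset ι} {F : ι → Model n → Module.End ℂ (Cov n)}
    (h : ∀ i ∈ t, OpSmooth (F i) s) : OpSmooth (fun y => ∑ i ∈ t, F i y) s := by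
  intro u hu
  simp only [LinearMap.sum_apply]
  exact FSmooth.sum fun i hi => h i hi u hu

variable {P G : Model n → Matrix (Idx n) (Idx n) ℝ}

theorem contDiffOn_ofReal {f : Model n → ℝ} (hf : ContDiffOn ℝ ∞ f s) :
    ContDiffOn ℝ ∞ (fun y => (f y : ℂ)) s := Complex.ofRealCLM.contDiff.comp_contDiffOn hf

theorem opSmooth_lam (hP : ∀ a b, ContDiffOn ℝ ∞ (fun y => P y a b) s) :
    OpSmooth (fun y => lam (P y)) s :=
  OpSmooth.smul contDiffOn_const <| OpSmooth.sum fun a _ => OpSmooth.sum fun b _ =>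
    OpSmooth.smul (contDiffOn_ofReal (hP a b)) ((opSmooth_contr _).mul (opSmooth_contr _))

theorem opSmooth_sharpB (hP : ∀ a b, ContDiffOn ℝ ∞ (fun y => P y a b) s) (a : Idx n) :
    OpSmooth (fun y => sharpB (P y) a) s :=
  OpSmooth.sum fun b _ => OpSmooth.smul (contDiffOn_ofReal (hP b a)) (opSmooth_contr _)

theorem opSmooth_lefAdj (hP : ∀ a b, ContDiffOn ℝ ∞ (fun y => P y a b) s)
    (hG : ∀ a b, ContDiffOn ℝ ∞ (fun y => G y a b) s) :
    OpSmooth (fun y => lefAdj (P y) (G y)) s :=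
  OpSmooth.smul contDiffOn_const <| OpSmooth.sum fun a _ => OpSmooth.sum fun b _ =>
    OpSmooth.smul ((contDiffOn_ofReal (hG a b)).mul contDiffOn_const)
      ((opSmooth_sharpB hP _).mul (opSmooth_sharpB hP _))

theorem opSmooth_lefBracket (hP : ∀ a b, ContDiffOn ℝ ∞ (fun y => P y a b) s)
    (hG : ∀ a b, ContDiffOn ℝ ∞ (fun y => G y a b) s) :
    OpSmooth (fun y => lefBracket (P y) (G y)) s := by
  refine OpSmooth.sub (OpSmooth.smul (contDiffOn_const.mul (contDiffOn_ofReal ?_)) opSmooth_one)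
    (OpSmooth.sum fun a _ => OpSmooth.sum fun b _ => OpSmooth.smul (contDiffOn_ofReal (hG a b))
      ((opSmooth_ext _).mul (opSmooth_sharpB hP _)))
  simp only [Matrix.trace, Matrix.diag_apply, Matrix.mul_apply]
  exact ContDiffOn.sum fun a _ => ContDiffOn.sum fun b _ => (hP a b).mul (hG b a)

end OpSmooth

theorem contDiffOn_innerP {n : ℕ} {P : Model n → Matrix (Idx n) (Idx n) ℝ} {s : Set (Model n)}
    (hP : ∀ a b, ContDiffOn ℝ ∞ (fun y => P y a b) s) {u v : Model n → Cov n}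
    (hu : FSmooth u s) (hv : FSmooth v s) :
    ContDiffOn ℝ ∞ (fun y => innerP (P y) (u y) (v y)) s := by
  simp only [innerP_apply, innerDeg_apply]
  refine ContDiffOn.sum fun k _ => contDiffOn_const.mul <| ContDiffOn.sum fun i _ =>
    ContDiffOn.sum fun j _ => ((contDiffOn_ofReal ?_).mul (hu k _)).mul (hv.conj k _)
  exact contDiffOn_prod fun a _ => hP _ _

theorem contDiffOn_det {n : ℕ} {ι : Type*} [Fintype ι] [DecidableEq ι]
    {G : Model n → Matrix ι ι ℝ} {s : Set (Model n)}
    (hG : ∀ a b, ContDiffOn ℝ ∞ (fun y => G y a b) s) :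
    ContDiffOn ℝ ∞ (fun y => (G y).det) s := by
  simp only [Matrix.det_apply]
  refine ContDiffOn.sum fun e _ => ContDiffOn.const_smul _ ?_
  exact contDiffOn_prod fun a _ => hG _ _

theorem contDiffOn_matrix_inv {n : ℕ} {ι : Type*} [Fintype ι] [DecidableEq ι]
    {G : Model n → Matrix ι ι ℝ} {s : Set (Model n)}
    (hG : ∀ a b, ContDiffOn ℝ ∞ (fun y => G y a b) s) (h0 : ∀ y ∈ s, (G y).det ≠ 0) (a b : ι) :
    ContDiffOn ℝ ∞ (fun y => (G y)⁻¹ a b) s := by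
  simp only [Matrix.inv_def, Ring.inverse_eq_inv', Matrix.smul_apply, smul_eq_mul,
    Matrix.adjugate_apply]
  refine ((contDiffOn_det hG).inv h0).mul (contDiffOn_det fun c d => ?_)
  by_cases h : c = b
  · subst h
    simp only [Matrix.updateRow_self]
    exact contDiffOn_const
  · simp only [Matrix.updateRow_ne h]
    exact hG c d

/-- The partial derivative of a family of forms in a basis direction. -/
def pd {n : ℕ} (a : Idx n) (u : Model n → Cov n) (y : Model n) : Cov n :=
  fun k => fderiv ℝ (fun z => u z k) y (realBasis n a)

section Pd

variable {n : ℕ} {u v : Model n → Cov n} {s : Set (Model n)} {y : Model n}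

theorem FSmooth.pd (h : FSmooth u s) (hs : IsOpen s) (a : Idx n) : FSmooth (pd a u) s := by
  intro k w
  refine contDiffOn_alt_apply ?_ w
  exact ((h.contDiffOn k).fderiv_of_isOpen hs (m := ∞) (by simp)).clm_apply contDiffOn_const

theorem hasDerivAt_line {F : Type*} [NormedAddCommGroup F] [NormedSpace ℝ F] {f : Model n → F}
    (hf : DifferentiableAt ℝ f y) (v : Model n) :
    HasDerivAt (fun t : ℝ => f (y + t • v)) (fderiv ℝ f y v) 0 :=
  (hf.hasFDerivAt.hasLineDerivAt v)

theorem FSmooth.hasCovDeriv (h : FSmooth u s) (hs : IsOpen s) (hy : y ∈ s) (a : Idx n) :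
    HasCovDeriv (fun t => u (y + t • realBasis n a)) (EtaBKN.pd a u y) 0 := by
  intro k w
  have h1 : DifferentiableAt ℝ (fun z => u z k) y :=
    ((h.contDiffOn k).contDiffAt (hs.mem_nhds hy)).differentiableAt (by simp)
  have h2 := (ContinuousAlternatingMap.apply ℝ (Model n) ℂ w : Alt n k →L[ℝ] ℂ).hasFDerivAt.comp_hasDerivAt
    (0 : ℝ) (hasDerivAt_line h1 (realBasis n a))
  exact h2

theorem pd_eq_of_hasCovDeriv (h : FSmooth u s) (hs : IsOpen s) (hy : y ∈ s) {a : Idx n}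
    {u' : Cov n} (h' : HasCovDeriv (fun t => u (y + t • realBasis n a)) u' 0) : pd a u y = u' :=
  (h.hasCovDeriv hs hy a).unique h'

theorem pd_congr {t : Set (Model n)} (ht : IsOpen t) (hy : y ∈ t) (h : ∀ z ∈ t, u z = v z)
    (a : Idx n) : pd a u y = pd a v y := by
  funext k
  have : (fun z => u z k) =ᶠ[nhds y] fun z => v z k := by
    filter_upwards [ht.mem_nhds hy] with z hz
    rw [h z hz]
  rw [pd, pd, this.fderiv_eq]

end Pd

/-! ### The calculus of a Hermitian metric on an open subset of the model space -/

/-- `w` is a smooth positive real `(1, 1)`-form on the open set `s`. -/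
structure FlatMetric {n : ℕ} (w : Model n → Alt n 2) (s : Set (Model n)) : Prop where
  isOpen : IsOpen s
  smooth : ContDiffOn ℝ ∞ w s
  real11 : ∀ y ∈ s, IsReal11 (w y)
  pos : ∀ y ∈ s, (gramOf (w y)).PosDef

/-- The derivative of the Gram matrix. -/
def gramD {n : ℕ} (w : Model n → Alt n 2) (a : Idx n) (y : Model n) : Matrix (Idx n) (Idx n) ℝ :=
  gramOf (fderiv ℝ w y (realBasis n a))

/-- The inverse Gram matrix. -/
def gramInv {n : ℕ} (w : Model n → Alt n 2) (y : Model n) : Matrix (Idx n) (Idx n) ℝ :=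
  (gramOf (w y))⁻¹

/-- Exterior multiplication with `eᵃ ∘ J`. -/
def extJ {n : ℕ} (a : Idx n) : Module.End ℂ (Cov n) := ext (compJ (coord a))

/-- The exterior derivative. -/
def flatD {n : ℕ} (u : Model n → Cov n) (y : Model n) : Cov n := ∑ a, extB a (pd a u y)

/-- The operator `∑ (eᵃ ∘ J) ∧ ∂ₐ`, which is `i (∂ - ∂̄)`. -/
def flatDc {n : ℕ} (u : Model n → Cov n) (y : Model n) : Cov n := ∑ a, extJ a (pd a u y)

/-- The adjoint of the torsion operator. -/
def flatTors {n : ℕ} (w : Model n → Alt n 2) (y : Model n) : Module.End ℂ (Cov n) :=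
  ∑ a, (lefBracket (gramInv w y) (gramD w a y) * sharpB (gramInv w y) a -
    lefAdj (gramInv w y) (gramD w a y) * extJ a)

/-- The formal adjoint of the exterior derivative. -/
def flatCod {n : ℕ} (w : Model n → Alt n 2) (v : Model n → Cov n) (y : Model n) : Cov n :=
  flatDc (fun z => lam (gramInv w z) (v z)) y - lam (gramInv w y) (flatDc v y) -
    flatTors w y (v y)

/-- Because `J² = -1`, commuting `Λ` with `(eᵃ ∘ J) ∧ ·` gives contraction with the dual of `eᵃ`
itself. This is the relation between `dᶜ` and `d⋆` at the level of principal symbols. -/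
theorem lam_mul_extJ {n : ℕ} {P : Matrix (Idx n) (Idx n) ℝ} (hP : JInvariant P) (hs : P.IsSymm)
    (a : Idx n) : lam P * extJ a = extJ a * lam P + sharpB P a := by
  rw [extJ, lam_mul_ext hP hs, compJ_compJ, ← sharp_coord, ← neg_one_smul ℂ, sharp_smul]
  simp

theorem JInvariant.mul {n : ℕ} {P Q : Matrix (Idx n) (Idx n) ℝ} (hP : JInvariant P)
    (hQ : JInvariant Q) : JInvariant (P * Q) := by
  intro a b
  rw [Matrix.mul_apply, Matrix.mul_apply, Finset.mul_sum, ← sum_partner]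
  refine Finset.sum_congr rfl fun c _ => ?_
  rw [hP, hQ]
  linear_combination (partnerSign a * partnerSign b * P a c * Q c b) * partnerSign_mul_self c

namespace FlatMetric

variable {n : ℕ} {w : Model n → Alt n 2} {s : Set (Model n)} {y : Model n} (hw : FlatMetric w s)
include hw

theorem differentiableAt (hy : y ∈ s) : DifferentiableAt ℝ w y :=
  (hw.smooth.contDiffAt (hw.isOpen.mem_nhds hy)).differentiableAt (by simp)

theorem line_mem (hy : y ∈ s) (v : Model n) : ∀ᶠ t : ℝ in nhds 0, y + t • v ∈ s := by
  have : Filter.Tendsto (fun t : ℝ => y + t • v) (nhds 0) (nhds y) := by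
    have : Continuous fun t : ℝ => y + t • v := by fun_prop
    simpa using this.tendsto 0
  exact this (hw.isOpen.mem_nhds hy)

theorem hasDerivAt_apply (hy : y ∈ s) (v : Model n) (x : Fin 2 → Model n) :
    HasDerivAt (fun t : ℝ => w (y + t • v) x) (fderiv ℝ w y v x) 0 :=
  (ContinuousAlternatingMap.apply ℝ (Model n) ℂ x : Alt n 2 →L[ℝ] ℂ).hasFDerivAt.comp_hasDerivAt
    (0 : ℝ) (hasDerivAt_line (hw.differentiableAt hy) v)

/-- The defining conditions are linear with constant coefficients, so they survive differentiation
along a line. This makes the algebra of `(1, 1)`-forms available for `∂ₐω`. -/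
theorem isReal11_fderiv (hy : y ∈ s) (v : Model n) : IsReal11 (fderiv ℝ w y v) where
  real x := by
    have h1 := Complex.imCLM.hasFDerivAt.comp_hasDerivAt (0 : ℝ) (hw.hasDerivAt_apply hy v x)
    have h2 : (Complex.imCLM ∘ fun t : ℝ => w (y + t • v) x) =ᶠ[nhds 0] fun _ => (0 : ℝ) := by
      filter_upwards [hw.line_mem hy v] with t ht
      exact (hw.real11 _ ht).real x
    exact h1.unique ((hasDerivAt_const (0 : ℝ) (0 : ℝ)).congr_of_eventuallyEq h2)
  invariant x z := by
    have h2 : (fun t : ℝ => w (y + t • v) ![Complex.I • x, Complex.I • z]) =ᶠ[nhds 0]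
        fun t => w (y + t • v) ![x, z] := by
      filter_upwards [hw.line_mem hy v] with t ht
      exact (hw.real11 _ ht).invariant x z
    exact (hw.hasDerivAt_apply hy v _).unique
      ((hw.hasDerivAt_apply hy v _).congr_of_eventuallyEq h2)

theorem gramD_symm (hy : y ∈ s) (a : Idx n) : (gramD w a y).IsSymm :=
  (hw.isReal11_fderiv hy _).symm

theorem gramD_jInvariant (hy : y ∈ s) (a : Idx n) : JInvariant (gramD w a y) :=
  (hw.isReal11_fderiv hy _).jInvariant

theorem det_pos (hy : y ∈ s) : 0 < (gramOf (w y)).det := (hw.pos y hy).det_pos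

theorem isUnit_det (hy : y ∈ s) : IsUnit (gramOf (w y)).det := (hw.det_pos hy).ne'.isUnit

theorem gram_mul_inv (hy : y ∈ s) : gramOf (w y) * gramInv w y = 1 :=
  Matrix.mul_nonsing_inv _ (hw.isUnit_det hy)

theorem inv_mul_gram (hy : y ∈ s) : gramInv w y * gramOf (w y) = 1 :=
  Matrix.nonsing_inv_mul _ (hw.isUnit_det hy)

theorem jInvariant (hy : y ∈ s) : JInvariant (gramInv w y) :=
  (hw.real11 y hy).jInvariant.inv (hw.inv_mul_gram hy)

theorem isSymm (hy : y ∈ s) : (gramInv w y).IsSymm := by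
  have := (hw.real11 y hy).symm
  rw [Matrix.IsSymm, gramInv, Matrix.transpose_nonsing_inv, this.eq]

theorem posDef (hy : y ∈ s) : (gramInv w y).PosDef := (hw.pos y hy).inv

theorem contDiffOn_gram (a b : Idx n) : ContDiffOn ℝ ∞ (fun y => gramOf (w y) a b) s :=
  Complex.reCLM.contDiff.comp_contDiffOn (contDiffOn_alt_apply hw.smooth _)

theorem contDiffOn_gramInv (a b : Idx n) : ContDiffOn ℝ ∞ (fun y => gramInv w y a b) s :=
  contDiffOn_matrix_inv hw.contDiffOn_gram (fun _ hy => (hw.det_pos hy).ne') a b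

theorem contDiffOn_gramD (c a b : Idx n) : ContDiffOn ℝ ∞ (fun y => gramD w c y a b) s := by
  refine Complex.reCLM.contDiff.comp_contDiffOn (contDiffOn_alt_apply ?_ _)
  exact (hw.smooth.fderiv_of_isOpen hw.isOpen (m := ∞) (by simp)).clm_apply contDiffOn_const

theorem contDiffOn_density : ContDiffOn ℝ ∞ (fun y => Real.sqrt (gramOf (w y)).det) s :=
  (contDiffOn_det hw.contDiffOn_gram).sqrt fun _ hy => (hw.det_pos hy).ne'

theorem hasDerivAt_gram (hy : y ∈ s) (c a b : Idx n) :
    HasDerivAt (fun t : ℝ => gramOf (w (y + t • realBasis n c)) a b) (gramD w c y a b) 0 :=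
  Complex.reCLM.hasFDerivAt.comp_hasDerivAt (0 : ℝ) (hw.hasDerivAt_apply hy _ _)

/-- Obtained by differentiating the identity `P G = 1` along the line. -/
theorem hasDerivAt_gramInv (hy : y ∈ s) (c a b : Idx n) :
    HasDerivAt (fun t : ℝ => gramInv w (y + t • realBasis n c) a b)
      ((-(gramInv w y * gramD w c y * gramInv w y)) a b) 0 := by
  have hd : ∀ a b, HasDerivAt (fun t : ℝ => gramInv w (y + t • realBasis n c) a b)
      (fderiv ℝ (fun z => gramInv w z a b) y (realBasis n c)) 0 := fun a b =>
    hasDerivAt_line (((hw.contDiffOn_gramInv a b).contDiffAt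
      (hw.isOpen.mem_nhds hy)).differentiableAt (by simp)) _
  let D : Matrix (Idx n) (Idx n) ℝ :=
    Matrix.of fun a b => fderiv ℝ (fun z => gramInv w z a b) y (realBasis n c)
  have h1 : D * gramOf (w y) + gramInv w y * gramD w c y = 0 := by
    ext a b
    have h := HasDerivAt.fun_sum (u := Finset.univ) fun d (_ : d ∈ Finset.univ) =>
      (hd a d).mul (hw.hasDerivAt_gram hy c d b)
    have h2 : (fun t : ℝ => ∑ d, gramInv w (y + t • realBasis n c) a d *
        gramOf (w (y + t • realBasis n c)) d b) =ᶠ[nhds 0]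
          fun _ => (1 : Matrix (Idx n) (Idx n) ℝ) a b := by
      filter_upwards [hw.line_mem hy (realBasis n c)] with t ht
      rw [← hw.inv_mul_gram ht, Matrix.mul_apply]
    have h3 := h.unique ((hasDerivAt_const (0 : ℝ) _).congr_of_eventuallyEq h2)
    rw [Matrix.add_apply, Matrix.mul_apply, Matrix.mul_apply, ← Finset.sum_add_distrib]
    simpa [D] using h3
  have h2 : D = -(gramInv w y * gramD w c y * gramInv w y) := by
    have h3 : D = D * gramOf (w y) * gramInv w y := by
      rw [Matrix.mul_assoc, hw.gram_mul_inv hy, Matrix.mul_one]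
    rw [h3, eq_neg_of_add_eq_zero_left h1, Matrix.neg_mul]
  rw [← h2]
  exact hd a b

/-- `dω = ∑ eᵃ ∧ ∂ₐω` with each `∂ₐω` real of type `(1, 1)`. Hence `[Λ, eᵃ ∧ ∂ₐω ∧ ·]` is `eᵃ ∧ [Λ,
∂ₐω ∧ ·]` minus contraction with the dual of `eᵃ ∘ J` after `∂ₐω ∧ ·`, and adjoints are taken factor
by factor. -/
theorem isAdj_flatTors (hy : y ∈ s) :
    IsAdj (gramInv w y)
      (lam (gramInv w y) * wedgeL (flatD (fun z => Pi.single 2 (w z)) y) -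
        wedgeL (flatD (fun z => Pi.single 2 (w z)) y) * lam (gramInv w y)) (flatTors w y) := by
  have hJ := hw.jInvariant hy
  have hs := hw.isSymm hy
  have hpd : ∀ a, pd a (fun z => Pi.single 2 (w z)) y =
      Pi.single 2 (fderiv ℝ w y (realBasis n a)) := by
    intro a
    funext k
    by_cases hk : k = 2
    · subst hk
      simp [pd]
    · simp [pd, hk]
  have hM : wedgeL (flatD (fun z => Pi.single 2 (w z)) y) =
      ∑ a, extB a * lef (gramD w a y) := by
    rw [flatD, map_sum]
    refine Finset.sum_congr rfl fun a _ => ?_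
    rw [hpd, gramD, ← wedgeL_single_two (hw.isReal11_fderiv hy _)]
    exact LinearMap.ext fun α => wedge_assoc _ _ _
  rw [hM, Finset.mul_sum, Finset.sum_mul, ← Finset.sum_sub_distrib]
  refine IsAdj.sum fun a _ => ?_
  have hDs := hw.gramD_symm hy a
  have e : lam (gramInv w y) * (extB a * lef (gramD w a y)) -
      extB a * lef (gramD w a y) * lam (gramInv w y) =
      extB a * lefBracket (gramInv w y) (gramD w a y) -
        sharp (gramInv w y) (compJ (coord a)) * lef (gramD w a y) := by
    rw [← mul_assoc, extB, lam_mul_ext hJ hs, sub_mul, mul_assoc, lam_mul_lef hJ hs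
      (hw.gramD_jInvariant hy a) hDs, mul_add, mul_assoc]
    abel
  rw [e]
  have hreal : IsRealCovector (compJ (coord a)) := fun v => isRealCovector_coord a _
  exact ((isAdj_extB hs a).mul (isAdj_lefBracket hs hDs)).sub
    (((isAdj_ext hs hreal).symm hs).mul (isAdj_lef hs _))

/-- Leibniz rule: the coefficients of `Λ` form the inverse Gram matrix, whose derivative `-P (∂ₐG)
P` is recognized through `lefAdj_eq`. -/
theorem pd_lam {v : Model n → Cov n} (hv : FSmooth v s) (hy : y ∈ s) (a : Idx n) :
    pd a (fun z => lam (gramInv w z) (v z)) y =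
      lam (gramInv w y) (pd a v y) - lefAdj (gramInv w y) (gramD w a y) (v y) := by
  have h := hasOpDeriv_lam (hw.hasDerivAt_gramInv hy a) _ _ (hv.hasCovDeriv hw.isOpen hy a)
  rw [pd_eq_of_hasCovDeriv (opSmooth_lam hw.contDiffOn_gramInv _ hv) hw.isOpen hy h]
  rw [lefAdj_eq (hw.jInvariant hy) (hw.isSymm hy) (hw.gramD_symm hy a)]
  have : lam (-(gramInv w y * gramD w a y * gramInv w y)) =
      -lam (gramInv w y * gramD w a y * gramInv w y) := by
    simp [lam]
  rw [this]
  simp only [zero_smul, add_zero, LinearMap.neg_apply]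
  abel

/-- Puts the commutator expression into the shape delivered by integration by parts. Moving `(eᵃ ∘
J) ∧ ·` past `Λ`, and past the operator coming from the derivative of `Λ`, gives contraction with
the dual of `eᵃ` and the derivative of that contraction; the first half of the torsion term gives
the derivative of the metric and the volume. -/
theorem flatCod_eq {v : Model n → Cov n} (hv : FSmooth v s) (hy : y ∈ s) :
    flatCod w v y = -∑ a, (sharpB (gramInv w y) a (pd a v y) +
      (-sharpB (gramInv w y * gramD w a y * gramInv w y) a) (v y) +
      lefBracket (gramInv w y) (gramD w a y) (sharpB (gramInv w y) a (v y))) := by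
  have hJ := hw.jInvariant hy
  have hs := hw.isSymm hy
  rw [flatCod, flatDc, flatDc, flatTors, LinearMap.sum_apply, map_sum, ← Finset.sum_sub_distrib,
    ← Finset.sum_sub_distrib, ← Finset.sum_neg_distrib]
  refine Finset.sum_congr rfl fun a _ => ?_
  rw [hw.pd_lam hv hy]
  have h1 := LinearMap.congr_fun (lam_mul_extJ hJ hs a) (pd a v y)
  have hDs := hw.gramD_symm hy a
  set Q := gramInv w y * gramD w a y * gramInv w y with hQ
  have hQs : Q.IsSymm := by
    rw [Matrix.IsSymm, hQ, Matrix.transpose_mul, Matrix.transpose_mul, hs.eq, hDs.eq,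
      Matrix.mul_assoc]
  have hQ2 : lam Q * extJ a = extJ a * lam Q + sharpB Q a := by
    exact lam_mul_extJ ((hJ.mul (hw.gramD_jInvariant hy a)).mul hJ) hQs a
  have h2 := LinearMap.congr_fun hQ2 (v y)
  rw [lefAdj_eq hJ hs hDs, ← hQ]
  simp only [Module.End.mul_apply, LinearMap.add_apply, LinearMap.sub_apply, LinearMap.neg_apply,
    map_sub] at h1 h2 ⊢
  rw [h1, h2]
  abel

/-- The vector field with components `⟨u, ♯ₐ v⟩` times the density has as its divergence the
pointwise defect of adjointness between `d` and `flatCod`. The variations of the metric and of the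
density combine into `[Λ, ∂ₐω ∧ ·]` acting on `♯ₐ v`. -/
theorem divergence {u v : Model n → Cov n} (hu : FSmooth u s) (hv : FSmooth v s) (hy : y ∈ s) :
    ∑ a, fderiv ℝ (fun z => innerP (gramInv w z) (u z) (sharpB (gramInv w z) a (v z)) *
      (Real.sqrt (gramOf (w z)).det : ℂ)) y (realBasis n a) =
    (innerP (gramInv w y) (flatD u y) (v y) - innerP (gramInv w y) (u y) (flatCod w v y)) *
      (Real.sqrt (gramOf (w y)).det : ℂ) := by
  have hs := hw.isSymm hy
  have key : ∀ a, fderiv ℝ (fun z => innerP (gramInv w z) (u z) (sharpB (gramInv w z) a (v z)) *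
      (Real.sqrt (gramOf (w z)).det : ℂ)) y (realBasis n a) =
      (innerP (gramInv w y) (extB a (pd a u y)) (v y) + innerP (gramInv w y) (u y)
        (sharpB (gramInv w y) a (pd a v y) +
          (-sharpB (gramInv w y * gramD w a y * gramInv w y) a) (v y) +
          lefBracket (gramInv w y) (gramD w a y) (sharpB (gramInv w y) a (v y)))) *
      (Real.sqrt (gramOf (w y)).det : ℂ) := by
    intro a
    have h1 := hasDerivAt_innerP (G := gramD w a y) (t := 0)
      (P := fun t : ℝ => gramInv w (y + t • realBasis n a))
      (by simpa using hs) (by simpa using hw.hasDerivAt_gramInv hy a)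
      (hu.hasCovDeriv hw.isOpen hy a)
      (hasOpDeriv_sharpB (hw.hasDerivAt_gramInv hy a) a _ _ (hv.hasCovDeriv hw.isOpen hy a))
    have h2 := hasDerivAt_sqrt_det (hw.hasDerivAt_gram hy a) (by simpa using hw.det_pos hy)
    have h3 := h1.mul h2.ofReal_comp
    have h4 : DifferentiableAt ℝ (fun z => innerP (gramInv w z) (u z)
        (sharpB (gramInv w z) a (v z)) * (Real.sqrt (gramOf (w z)).det : ℂ)) y :=
      (((contDiffOn_innerP hw.contDiffOn_gramInv hu
        (opSmooth_sharpB hw.contDiffOn_gramInv a _ hv)).mul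
        (contDiffOn_ofReal hw.contDiffOn_density)).contDiffAt
          (hw.isOpen.mem_nhds hy)).differentiableAt (by simp)
    rw [(hasDerivAt_line h4 (realBasis n a)).unique h3]
    simp only [zero_smul, add_zero]
    have hneg : sharpB (-(gramInv w y * gramD w a y * gramInv w y)) a =
        -sharpB (gramInv w y * gramD w a y * gramInv w y) a := by
      simp [sharpB]
    -- The term with `∂ₐu` is moved to the second argument; what remains is that `gramDeriv` plus
    -- the scalar from the density is `lefBracket`.
    rw [isAdj_extB hs, hneg, map_add, map_add, map_add, lefBracket, gramDeriv]
    simp only [LinearMap.sub_apply, LinearMap.smul_apply, Module.End.one_apply, map_sub,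
      LinearMap.map_smulₛₗ, LinearMap.neg_apply, map_neg, smul_eq_mul, map_mul, conj_half,
      Complex.conj_ofReal, gramInv]
    push_cast
    ring
  rw [Finset.sum_congr rfl fun a _ => key a, ← Finset.sum_mul, Finset.sum_add_distrib,
    hw.flatCod_eq hv hy, flatD, map_neg, map_sum, map_sum, sub_neg_eq_add, LinearMap.sum_apply]

theorem fsmooth_lam {v : Model n → Cov n} (hv : FSmooth v s) :
    FSmooth (fun z => lam (gramInv w z) (v z)) s := opSmooth_lam hw.contDiffOn_gramInv _ hv

theorem fsmooth_flatTors {v : Model n → Cov n} (hv : FSmooth v s) :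
    FSmooth (fun z => flatTors w z (v z)) s := by
  refine OpSmooth.sum (fun a _ => OpSmooth.sub (OpSmooth.mul ?_ ?_) (OpSmooth.mul ?_ ?_)) _ hv
  · exact opSmooth_lefBracket hw.contDiffOn_gramInv (hw.contDiffOn_gramD a)
  · exact opSmooth_sharpB hw.contDiffOn_gramInv a
  · exact opSmooth_lefAdj hw.contDiffOn_gramInv (hw.contDiffOn_gramD a)
  · exact opSmooth_ext _

end FlatMetric

theorem FSmooth.flatD {n : ℕ} {u : Model n → Cov n} {s : Set (Model n)} (hu : FSmooth u s)
    (hs : IsOpen s) : FSmooth (flatD u) s := FSmooth.sum fun a _ => (hu.pd hs a).ext _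

theorem FSmooth.flatDc {n : ℕ} {u : Model n → Cov n} {s : Set (Model n)} (hu : FSmooth u s)
    (hs : IsOpen s) : FSmooth (flatDc u) s := FSmooth.sum fun a _ => (hu.pd hs a).ext _

/-! ### Forms in the charts of a complex manifold -/

section Charts

variable {n : ℕ} {X : Type*} [TopologicalSpace X] [ChartedSpace (Model n) X]

/-- The transition map from the preferred chart at `x₀` to the preferred chart at `x₁`. -/
def trans (x₀ x₁ : X) (y : Model n) : Model n :=
  chartAt (Model n) x₁ ((chartAt (Model n) x₀).symm y)

/-- The domain of the transition map. -/
def transDom (x₀ x₁ : X) : Set (Model n) :=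
  (chartAt (Model n) x₀).target ∩ (chartAt (Model n) x₀).symm ⁻¹' (chartAt (Model n) x₁).source

theorem isOpen_transDom (x₀ x₁ : X) : IsOpen (transDom (n := n) x₀ x₁) :=
  (chartAt (Model n) x₀).isOpen_inter_preimage_symm (chartAt (Model n) x₁).open_source

theorem trans_mem (x₀ x₁ : X) {y : Model n} (hy : y ∈ transDom x₀ x₁) :
    trans x₀ x₁ y ∈ transDom x₁ x₀ := by
  refine ⟨(chartAt (Model n) x₁).map_source hy.2, ?_⟩
  rw [Set.mem_preimage, trans, (chartAt (Model n) x₁).left_inv hy.2]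
  exact (chartAt (Model n) x₀).map_target hy.1

theorem symm_trans (x₀ x₁ : X) {y : Model n} (hy : y ∈ transDom x₀ x₁) :
    (chartAt (Model n) x₁).symm (trans x₀ x₁ y) = (chartAt (Model n) x₀).symm y :=
  (chartAt (Model n) x₁).left_inv hy.2

theorem trans_trans (x₀ x₁ x₂ : X) {y : Model n} (hy : y ∈ transDom x₀ x₁) :
    trans x₁ x₂ (trans x₀ x₁ y) = trans x₀ x₂ y := by
  rw [trans, symm_trans x₀ x₁ hy, trans]

theorem trans_self (x₀ : X) {y : Model n} (hy : y ∈ (chartAt (Model n) x₀).target) :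
    trans x₀ x₀ y = y := (chartAt (Model n) x₀).right_inv hy

theorem mem_transDom (x₀ : X) {y : Model n} (hy : y ∈ (chartAt (Model n) x₀).target) :
    y ∈ transDom x₀ ((chartAt (Model n) x₀).symm y) := ⟨hy, mem_chart_source _ _⟩

theorem mem_transDom_self (x₀ : X) {y : Model n} (hy : y ∈ (chartAt (Model n) x₀).target) :
    y ∈ transDom x₀ x₀ := ⟨hy, (chartAt (Model n) x₀).map_target hy⟩

/-- The derivative of the transition map. -/
def dTrans (x₀ x₁ : X) (y : Model n) : Model n →L[ℝ] Model n := fderiv ℝ (trans x₀ x₁) y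

theorem dTrans_self (x₀ : X) {y : Model n} (hy : y ∈ (chartAt (Model n) x₀).target) :
    dTrans x₀ x₀ y = ContinuousLinearMap.id ℝ (Model n) := by
  have h : trans x₀ x₀ =ᶠ[nhds y] id := by
    filter_upwards [(chartAt (Model n) x₀).open_target.mem_nhds hy] with z hz
    exact trans_self x₀ hz
  rw [dTrans, h.fderiv_eq, fderiv_id]

section Smooth

variable [IsManifold 𝓘(ℂ, Model n) ω X]

theorem contDiffOn_trans_complex (x₀ x₁ : X) :
    ContDiffOn ℂ ω (trans x₀ x₁) (transDom (n := n) x₀ x₁) := by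
  have := contDiffOn_ext_coord_change (I := 𝓘(ℂ, Model n)) (n := ω) x₁ x₀
  simp only [extChartAt, OpenPartialHomeomorph.extend, modelWithCornersSelf_partialEquiv,
    PartialEquiv.trans_refl] at this
  exact this

theorem contDiffOn_trans (x₀ x₁ : X) :
    ContDiffOn ℝ ∞ (trans x₀ x₁) (transDom (n := n) x₀ x₁) :=
  ((contDiffOn_trans_complex x₀ x₁).restrict_scalars ℝ).of_le le_top

theorem differentiableAt_trans (x₀ x₁ : X) {y : Model n} (hy : y ∈ transDom x₀ x₁) :
    DifferentiableAt ℝ (trans x₀ x₁) y :=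
  ((contDiffOn_trans x₀ x₁).contDiffAt ((isOpen_transDom x₀ x₁).mem_nhds hy)).differentiableAt
    (by simp)

theorem dTrans_smul (x₀ x₁ : X) {y : Model n} (hy : y ∈ transDom x₀ x₁) (v : Model n) :
    dTrans x₀ x₁ y (Complex.I • v) = Complex.I • dTrans x₀ x₁ y v := by
  have h : DifferentiableAt ℂ (trans x₀ x₁) y :=
    ((contDiffOn_trans_complex x₀ x₁).contDiffAt
      ((isOpen_transDom x₀ x₁).mem_nhds hy)).differentiableAt (by simp)
  rw [dTrans, (h.hasFDerivAt.restrictScalars ℝ).fderiv]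
  simp

theorem dTrans_comp (x₀ x₁ x₂ : X) {y : Model n} (hy : y ∈ transDom x₀ x₁)
    (hy' : y ∈ transDom x₀ x₂) :
    dTrans x₀ x₂ y = (dTrans x₁ x₂ (trans x₀ x₁ y)).comp (dTrans x₀ x₁ y) := by
  have h2 : trans x₀ x₁ y ∈ transDom x₁ x₂ := by
    refine ⟨(trans_mem x₀ x₁ hy).1, ?_⟩
    rw [Set.mem_preimage, symm_trans x₀ x₁ hy]
    exact hy'.2
  have h : trans x₀ x₂ =ᶠ[nhds y] trans x₁ x₂ ∘ trans x₀ x₁ := by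
    filter_upwards [(isOpen_transDom x₀ x₁).mem_nhds hy] with z hz
    exact (trans_trans x₀ x₁ x₂ hz).symm
  rw [dTrans, h.fderiv_eq, fderiv_comp _ (differentiableAt_trans x₁ x₂ h2)
    (differentiableAt_trans x₀ x₁ hy)]
  rfl

theorem dTrans_comp_symm (x₀ x₁ : X) {y : Model n} (hy : y ∈ transDom x₀ x₁) :
    (dTrans x₁ x₀ (trans x₀ x₁ y)).comp (dTrans x₀ x₁ y) = ContinuousLinearMap.id ℝ (Model n) := by
  rw [← dTrans_comp x₀ x₁ x₀ hy (mem_transDom_self x₀ hy.1), dTrans_self x₀ hy.1]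

theorem dTrans_symm_comp (x₀ x₁ : X) {y : Model n} (hy : y ∈ transDom x₀ x₁) :
    (dTrans x₀ x₁ y).comp (dTrans x₁ x₀ (trans x₀ x₁ y)) = ContinuousLinearMap.id ℝ (Model n) := by
  have h := dTrans_comp_symm x₁ x₀ (trans_mem x₀ x₁ hy)
  rwa [trans_trans x₀ x₁ x₀ hy, trans_self x₀ hy.1] at h

variable (n X) in
theorem isManifold_real : IsManifold 𝓘(ℝ, Model n) ∞ X := by
  refine isManifold_of_contDiffOn _ _ _ fun e e' he he' => ?_
  have h := (contDiffGroupoid ω 𝓘(ℂ, Model n)).compatible he he'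
  rw [contDiffGroupoid, mem_groupoid_of_pregroupoid] at h
  have h1 := h.1
  simp only [contDiffPregroupoid, modelWithCornersSelf_coe, modelWithCornersSelf_coe_symm,
    Set.preimage_id, Set.range_id, Set.inter_univ, Function.id_comp, Function.comp_id] at h1 ⊢
  exact (h1.restrict_scalars ℝ).of_le le_top

/-- The derivative at `y` of the inverse of the preferred chart at `x₀`. -/
def dSymm (x₀ : X) (y : Model n) : Model n →L[ℝ] Model n :=
  mfderiv 𝓘(ℝ, Model n) 𝓘(ℝ, Model n) (chartAt (Model n) x₀).symm y

/-- Tangent vectors at a point are read in the preferred chart at that point, so the differential of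
an inverse chart is the derivative of the transition map into the preferred chart at the image. -/
theorem dSymm_eq (x₀ : X) {y : Model n} (hy : y ∈ (chartAt (Model n) x₀).target) :
    dSymm x₀ y = dTrans x₀ ((chartAt (Model n) x₀).symm y) y := by
  have := isManifold_real n X
  have : IsManifold 𝓘(ℝ, Model n) 1 X := IsManifold.of_le (n := ∞) (by simp)
  refine (mdifferentiableAt_atlas_symm (I := 𝓘(ℝ, Model n))
    (chart_mem_atlas _ x₀) hy).mfderiv.trans ?_
  simp only [writtenInExtChartAt, extChartAt, OpenPartialHomeomorph.extend,
    modelWithCornersSelf_partialEquiv, PartialEquiv.trans_refl, modelWithCornersSelf_coe,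
    Set.range_id, fderivWithin_univ]
  rfl

theorem mfderiv_chart_self (x : X) :
    (mfderiv 𝓘(ℝ, Model n) 𝓘(ℝ, Model n) (chartAt (Model n) x) x : Model n →L[ℝ] Model n) =
      ContinuousLinearMap.id ℝ (Model n) := by
  have := isManifold_real n X
  have : IsManifold 𝓘(ℝ, Model n) 1 X := IsManifold.of_le (n := ∞) (by simp)
  refine (mdifferentiableAt_atlas (I := 𝓘(ℝ, Model n)) (chart_mem_atlas _ x)
    (mem_chart_source _ x)).mfderiv.trans ?_
  simp only [writtenInExtChartAt, extChartAt, OpenPartialHomeomorph.extend,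
    modelWithCornersSelf_partialEquiv, PartialEquiv.trans_refl, modelWithCornersSelf_coe,
    Set.range_id, fderivWithin_univ]
  exact dTrans_self x (mem_chart_target _ x)

end Smooth

/-- The local representative of a form in the preferred chart at `x₀`. -/
def loc (x₀ : X) (u : Form n X) (y : Model n) : Cov n := fun k => localRep x₀ u k y

theorem loc_eq (x₀ : X) (u : Form n X) (y : Model n) :
    loc x₀ u y = pullback (dSymm x₀ y) (u ((chartAt (Model n) x₀).symm y)) := rfl

theorem isSmoothForm_iff {u : Form n X} :
    IsSmoothForm u ↔ ∀ x₀ : X, FSmooth (loc x₀ u) (chartAt (Model n) x₀).target :=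
  ⟨fun h x₀ k w => contDiffOn_alt_apply (h k x₀) w, fun h k x₀ => (h x₀).contDiffOn k⟩

theorem loc_conjForm (x₀ : X) (u : Form n X) (y : Model n) :
    loc x₀ (conjForm u) y = conjCov (loc x₀ u y) := rfl

theorem loc_add (x₀ : X) (u v : Form n X) (y : Model n) :
    loc x₀ (u + v) y = loc x₀ u y + loc x₀ v y := by
  simp only [loc_eq, Pi.add_apply, map_add]

theorem loc_sub (x₀ : X) (u v : Form n X) (y : Model n) :
    loc x₀ (u - v) y = loc x₀ u y - loc x₀ v y := by
  simp only [loc_eq, Pi.sub_apply, map_sub]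

theorem loc_smul (x₀ : X) (f : X → ℂ) (u : Form n X) (y : Model n) :
    loc x₀ (fun x => f x • u x) y = f ((chartAt (Model n) x₀).symm y) • loc x₀ u y := by
  simp only [loc_eq, map_smul]

section Smooth

variable [IsManifold 𝓘(ℂ, Model n) ω X]

theorem dSymm_smul (x₀ : X) {y : Model n} (hy : y ∈ (chartAt (Model n) x₀).target) (v : Model n) :
    dSymm x₀ y (Complex.I • v) = Complex.I • dSymm x₀ y v := by
  rw [dSymm_eq x₀ hy]
  exact dTrans_smul _ _ (mem_transDom x₀ hy) v

/-- The inverse of `dSymm`. -/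
def dSymmInv (x₀ : X) (y : Model n) : Model n →L[ℝ] Model n :=
  dTrans ((chartAt (Model n) x₀).symm y) x₀ (trans x₀ ((chartAt (Model n) x₀).symm y) y)

theorem dSymmInv_comp (x₀ : X) {y : Model n} (hy : y ∈ (chartAt (Model n) x₀).target) :
    (dSymmInv x₀ y).comp (dSymm x₀ y) = ContinuousLinearMap.id ℝ (Model n) := by
  rw [dSymm_eq x₀ hy]
  exact dTrans_comp_symm _ _ (mem_transDom x₀ hy)

theorem dSymm_comp (x₀ : X) {y : Model n} (hy : y ∈ (chartAt (Model n) x₀).target) :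
    (dSymm x₀ y).comp (dSymmInv x₀ y) = ContinuousLinearMap.id ℝ (Model n) := by
  rw [dSymm_eq x₀ hy]
  exact dTrans_symm_comp _ _ (mem_transDom x₀ hy)

theorem loc_trans (x₀ x₁ : X) (u : Form n X) {y : Model n} (hy : y ∈ transDom x₀ x₁) :
    loc x₀ u y = pullback (dTrans x₀ x₁ y) (loc x₁ u (trans x₀ x₁ y)) := by
  rw [loc_eq, loc_eq, pullback_comp, symm_trans x₀ x₁ hy, dSymm_eq x₀ hy.1,
    dSymm_eq x₁ (trans_mem x₀ x₁ hy).1, symm_trans x₀ x₁ hy,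
    ← dTrans_comp x₀ x₁ _ hy (mem_transDom x₀ hy.1)]

theorem loc_self (x : X) (u : Form n X) : loc x u (chartAt (Model n) x x) = u x := by
  rw [loc_eq, dSymm_eq x (mem_chart_target _ x),
    (chartAt (Model n) x).left_inv (mem_chart_source _ x),
    dTrans_self x (mem_chart_target _ x), pullback_id]

theorem loc_theta (x₀ : X) (η : X → ℝ) (u : Form n X) {y : Model n}
    (hy : y ∈ (chartAt (Model n) x₀).target) :
    loc x₀ (theta η u) y = thetaL (η ((chartAt (Model n) x₀).symm y)) (loc x₀ u y) := by
  rw [loc_eq, loc_eq, thetaL_pullback _ (dSymm_smul x₀ hy)]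
  rfl

end Smooth

/-! ### The exterior derivative -/

theorem ext_apply_sum {n : ℕ} (ξ : Model n →L[ℝ] ℂ) (k : ℕ) (α : Cov n)
    (w : Fin (k + 1) → Model n) :
    ext ξ α (k + 1) w = ∑ i : Fin (k + 1), (-1 : ℂ) ^ i.1 * (ξ (w i) * α k (i.removeNth w)) := by
  induction k generalizing α with
  | zero =>
    rw [ext_succ_apply, ext_zero_deg]
    have : Fin.tail w = Fin.removeNth 0 w := Subsingleton.elim _ _
    rw [this, Fin.sum_univ_one]
    simp
  | succ k ih =>
    rw [ext_succ_apply, ih, Fin.sum_univ_succ (n := k + 1), sub_eq_add_neg,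
      ← Finset.sum_neg_distrib]
    refine congrArg₂ _ (by simp) (Finset.sum_congr rfl fun i _ => ?_)
    have e : i.succ.removeNth w = Fin.cons (w 0) (i.removeNth (Fin.tail w)) := by
      funext j
      refine Fin.cases ?_ (fun j => ?_) j
      · simp [Fin.removeNth]
      · simp [Fin.removeNth, Fin.tail]
    rw [e, contr_apply, Fin.val_succ, pow_succ]
    simp only [Fin.tail]
    ring

theorem flatD_zero {n : ℕ} (u : Model n → Cov n) (y : Model n) : flatD u y 0 = 0 := by
  simp [flatD, extB, ext_zero_deg]

/-- Expanding the differentiating vector `w i` in the real basis turns the usual alternating sum of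
directional derivatives into `∑ eᵃ ∧ ∂ₐ`. -/
theorem flatD_eq_extDeriv {n : ℕ} {u : Model n → Cov n} {s : Set (Model n)} (hu : FSmooth u s)
    (hs : IsOpen s) {y : Model n} (hy : y ∈ s) (k : ℕ) :
    flatD u y (k + 1) = extDeriv (fun z => u z k) y := by
  have hd : DifferentiableAt ℝ (fun z => u z k) y :=
    ((hu.contDiffOn k).contDiffAt (hs.mem_nhds hy)).differentiableAt (by simp)
  ext w
  rw [extDeriv_apply hd, flatD, Finset.sum_apply, ContinuousAlternatingMap.sum_apply]
  simp only [extB, ext_apply_sum]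
  rw [Finset.sum_comm]
  refine Finset.sum_congr rfl fun i _ => ?_
  have hval : ∀ v, fderiv ℝ (fun z => u z k (i.removeNth w)) y v =
      fderiv ℝ (fun z => u z k) y v (i.removeNth w) := by
    intro v
    have := (ContinuousAlternatingMap.apply ℝ (Model n) ℂ (i.removeNth w) :
      Alt n k →L[ℝ] ℂ).hasFDerivAt.comp y hd.hasFDerivAt
    exact congrArg (fun L : Model n →L[ℝ] ℂ => L v) this.fderiv
  rw [hval]
  conv_rhs => rw [← sum_coordR (w i), map_sum, ContinuousAlternatingMap.sum_apply]
  rw [Finset.smul_sum]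
  refine Finset.sum_congr rfl fun a _ => ?_
  rw [map_smul, coord_apply]
  simp [pd]

section Smooth

variable [IsManifold 𝓘(ℂ, Model n) ω X]

theorem extD_eq {u : Form n X} (hu : IsSmoothForm u) (x : X) :
    extD u x = flatD (loc x u) (chartAt (Model n) x x) := by
  funext k
  cases k with
  | zero => rw [flatD_zero]; rfl
  | succ k =>
    rw [flatD_eq_extDeriv (isSmoothForm_iff.1 hu x) (chartAt (Model n) x).open_target
      (mem_chart_target _ x)]
    change (extDeriv (localRep x u k) (chartAt (Model n) x x)).compContinuousLinearMap
      (mfderiv 𝓘(ℝ, Model n) 𝓘(ℝ, Model n) (chartAt (Model n) x) x) = _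
    have h := mfderiv_chart_self (n := n) x
    exact (congrArg (fun L : Model n →L[ℝ] Model n =>
      (extDeriv (localRep x u k) (chartAt (Model n) x x)).compContinuousLinearMap L) h).trans
        (ContinuousAlternatingMap.ext fun w => rfl)

/-- Naturality of the exterior derivative under the transition maps. Since `extD` is computed at
each point in that point's own chart, this is what makes `flatD` its expression in every chart. -/
theorem flatD_pullback {u : Form n X} (hu : IsSmoothForm u) (x₀ x₁ : X) {y : Model n}
    (hy : y ∈ transDom x₀ x₁) :
    flatD (loc x₀ u) y = pullback (dTrans x₀ x₁ y) (flatD (loc x₁ u) (trans x₀ x₁ y)) := by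
  funext k
  cases k with
  | zero =>
    rw [flatD_zero]
    change (0 : Alt n 0) = (flatD (loc x₁ u) (trans x₀ x₁ y) 0).compContinuousLinearMap _
    rw [flatD_zero]; rfl
  | succ k =>
    have hu0 := isSmoothForm_iff.1 hu x₀
    have hu1 := isSmoothForm_iff.1 hu x₁
    have hy1 := (trans_mem x₀ x₁ hy).1
    change _ = (flatD (loc x₁ u) (trans x₀ x₁ y) (k + 1)).compContinuousLinearMap _
    rw [flatD_eq_extDeriv hu0 (chartAt (Model n) x₀).open_target hy.1,
      flatD_eq_extDeriv hu1 (chartAt (Model n) x₁).open_target hy1]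
    have hd : DifferentiableAt ℝ (fun z => loc x₁ u z k) (trans x₀ x₁ y) :=
      ((hu1.contDiffOn k).contDiffAt
        ((chartAt (Model n) x₁).open_target.mem_nhds hy1)).differentiableAt (by simp)
    have h := extDeriv_pullback (r := ∞) hd ((contDiffOn_trans x₀ x₁).contDiffAt
      ((isOpen_transDom x₀ x₁).mem_nhds hy)) (by
      rw [minSmoothness_of_isRCLikeNormedField]; exact WithTop.coe_le_coe.2 (le_top : (2 : ℕ∞) ≤ ⊤))
    have e : (fun z => loc x₀ u z k) =ᶠ[nhds y] fun z =>
        (loc x₁ u (trans x₀ x₁ z) k).compContinuousLinearMap (fderiv ℝ (trans x₀ x₁) z) := by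
      filter_upwards [(isOpen_transDom x₀ x₁).mem_nhds hy] with z hz
      rw [loc_trans x₀ x₁ u hz]
      rfl
    rw [e.extDeriv_eq, h]
    rfl

theorem loc_extD {u : Form n X} (hu : IsSmoothForm u) (x₀ : X) {y : Model n}
    (hy : y ∈ (chartAt (Model n) x₀).target) : loc x₀ (extD u) y = flatD (loc x₀ u) y := by
  rw [flatD_pullback hu x₀ _ (mem_transDom x₀ hy), loc_eq, extD_eq hu, dSymm_eq x₀ hy]
  rfl

theorem isSmoothForm_extD {u : Form n X} (hu : IsSmoothForm u) : IsSmoothForm (extD u) :=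
  isSmoothForm_iff.2 fun x₀ => ((isSmoothForm_iff.1 hu x₀).flatD
    (chartAt (Model n) x₀).open_target).congr fun _ hy => loc_extD hu x₀ hy

end Smooth

end Charts

/-! ### Gram matrices of `(1, 1)`-forms -/

theorem contr_sum {n : ℕ} {ι : Type*} (s : Finset ι) (f : ι → Model n) :
    contr (∑ i ∈ s, f i) = ∑ i ∈ s, contr (f i) := by
  classical
  induction s using Finset.induction_on with
  | empty => simp [contr_zero]
  | insert i s hi ih => rw [Finset.sum_insert hi, Finset.sum_insert hi, contr_add, ih]

theorem contr_I_expand {n : ℕ} (u : Model n) :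
    contr (Complex.I • u) = ∑ b, (coordR b u : ℂ) • contrJ b := by
  conv_lhs => rw [← sum_coordR u, Finset.smul_sum, contr_sum]
  refine Finset.sum_congr rfl fun b _ => ?_
  rw [smul_comm, contr_smul]
  rfl

theorem alt_two_eq_contr {n : ℕ} (w : Alt n 2) (v u : Model n) :
    w ![v, u] = contr u (contr v (Pi.single 2 w : Cov n)) 0 Fin.elim0 := by
  rw [contr_apply, contr_apply, Pi.single_eq_same]
  refine congrArg _ ?_
  funext a
  fin_cases a <;> rfl

theorem IsReal11.gramOf_bilin {n : ℕ} {w : Alt n 2} (hw : IsReal11 w) (v u : Model n) :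
    w ![v, Complex.I • u] =
      ((∑ a, ∑ b, coordR a v * coordR b u * gramOf w a b : ℝ) : ℂ) := by
  rw [alt_two_eq_contr, contr_I_expand, contr_expand v]
  simp only [LinearMap.sum_apply, LinearMap.smul_apply, map_sum, map_smul, Finset.sum_apply,
    Pi.smul_apply, ContinuousAlternatingMap.sum_apply, ContinuousAlternatingMap.smul_apply,
    smul_eq_mul]
  push_cast
  refine Finset.sum_congr rfl fun a _ => ?_
  rw [Finset.mul_sum]
  refine Finset.sum_congr rfl fun b _ => ?_
  rw [hw.gramOf_coe, alt_two_eq_contr, coord_apply]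
  simp only [contrJ]
  ring

theorem IsReal11.gramOf_posDef {n : ℕ} {w : Alt n 2} (hw : IsReal11 w)
    (hpos : ∀ v : Model n, v ≠ 0 → 0 < (w ![v, Complex.I • v]).re) : (gramOf w).PosDef := by
  refine Matrix.PosDef.of_dotProduct_mulVec_pos ?_ fun x hx => ?_
  · rw [Matrix.IsHermitian, Matrix.conjTranspose_eq_transpose_of_trivial, hw.symm.eq]
  · have hc : ∀ a, coordR a (∑ b, x b • realBasis n b) = x a := by
      intro a
      have h1 : (coordR a (∑ b, x b • realBasis n b) : ℂ) = x a := by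
        rw [← coord_apply, map_sum]
        simp only [map_smul, coord_realBasis]
        simp
      exact_mod_cast h1
    have hne : ∑ b, x b • realBasis n b ≠ 0 := by
      intro h0
      apply hx
      funext a
      rw [← hc a, h0]
      simp [coordR]
    have h := hpos _ hne
    rw [hw.gramOf_bilin, Complex.ofReal_re] at h
    simp only [hc] at h
    simp only [star_trivial, dotProduct, Matrix.mulVec, Finset.mul_sum]
    refine h.trans_eq ?_
    exact Finset.sum_congr rfl fun a _ => Finset.sum_congr rfl fun b _ => by ring

theorem IsReal11.comp {n : ℕ} {w : Alt n 2} (hw : IsReal11 w) {A : Model n →L[ℝ] Model n}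
    (hA : ∀ v, A (Complex.I • v) = Complex.I • A v) : IsReal11 (w.compContinuousLinearMap A) where
  real v := hw.real _
  invariant v u := by
    have h : ∀ x z : Model n, w.compContinuousLinearMap A ![x, z] = w ![A x, A z] := by
      intro x z
      rw [ContinuousAlternatingMap.compContinuousLinearMap_apply]
      refine congrArg _ ?_
      funext a
      fin_cases a <;> rfl
    rw [h, h, hA, hA, hw.invariant]

theorem comp_apply_two {n : ℕ} (w : Alt n 2) (A : Model n →L[ℝ] Model n) (v u : Model n) :
    w.compContinuousLinearMap A ![v, u] = w ![A v, A u] := by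
  rw [ContinuousAlternatingMap.compContinuousLinearMap_apply]
  refine congrArg _ ?_
  funext a
  fin_cases a <;> rfl

theorem IsReal11.gramOf_comp {n : ℕ} {w : Alt n 2} (hw : IsReal11 w) {A : Model n →L[ℝ] Model n}
    (hA : ∀ v, A (Complex.I • v) = Complex.I • A v) :
    gramOf (w.compContinuousLinearMap A) =
      (realMatrix A).transpose * gramOf w * realMatrix A := by
  ext a b
  have h : gramOf (w.compContinuousLinearMap A) a b =
      (w ![A (realBasis n a), Complex.I • A (realBasis n b)]).re := by
    rw [← hA, ← comp_apply_two]; rfl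
  rw [h, hw.gramOf_bilin, Complex.ofReal_re, Matrix.mul_apply, Finset.sum_comm]
  refine Finset.sum_congr rfl fun c _ => ?_
  rw [Matrix.mul_apply, Finset.sum_mul]
  refine Finset.sum_congr rfl fun d _ => ?_
  rw [Matrix.transpose_apply]
  simp only [realMatrix, Matrix.of_apply]
  ring

theorem realMatrix_comp {n : ℕ} (A B : Model n →L[ℝ] Model n) :
    realMatrix (A.comp B) = realMatrix A * realMatrix B := by
  ext a b
  rw [Matrix.mul_apply]
  have h : (coordR a (A (B (realBasis n b))) : ℂ) =
      ∑ c, ((realMatrix A a c * realMatrix B c b : ℝ) : ℂ) := by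
    conv_lhs => rw [← sum_coordR (B (realBasis n b)), map_sum, ← coord_apply, map_sum]
    refine Finset.sum_congr rfl fun c _ => ?_
    rw [map_smul, map_smul, coord_apply]
    simp only [realMatrix, Matrix.of_apply, Complex.real_smul]
    push_cast; ring
  exact_mod_cast h

theorem realMatrix_id {n : ℕ} : realMatrix (ContinuousLinearMap.id ℝ (Model n)) = 1 := by
  ext a b
  simp [realMatrix, coordR_realBasis, Matrix.one_apply]

/-- Adjoints are natural for isometric pullbacks. -/
theorem IsAdj.pullback_comm {n : ℕ} {P P' : Matrix (Idx n) (Idx n) ℝ} (hP' : P'.PosDef)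
    {A B : Model n →L[ℝ] Model n} (hB : B.comp A = ContinuousLinearMap.id ℝ (Model n))
    (hA : ∀ α β, innerP P' (pullback A α) (pullback A β) = innerP P α β)
    {T S T' S' : Module.End ℂ (Cov n)} (h : IsAdj P T S) (h' : IsAdj P' T' S')
    (hT : ∀ α, T' (pullback A α) = pullback A (T α)) (β : Cov n) :
    S' (pullback A β) = pullback A (S β) := by
  refine eq_of_innerP hP' fun α => ?_
  -- As `B` is a left inverse of `A`, every form is a pullback by `A`, so it suffices to test
  -- against pullbacks.
  have e : α = pullback A (pullback B α) := by
    rw [pullback_comp, hB, pullback_id]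
  rw [e, ← h', hT, hA, h, hA]

theorem pullback_single {n k : ℕ} (A : Model n →L[ℝ] Model n) (α : Alt n k) :
    pullback A (Pi.single k α) = Pi.single k (α.compContinuousLinearMap A) := by
  funext j
  by_cases hj : j = k
  · subst hj
    ext w
    simp [pullback_apply]
  · ext w
    simp [pullback_apply, hj]

/-! ### The metric in the charts -/

section Metric

variable {n : ℕ} {X : Type*} [TopologicalSpace X] [ChartedSpace (Model n) X]
  (g : HermitianMetric n X)

/-- The local representative of the fundamental form. -/
def locForm (x₀ : X) (y : Model n) : Alt n 2 :=
  (g.form ((chartAt (Model n) x₀).symm y)).compContinuousLinearMap (dSymm x₀ y)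

/-- The inverse Gram matrix. -/
def coGram (x : X) : Matrix (Idx n) (Idx n) ℝ := (g.gram x)⁻¹

theorem gram_eq (x : X) : g.gram x = gramOf (g.form x) := rfl

theorem inner_eq (x : X) (α β : Cov n) : g.inner x α β = innerP (coGram g x) α β := by
  rw [innerP_apply]
  rfl

theorem isReal11_form (x : X) : IsReal11 (g.form x) := ⟨g.real x, g.invariant x⟩

theorem gram_posDef (x : X) : (g.gram x).PosDef := (isReal11_form g x).gramOf_posDef (g.pos x)

theorem coGram_posDef (x : X) : (coGram g x).PosDef := (gram_posDef g x).inv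

theorem gram_isUnit (x : X) : IsUnit (g.gram x).det := (gram_posDef g x).det_pos.ne'.isUnit

theorem coGram_symm (x : X) : (coGram g x).IsSymm := by
  rw [Matrix.IsSymm, coGram, Matrix.transpose_nonsing_inv, gram_eq, (isReal11_form g x).symm.eq]

theorem coGram_jInvariant (x : X) : JInvariant (coGram g x) :=
  (isReal11_form g x).jInvariant.inv (Matrix.nonsing_inv_mul _ (gram_isUnit g x))

theorem loc_omega (x₀ : X) (y : Model n) : loc x₀ g.omega y = Pi.single 2 (locForm g x₀ y) := by
  rw [loc_eq, HermitianMetric.omega, ofDegree, pullback_single]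
  rfl

/-! ### The operator `Λ` and the adjoint of the torsion operator -/

/-- The operator `Λ` at a point. -/
def lamAt (x : X) : Module.End ℂ (Cov n) := lam (coGram g x)

/-- For the Gram matrix `G` itself `P G P = P`, so the adjoint described by `lefAdj_eq` is `lam P`.
-/
theorem isAdj_lam {w : Alt n 2} (hw : IsReal11 w) (hpos : (gramOf w).PosDef) :
    IsAdj (gramOf w)⁻¹ (wedgeL (Pi.single 2 w)) (lam (gramOf w)⁻¹) := by
  have hdet : IsUnit (gramOf w).det := hpos.det_pos.ne'.isUnit
  have hs : ((gramOf w)⁻¹).IsSymm := by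
    rw [Matrix.IsSymm, Matrix.transpose_nonsing_inv, hw.symm.eq]
  have h := isAdj_lef hs (gramOf w)
  rw [lefAdj_eq (hw.jInvariant.inv (Matrix.nonsing_inv_mul _ hdet)) hs hw.symm,
    Matrix.nonsing_inv_mul _ hdet, Matrix.one_mul] at h
  rw [wedgeL_single_two hw]
  exact h

theorem isAdj_lamAt (x : X) : IsAdj (coGram g x) (wedgeL (g.omega x)) (lamAt g x) :=
  isAdj_lam (isReal11_form g x) (gram_posDef g x)

theorem isSmoothForm_omega : IsSmoothForm g.omega := g.smooth

/-- The torsion operator `[Λ, dω ∧ ·]` at a point. -/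
def torsAt (x : X) : Module.End ℂ (Cov n) :=
  lamAt g x * wedgeL (extD g.omega x) - wedgeL (extD g.omega x) * lamAt g x

/-- The adjoint of the torsion operator `[Λ, dω ∧ ·]` at a point. -/
def torsAdj (x : X) : Module.End ℂ (Cov n) := flatTors (locForm g x) (chartAt (Model n) x x)

theorem flatD_loc_omega (x₀ : X) : flatD (loc x₀ g.omega) =
    flatD (fun z => Pi.single 2 (locForm g x₀ z)) :=
  congrArg flatD (funext fun y => loc_omega g x₀ y)

variable [IsManifold 𝓘(ℂ, Model n) ω X]

theorem isReal11_locForm (x₀ : X) {y : Model n} (hy : y ∈ (chartAt (Model n) x₀).target) :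
    IsReal11 (locForm g x₀ y) := (isReal11_form g _).comp (dSymm_smul x₀ hy)

theorem flatMetric (x₀ : X) : FlatMetric (locForm g x₀) (chartAt (Model n) x₀).target where
  isOpen := (chartAt (Model n) x₀).open_target
  smooth := by
    refine ((isSmoothForm_iff.1 g.smooth x₀).contDiffOn 2).congr fun y _ => ?_
    have := congrFun (loc_omega g x₀ y) 2
    rw [Pi.single_eq_same] at this
    exact this.symm
  real11 y hy := isReal11_locForm g x₀ hy
  pos y hy := by
    refine (isReal11_locForm g x₀ hy).gramOf_posDef fun v hv => ?_
    rw [locForm, comp_apply_two, dSymm_smul x₀ hy]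
    refine g.pos _ _ fun h => hv ?_
    have := congrArg (fun L : Model n →L[ℝ] Model n => L v) (dSymmInv_comp x₀ hy)
    simp only [ContinuousLinearMap.comp_apply, h, map_zero] at this
    exact this.symm

/-- The local metric is the pullback, with Gram matrix `AᵀGA` for the matrix `A` of `dSymm`.
Inverting it and pushing forward by `A` gives back `G⁻¹`. -/
theorem innerP_loc (x₀ : X) {y : Model n} (hy : y ∈ (chartAt (Model n) x₀).target)
    (α β : Cov n) :
    innerP (gramInv (locForm g x₀) y) (pullback (dSymm x₀ y) α) (pullback (dSymm x₀ y) β) =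
      innerP (coGram g ((chartAt (Model n) x₀).symm y)) α β := by
  rw [innerP_pullback]
  have h1 : realMatrix (dSymmInv x₀ y) * realMatrix (dSymm x₀ y) = 1 := by
    rw [← realMatrix_comp, dSymmInv_comp x₀ hy, realMatrix_id]
  have h2 : realMatrix (dSymm x₀ y) * realMatrix (dSymmInv x₀ y) = 1 := by
    rw [← realMatrix_comp, dSymm_comp x₀ hy, realMatrix_id]
  have h3 : (realMatrix (dSymm x₀ y))⁻¹ = realMatrix (dSymmInv x₀ y) :=
    Matrix.inv_eq_left_inv h1
  have h4 : ((realMatrix (dSymm x₀ y)).transpose)⁻¹ =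
      (realMatrix (dSymmInv x₀ y)).transpose := by
    rw [← Matrix.transpose_nonsing_inv, h3]
  have h5 : gramInv (locForm g x₀) y = realMatrix (dSymmInv x₀ y) *
      coGram g ((chartAt (Model n) x₀).symm y) * (realMatrix (dSymmInv x₀ y)).transpose := by
    rw [gramInv, locForm, (isReal11_form g _).gramOf_comp (dSymm_smul x₀ hy), Matrix.mul_inv_rev,
      Matrix.mul_inv_rev, h3, h4, ← Matrix.mul_assoc]
    rfl
  have h6 : (realMatrix (dSymmInv x₀ y)).transpose * (realMatrix (dSymm x₀ y)).transpose = 1 := by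
    rw [← Matrix.transpose_mul, h2, Matrix.transpose_one]
  have h7 : realMatrix (dSymm x₀ y) * gramInv (locForm g x₀) y *
      (realMatrix (dSymm x₀ y)).transpose = coGram g ((chartAt (Model n) x₀).symm y) := by
    rw [h5, ← Matrix.mul_assoc, ← Matrix.mul_assoc, h2, Matrix.one_mul, Matrix.mul_assoc, h6,
      Matrix.mul_one]
  rw [h7]

theorem gramInv_self (x : X) : gramInv (locForm g x) (chartAt (Model n) x x) = coGram g x := by
  have hA : dSymm x (chartAt (Model n) x x) = ContinuousLinearMap.id ℝ (Model n) := by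
    rw [dSymm_eq x (mem_chart_target _ x), (chartAt (Model n) x).left_inv (mem_chart_source _ x),
      dTrans_self x (mem_chart_target _ x)]
  rw [gramInv, locForm, hA, (chartAt (Model n) x).left_inv (mem_chart_source _ x)]
  rfl

/-- Exterior multiplication by the fundamental form is natural and the pullback is isometric, so the
adjoints correspond; no transformation rule for contractions enters. -/
theorem loc_lam (x₀ : X) (u : Form n X) {y : Model n} (hy : y ∈ (chartAt (Model n) x₀).target) :
    loc x₀ (fun x => lamAt g x (u x)) y = lam (gramInv (locForm g x₀) y) (loc x₀ u y) := by
  have hw := flatMetric g x₀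
  rw [loc_eq, loc_eq]
  refine (IsAdj.pullback_comm (hw.posDef hy) (dSymmInv_comp x₀ hy) (innerP_loc g x₀ hy)
    (isAdj_lamAt g _) (isAdj_lam (hw.real11 y hy) (hw.pos y hy)) (fun α => ?_) _).symm
  rw [← loc_omega, loc_eq, wedgeL_apply, wedgeL_apply, pullback_wedge]

theorem isAdj_torsAt (x : X) : IsAdj (coGram g x) (torsAt g x) (torsAdj g x) := by
  have h := (flatMetric g x).isAdj_flatTors (mem_chart_target _ x)
  rw [gramInv_self, ← flatD_loc_omega, ← extD_eq (isSmoothForm_omega g)] at h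
  exact h

/-- Again by uniqueness of adjoints: the torsion operator is built from `Λ` and `dω ∧ ·`, both of
which are natural. In particular, the adjoint defined in the chart of each point has a smooth
expression in any fixed chart. -/
theorem loc_torsAdj (x₀ : X) (u : Form n X) {y : Model n}
    (hy : y ∈ (chartAt (Model n) x₀).target) :
    loc x₀ (fun x => torsAdj g x (u x)) y = flatTors (locForm g x₀) y (loc x₀ u y) := by
  have hw := flatMetric g x₀
  rw [loc_eq, loc_eq]
  refine (IsAdj.pullback_comm (hw.posDef hy) (dSymmInv_comp x₀ hy) (innerP_loc g x₀ hy)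
    (isAdj_torsAt g _) (hw.isAdj_flatTors hy) (fun α => ?_) _).symm
  have hl : ∀ β, lam (gramInv (locForm g x₀) y) (pullback (dSymm x₀ y) β) =
      pullback (dSymm x₀ y) (lamAt g ((chartAt (Model n) x₀).symm y) β) := fun β =>
    (loc_lam g x₀ (fun _ => β) hy).symm
  have hD : flatD (fun z => Pi.single 2 (locForm g x₀ z)) y =
      pullback (dSymm x₀ y) (extD g.omega ((chartAt (Model n) x₀).symm y)) := by
    rw [← flatD_loc_omega, ← loc_extD (isSmoothForm_omega g) x₀ hy, loc_eq]
  rw [hD, torsAt]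
  simp only [LinearMap.sub_apply, Module.End.mul_apply, wedgeL_apply, map_sub, pullback_wedge, hl]
  rw [← pullback_wedge, hl]

end Metric

/-! ### The degree and the operators `θ` -/

/-- Multiplication by `c ^ k` in degree `k`. -/
def degL {n : ℕ} (c : ℝ) : Module.End ℂ (Cov n) where
  toFun α k := (c : ℂ) ^ k • α k
  map_add' α β := by funext k; simp
  map_smul' r α := by funext k; simp [smul_comm r]

theorem degL_apply {n : ℕ} (c : ℝ) (α : Cov n) (k : ℕ) : degL c α k = (c : ℂ) ^ k • α k := rfl

/-- Multiplication by `k` in degree `k`. -/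
def numL {n : ℕ} : Module.End ℂ (Cov n) where
  toFun α k := (k : ℂ) • α k
  map_add' α β := by funext k; simp
  map_smul' r α := by funext k; simp [smul_comm r]

theorem numL_apply {n : ℕ} (α : Cov n) (k : ℕ) : numL α k = (k : ℂ) • α k := rfl

theorem contr_degL {n : ℕ} (c : ℝ) (v : Model n) (α : Cov n) :
    contr v (degL c α) = (c : ℂ) • degL c (contr v α) := by
  funext k; ext w
  simp [contr_apply, degL_apply, pow_succ]
  ring

theorem contr_numL {n : ℕ} (v : Model n) (α : Cov n) :
    contr v (numL α) = numL (contr v α) + contr v α := by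
  funext k; ext w
  simp [contr_apply, numL_apply]
  ring

theorem contr_mul_numL {n : ℕ} (v : Model n) :
    contr v * numL = numL * contr v + contr v := LinearMap.ext fun α => contr_numL v α

theorem degL_ext {n : ℕ} (c : ℝ) (ξ : Model n →L[ℝ] ℂ) (α : Cov n) :
    degL c (ext ξ α) = (c : ℂ) • ext ξ (degL c α) := by
  funext k
  cases k with
  | zero => simp [degL_apply, ext_zero_deg]
  | succ k =>
    ext w
    rw [degL_apply, Pi.smul_apply, ContinuousAlternatingMap.smul_apply,
      ContinuousAlternatingMap.smul_apply, ext_apply_sum, ext_apply_sum, smul_eq_mul, smul_eq_mul,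
      Finset.mul_sum, Finset.mul_sum]
    refine Finset.sum_congr rfl fun i _ => ?_
    rw [degL_apply, ContinuousAlternatingMap.smul_apply, smul_eq_mul]
    ring

/-- Both sides have the same commutator with a contraction, namely that contraction. -/
theorem sum_extB_contrB {n : ℕ} : ∑ a, extB a * contrB a = (numL : Module.End ℂ (Cov n)) := by
  refine op_ext (fun α => ?_) fun k ih v α => ?_
  · simp [LinearMap.sum_apply, extB, ext_zero_deg, numL_apply]
  · have h : contr v ((∑ a, extB a * contrB a) α) =
        contr v α + (∑ a, extB a * contrB a) (contr v α) := by
      have hv := LinearMap.congr_fun (contr_expand v) α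
      conv_rhs => enter [1]; rw [hv]
      simp only [LinearMap.sum_apply, Module.End.mul_apply, map_sum, extB, contr_ext,
        ← Finset.sum_add_distrib, LinearMap.smul_apply]
      refine Finset.sum_congr rfl fun a _ => ?_
      rw [contrB, contr_contr v, map_neg, sub_neg_eq_add]
    rw [h, contr_numL, Pi.add_apply, Pi.add_apply, ih, add_comm]

theorem degL_degL {n : ℕ} (c d : ℝ) (α : Cov n) : degL c (degL d α) = degL (c * d) α := by
  funext k
  rw [degL_apply, degL_apply, degL_apply, smul_smul]
  push_cast
  rw [mul_pow]

theorem degL_one {n : ℕ} (α : Cov n) : degL 1 α = α := by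
  funext k
  simp [degL_apply]

theorem thetaL_degL {n : ℕ} (c d : ℝ) (α : Cov n) : thetaL c (degL d α) = degL d (thetaL c α) := by
  funext k; ext w
  simp only [thetaL_apply, degL_apply, ContinuousAlternatingMap.smul_apply, thetaCov_apply,
    slotPart_smul, smul_eq_mul, Finset.mul_sum]
  exact Finset.sum_congr rfl fun S _ => by ring

theorem thetaL_numL {n : ℕ} (c : ℝ) (α : Cov n) : thetaL c (numL α) = numL (thetaL c α) := by
  funext k; ext w
  simp only [thetaL_apply, numL_apply, ContinuousAlternatingMap.smul_apply, thetaCov_apply,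
    slotPart_smul, smul_eq_mul, Finset.mul_sum]
  exact Finset.sum_congr rfl fun S _ => by ring

theorem thetaL_thetaL {n : ℕ} (c d : ℝ) (α : Cov n) :
    thetaL c (thetaL d α) = thetaL (c * d) α := by
  funext k; ext w
  rw [thetaL_apply, thetaL_apply, thetaL_apply, thetaCov_apply, thetaCov_apply]
  refine Finset.sum_congr rfl fun S _ => ?_
  rw [slotPart_thetaCov, ← mul_assoc, ← mul_pow]
  push_cast
  rfl

theorem thetaL_one {n : ℕ} (α : Cov n) : thetaL 1 α = α := by
  funext k; ext w
  rw [thetaL_apply, thetaCov_apply, ← sum_slotPart (α k) w]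
  simp

/-- The conjugate of `θ` on forms of type `(p, q)` multiplies by `c ^ q`. -/
theorem conjCov_thetaL {n : ℕ} {c : ℝ} (hc : c ≠ 0) (α : Cov n) :
    conjCov (thetaL c (conjCov α)) = degL c (thetaL c⁻¹ α) := by
  -- Composed with `θ_c`, the claim becomes `c ^ q * c ^ p = c ^ (p + q)`. This version has no
  -- inverse in it and can be proved by contraction.
  have key : ∀ k, ∀ α : Cov n, conjCov (thetaL c (conjCov (thetaL c α))) k = degL c α k := by
    intro k
    induction k with
    | zero =>
      intro α
      refine alt_zero_ext fun w => ?_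
      rw [conjCov_apply, thetaL_zero_deg, conjCov_apply, thetaL_zero_deg, degL_apply]
      simp
    | succ k ih =>
      intro α
      refine alt_succ_ext fun v => ?_
      have e : contrTheta c v (conjCov (thetaL c α)) =
          (c : ℂ) • conjCov (thetaL c (contr v α)) := by
        have hI : Complex.I • Complex.I • v = -v := by
          rw [smul_smul, Complex.I_mul_I, neg_one_smul]
        simp only [contrTheta, LinearMap.sub_apply, LinearMap.smul_apply, contr_conjCov,
          contr_thetaL, map_sub, map_smul, hI, contr_neg, LinearMap.neg_apply, map_neg]
        funext k; ext w
        simp only [Pi.sub_apply, Pi.smul_apply, Pi.neg_apply, ContinuousAlternatingMap.sub_apply,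
          ContinuousAlternatingMap.smul_apply, conjCov_apply, smul_eq_mul, map_sub, map_mul,
          map_div₀, map_add, map_one, Complex.conj_I, Complex.conj_ofReal, map_ofNat,
          ContinuousAlternatingMap.neg_apply, map_neg]
        linear_combination (((c : ℂ) - 1) ^ 2 / 4 *
          (starRingEnd ℂ) (thetaL c (contr v α) k w)) * Complex.I_sq
      rw [contr_conjCov, contr_thetaL, e, map_smul, conjCov_smul, Complex.conj_ofReal, contr_degL,
        Pi.smul_apply, Pi.smul_apply, ih]
  have h := funext fun k => key k (thetaL c⁻¹ α)
  rw [thetaL_apply_inv c hc] at h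
  exact h

theorem thetaL_scalar {n : ℕ} (c : ℝ) (z : ℂ) : thetaL c (scalar z : Cov n) = scalar z := by
  refine cov_ext_contr (thetaL_zero_deg _ _) fun v => ?_
  rw [contr_thetaL, contrTheta, LinearMap.sub_apply, LinearMap.smul_apply, LinearMap.smul_apply,
    contr_scalar, contr_scalar]
  simp

/-- The result is `c ξ' + ξ''`, where `ξ' = (ξ - i ξ ∘ J) / 2` and `ξ'' = (ξ + i ξ ∘ J) / 2` are the
parts of type `(1, 0)` and `(0, 1)`. -/
theorem thetaL_oneForm {n : ℕ} (c : ℝ) (ξ : Model n →L[ℝ] ℂ) :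
    thetaL c (oneForm ξ) =
      oneForm ((((c : ℂ) + 1) / 2) • ξ - (Complex.I * ((c : ℂ) - 1) / 2) • compJ ξ) := by
  refine cov_ext_contr ?_ fun v => ?_
  · rw [thetaL_zero_deg]
    simp [oneForm_def]
  · rw [contr_thetaL, contrTheta, LinearMap.sub_apply, LinearMap.smul_apply, LinearMap.smul_apply,
      contr_oneForm, contr_oneForm, contr_oneForm, map_sub, map_smul, map_smul, thetaL_scalar,
      thetaL_scalar]
    simp only [scalar, ← Pi.single_smul, ← Pi.single_sub]
    congr 1

theorem thetaL_ext {n : ℕ} (c : ℝ) (ξ : Model n →L[ℝ] ℂ) (α : Cov n) :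
    thetaL c (ext ξ α) =
      ext ((((c : ℂ) + 1) / 2) • ξ - (Complex.I * ((c : ℂ) - 1) / 2) • compJ ξ) (thetaL c α) := by
  rw [ext_apply, thetaL_wedge, thetaL_oneForm, ext_apply]

/-- For `c = -1` the transformed covector is `-ξ' + ξ'' = i ξ ∘ J`. Thus conjugating `d` by `θ_{-1}`
yields `i dᶜ`. -/
theorem thetaL_neg_one_ext {n : ℕ} (ξ : Model n →L[ℝ] ℂ) (α : Cov n) :
    thetaL (-1) (ext ξ (thetaL (-1) α)) = Complex.I • ext (compJ ξ) α := by
  rw [thetaL_ext, thetaL_thetaL, neg_mul_neg, one_mul, thetaL_one, ← LinearMap.smul_apply,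
    ← ext_smul]
  congr 2
  push_cast
  ext v
  simp
  ring

/-! ### Leibniz rules -/

section Leibniz

variable {n : ℕ} {u : Model n → Cov n} {s : Set (Model n)} {y : Model n}

theorem HasCovDeriv.thetaL {u : ℝ → Cov n} {u' : Cov n} {t : ℝ} (h : HasCovDeriv u u' t) (c : ℝ) :
    HasCovDeriv (fun r => thetaL c (u r)) (thetaL c u') t := by
  intro k w
  simp only [thetaL_apply, thetaCov_apply, slotPart]
  exact HasDerivAt.fun_sum fun S _ => HasDerivAt.const_mul _ <|
    HasDerivAt.fun_sum fun T _ => HasDerivAt.const_mul _ (h k _)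

theorem HasCovDeriv.conj {u : ℝ → Cov n} {u' : Cov n} {t : ℝ} (h : HasCovDeriv u u' t) :
    HasCovDeriv (fun r => conjCov (u r)) (conjCov u') t := fun k w =>
  (Complex.conjCLE : ℂ →L[ℝ] ℂ).hasFDerivAt.comp_hasDerivAt t (h k w)

theorem HasCovDeriv.degL {u : ℝ → Cov n} {u' : Cov n} {t : ℝ} (h : HasCovDeriv u u' t)
    {c : ℝ → ℝ} {c' : ℝ} (hc : HasDerivAt c c' t) (h0 : c t ≠ 0) :
    HasCovDeriv (fun r => degL (c r) (u r))
      (degL (c t) u' + ((c' / c t : ℝ) : ℂ) • numL (degL (c t) (u t))) t := by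
  intro k w
  have h1 := (hc.ofReal_comp.pow k).mul (h k w)
  refine h1.congr_deriv ?_
  have h2 : (c t : ℂ) ≠ 0 := by exact_mod_cast h0
  simp only [Pi.add_apply, Pi.smul_apply, ContinuousAlternatingMap.add_apply,
    ContinuousAlternatingMap.smul_apply, numL_apply, degL_apply, smul_eq_mul]
  push_cast
  cases k with
  | zero => simp
  | succ k =>
    simp only [Nat.add_sub_cancel, Pi.pow_apply, pow_succ]
    field_simp
    push_cast
    ring

theorem FSmooth.degL {c : Model n → ℝ} (hc : ContDiffOn ℝ ∞ c s) (h : FSmooth u s) :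
    FSmooth (fun y => degL (c y) (u y)) s :=
  fun k w => ((contDiffOn_ofReal hc).pow k).mul (h k w)

theorem flatD_conj (hu : FSmooth u s) (hs : IsOpen s) (hy : y ∈ s) :
    flatD (fun z => conjCov (u z)) y = conjCov (flatD u y) := by
  rw [flatD, flatD, conjCov_sum]
  refine Finset.sum_congr rfl fun a _ => ?_
  rw [pd_eq_of_hasCovDeriv hu.conj hs hy (hu.hasCovDeriv hs hy a).conj, extB, ext_apply, ext_apply,
    conjCov_wedge]
  congr 1
  refine cov_ext_contr ?_ fun v => ?_
  · refine alt_zero_ext fun w => ?_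
    rw [conjCov_apply]; simp [oneForm_def]
  · rw [contr_conjCov, contr_oneForm]
    funext k; ext w
    rw [conjCov_apply]
    by_cases hk : k = 0
    · subst hk
      simp [scalar, coord_apply]
    · simp [scalar, hk]

theorem pd_add {v : Model n → Cov n} (hu : FSmooth u s) (hv : FSmooth v s) (hs : IsOpen s)
    (hy : y ∈ s) (a : Idx n) : pd a (fun z => u z + v z) y = pd a u y + pd a v y :=
  pd_eq_of_hasCovDeriv (hu.add hv) hs hy ((hu.hasCovDeriv hs hy a).add (hv.hasCovDeriv hs hy a))

theorem flatD_add {v : Model n → Cov n} (hu : FSmooth u s) (hv : FSmooth v s) (hs : IsOpen s)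
    (hy : y ∈ s) : flatD (fun z => u z + v z) y = flatD u y + flatD v y := by
  simp only [flatD, pd_add hu hv hs hy, map_add, Finset.sum_add_distrib]

theorem pd_smul {f : Model n → ℂ} (hf : ContDiffOn ℝ ∞ f s) (hu : FSmooth u s) (hs : IsOpen s)
    (hy : y ∈ s) (a : Idx n) :
    pd a (fun z => f z • u z) y = fderiv ℝ f y (realBasis n a) • u y + f y • pd a u y := by
  have h := HasCovDeriv.smul (hasDerivAt_line ((hf.contDiffAt (hs.mem_nhds hy)).differentiableAt
    (by simp)) (realBasis n a)) (hu.hasCovDeriv hs hy a)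
  simpa using pd_eq_of_hasCovDeriv (FSmooth.smul hf hu) hs hy h

theorem sum_smul_extB (ξ : Model n →L[ℝ] ℂ) (α : Cov n) :
    ∑ a, ξ (realBasis n a) • extB a α = ext ξ α := by
  have h : ∀ t : Finset (Idx n), ext (∑ a ∈ t, ξ (realBasis n a) • coord a) α =
      ∑ a ∈ t, ξ (realBasis n a) • extB a α := by
    intro t
    rw [ext, map_sum, map_sum, LinearMap.sum_apply]
    refine Finset.sum_congr rfl fun a _ => ?_
    rw [map_smul, map_smul, LinearMap.smul_apply]
    rfl
  rw [← h, ← covector_expand]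

theorem sum_smul_extJ (ξ : Model n →L[ℝ] ℂ) (α : Cov n) :
    ∑ a, ξ (realBasis n a) • extJ a α = ext (compJ ξ) α := by
  have h : compJ ξ = ∑ a, ξ (realBasis n a) • compJ (coord a) := by
    conv_lhs => rw [covector_expand ξ]
    ext v
    simp [compJ_apply]
  rw [h, ext, map_sum, map_sum, LinearMap.sum_apply]
  refine Finset.sum_congr rfl fun a _ => ?_
  rw [map_smul, map_smul, LinearMap.smul_apply]
  rfl

theorem flatD_smul {f : Model n → ℂ} (hf : ContDiffOn ℝ ∞ f s) (hu : FSmooth u s)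
    (hs : IsOpen s) (hy : y ∈ s) :
    flatD (fun z => f z • u z) y = f y • flatD u y + ext (fderiv ℝ f y) (u y) := by
  simp only [flatD, pd_smul hf hu hs hy, map_add, map_smul, Finset.sum_add_distrib,
    sum_smul_extB, ← Finset.smul_sum]
  rw [add_comm]

theorem flatDc_smul {f : Model n → ℂ} (hf : ContDiffOn ℝ ∞ f s) (hu : FSmooth u s)
    (hs : IsOpen s) (hy : y ∈ s) :
    flatDc (fun z => f z • u z) y = f y • flatDc u y + ext (compJ (fderiv ℝ f y)) (u y) := by
  simp only [flatDc, pd_smul hf hu hs hy, map_add, map_smul, Finset.sum_add_distrib,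
    sum_smul_extJ, ← Finset.smul_sum]
  rw [add_comm]

/-- The conjugate of the twisted exterior derivative in terms of `flatDc`. -/
theorem flatD_degL_thetaL {f : Model n → ℝ} (hf : ContDiffOn ℝ ∞ f s) (hf0 : ∀ z ∈ s, f z ≠ 0)
    (hu : FSmooth u s) (hs : IsOpen s) (hy : y ∈ s) :
    degL (f y) (thetaL (-1) (flatD (fun z => degL (f z)⁻¹ (thetaL (-1) (u z))) y)) =
      (f y : ℂ) • (Complex.I • flatDc u y) -
        Complex.I • ext (compJ (fderiv ℝ (fun z => (f z : ℂ)) y)) (numL (u y)) := by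
  have h0 := hf0 y hy
  have h0' : (f y : ℂ) ≠ 0 := by exact_mod_cast h0
  have hdf : DifferentiableAt ℝ f y :=
    (hf.contDiffAt (hs.mem_nhds hy)).differentiableAt (by simp)
  have hfd : ∀ v, fderiv ℝ (fun z => (f z : ℂ)) y v = ((fderiv ℝ f y v : ℝ) : ℂ) := by
    intro v
    exact congrArg (fun L : Model n →L[ℝ] ℂ => L v)
      (Complex.ofRealCLM.hasFDerivAt.comp y hdf.hasFDerivAt).fderiv
  -- In degree `k` the factor is `f ^ (-k)`, whose logarithmic derivative is `-k ∂ₐf / f`; this is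
  -- the origin of the degree operator.
  have hpd : ∀ a, pd a (fun z => degL (f z)⁻¹ (thetaL (-1) (u z))) y =
      degL (f y)⁻¹ (thetaL (-1) (pd a u y)) -
        ((fderiv ℝ f y (realBasis n a) / f y : ℝ) : ℂ) •
          numL (degL (f y)⁻¹ (thetaL (-1) (u y))) := by
    intro a
    have h1 := HasDerivAt.inv (hasDerivAt_line hdf (realBasis n a)) (by simpa using h0)
    have h2 := ((hu.hasCovDeriv hs hy a).thetaL (-1)).degL h1 (by simpa using h0)
    have h3 := pd_eq_of_hasCovDeriv ((FSmooth.thetaL contDiffOn_const hu).degL (hf.inv hf0)) hs hy h2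
    refine h3.trans ?_
    simp only [Pi.inv_apply, zero_smul, add_zero]
    rw [sub_eq_add_neg, ← neg_smul]
    congr 2
    push_cast
    field_simp
  have hdd : ∀ β : Cov n, degL (f y) (degL (f y)⁻¹ β) = β := by
    intro β
    rw [degL_degL, mul_inv_cancel₀ h0, degL_one]
  -- Conjugation by `θ_{-1}` turns `eᵃ` into `i eᵃ ∘ J`, and conjugation by `f ^ k` gives one factor
  -- `f` because the degree rises by one.
  have hterm : ∀ (a : Idx n) (β : Cov n),
      degL (f y) (thetaL (-1) (extB a (degL (f y)⁻¹ (thetaL (-1) β)))) =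
        (f y : ℂ) • (Complex.I • extJ a β) := by
    intro a β
    rw [← thetaL_degL, extB, degL_ext, hdd, map_smul, thetaL_neg_one_ext]
    rfl
  have hnum : ∀ β : Cov n, numL (degL (f y)⁻¹ (thetaL (-1) β)) =
      degL (f y)⁻¹ (thetaL (-1) (numL β)) := by
    intro β
    rw [thetaL_numL]
    funext k
    rw [numL_apply, degL_apply, degL_apply, numL_apply, smul_comm]
  rw [flatD, map_sum, map_sum, flatDc, ← sum_smul_extJ, Finset.smul_sum, Finset.smul_sum,
    Finset.smul_sum, ← Finset.sum_sub_distrib]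
  refine Finset.sum_congr rfl fun a _ => ?_
  rw [hpd, hnum, map_sub, map_sub, map_sub, map_smul, map_smul, map_smul, hterm, hterm, hfd]
  congr 1
  rw [smul_smul, smul_smul, smul_smul]
  congr 1
  push_cast
  field_simp

end Leibniz

/-! ### Pointwise commutation relations -/

section Pointwise

variable {n : ℕ} {w : Alt n 2} {P : Matrix (Idx n) (Idx n) ℝ}

/-- The covector `w(v, ·)`. -/
def contrTwo {n : ℕ} (w : Alt n 2) (v : Model n) : Model n →L[ℝ] ℂ :=
  ∑ a, (w ![v, realBasis n a]) • coord a

theorem contrTwo_apply (w : Alt n 2) (v u : Model n) : contrTwo w v u = w ![v, u] := by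
  have h := LinearMap.congr_fun (contr_expand u) (contr v (Pi.single 2 w : Cov n))
  have h2 := congrArg (fun β : Cov n => β 0 Fin.elim0) h
  simp only [LinearMap.sum_apply, LinearMap.smul_apply, Finset.sum_apply,
    Pi.smul_apply, ContinuousAlternatingMap.sum_apply, ContinuousAlternatingMap.smul_apply,
    smul_eq_mul, ← alt_two_eq_contr] at h2
  rw [h2, contrTwo, sum_apply]
  exact Finset.sum_congr rfl fun a _ => by rw [smul_apply, smul_eq_mul, mul_comm]

theorem contr_single_two (w : Alt n 2) (v : Model n) :
    contr v (Pi.single 2 w : Cov n) = oneForm (contrTwo w v) := by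
  rw [contr_single_succ, oneForm_def]
  congr 1
  ext u
  have h : w.curryLeft v u = w ![v, u 0] := by
    rw [ContinuousAlternatingMap.curryLeft_apply_apply]
    refine congrArg _ ?_
    funext a
    fin_cases a <;> rfl
  rw [h, ← contrTwo_apply]
  rfl

/-- A form of type `(1, 1)` carries exactly one factor `c`. After contraction this is the statement
that the contraction of `w` with `J v` is minus the contraction with `v` composed with `J`. -/
theorem thetaL_single_two (hw : IsReal11 w) (c : ℝ) :
    thetaL c (Pi.single 2 w : Cov n) = (c : ℂ) • Pi.single 2 w := by
  refine cov_ext_contr ?_ fun v => ?_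
  · rw [thetaL_zero_deg]; simp
  · have hJ : contrTwo w (Complex.I • v) = -compJ (contrTwo w v) := by
      ext u
      have h := hw.invariant v (Complex.I • u)
      have h2 : Complex.I • Complex.I • u = (-1 : ℝ) • u := by
        rw [smul_smul, Complex.I_mul_I]; simp
      rw [h2, alt_two_smul_right] at h
      rw [contrTwo_apply, neg_apply, compJ_apply, contrTwo_apply, ← h]
      simp
    rw [contr_thetaL, contrTheta, LinearMap.sub_apply, LinearMap.smul_apply, LinearMap.smul_apply,
      contr_single_two, contr_single_two, hJ, ← map_smul, ← map_smul, ← map_sub, thetaL_oneForm,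
      map_smul, contr_single_two, ← map_smul]
    congr 1
    ext u
    simp only [sub_apply, smul_apply, compJ_apply,
      neg_apply, smul_eq_mul]
    have h2 : Complex.I • Complex.I • u = -u := by
      rw [smul_smul, Complex.I_mul_I, neg_one_smul]
    rw [h2, map_neg]
    linear_combination (((c : ℂ) - 1) ^ 2 / 4 * contrTwo w v u) * Complex.I_sq

theorem isAdj_thetaL (hP : JInvariant P) (c : ℝ) : IsAdj P (thetaL c) (thetaL c) :=
  fun α β => innerP_thetaL hP c α β

/-- The adjoint of `θ_c (w ∧ ·) = c (w ∧ ·) θ_c`. -/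
theorem lam_thetaL (hw : IsReal11 w) (hpos : (gramOf w).PosDef) (c : ℝ) (α : Cov n) :
    lam (gramOf w)⁻¹ (thetaL c α) = (c : ℂ) • thetaL c (lam (gramOf w)⁻¹ α) := by
  have hdet : IsUnit (gramOf w).det := hpos.det_pos.ne'.isUnit
  have hs : ((gramOf w)⁻¹).IsSymm := by
    rw [Matrix.IsSymm, Matrix.transpose_nonsing_inv, hw.symm.eq]
  have hJ : JInvariant (gramOf w)⁻¹ := hw.jInvariant.inv (Matrix.nonsing_inv_mul _ hdet)
  have h := isAdj_lam hw hpos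
  have h1 := (isAdj_thetaL hJ c).mul h
  have h2 := (h.mul (isAdj_thetaL hJ c)).smul_real (c := (c : ℂ)) (Complex.conj_ofReal c)
  have e : thetaL c * wedgeL (Pi.single 2 w) =
      (c : ℂ) • (wedgeL (Pi.single 2 w) * thetaL c : Module.End ℂ (Cov n)) := by
    refine LinearMap.ext fun β => ?_
    rw [Module.End.mul_apply, wedgeL_apply, thetaL_wedge, thetaL_single_two hw,
      ← wedgeL_apply, map_smul]
    rfl
  rw [e] at h1
  exact LinearMap.congr_fun (h1.unique hpos.inv h2) α

/-- The scalar is half of `tr 1 = 2 n`, and the other term sums to the degree. Together with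
`lam_mul_lef` this is `[Λ, ω ∧ ·] = n - N`, where the `n` of the main identity originates. -/
theorem lefBracket_self (hw : IsReal11 w) (hpos : (gramOf w).PosDef) :
    lefBracket (gramOf w)⁻¹ (gramOf w) = (n : ℂ) • (1 : Module.End ℂ (Cov n)) - numL := by
  have hdet : IsUnit (gramOf w).det := hpos.det_pos.ne'.isUnit
  have htr : (((gramOf w)⁻¹ * gramOf w).trace : ℝ) = 2 * n := by
    rw [Matrix.nonsing_inv_mul _ hdet, Matrix.trace_one]
    simp [mul_comm]
  rw [lefBracket, htr]
  congr 1
  · congr 1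
    push_cast; ring
  · rw [← sum_extB_contrB]
    refine Finset.sum_congr rfl fun a _ => ?_
    simp only [sharpB, Finset.mul_sum, Finset.smul_sum, mul_smul_comm, smul_smul]
    rw [Finset.sum_comm]
    simp only [← Finset.sum_smul]
    have h1 : ∀ c, ∑ b, (gramOf w a b : ℂ) * ((gramOf w)⁻¹ c b : ℂ) = if a = c then 1 else 0 := by
      intro c
      have hs : ((gramOf w)⁻¹).IsSymm := by
        rw [Matrix.IsSymm, Matrix.transpose_nonsing_inv, hw.symm.eq]
      have h2 := congrFun (congrFun (Matrix.mul_nonsing_inv _ hdet) a) c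
      rw [Matrix.mul_apply, Matrix.one_apply] at h2
      have h3 : ((∑ b, gramOf w a b * (gramOf w)⁻¹ b c : ℝ) : ℂ) = if a = c then 1 else 0 := by
        rw [h2]; split_ifs <;> simp
      rw [← h3]
      push_cast
      exact Finset.sum_congr rfl fun b _ => by rw [hs.apply]
    simp [h1]

theorem lam_numL (P : Matrix (Idx n) (Idx n) ℝ) :
    lam P * numL = numL * lam P + (2 : ℂ) • lam P := by
  have h : ∀ a b, (contrJ a * contrB b) * numL =
      (numL * (contrJ a * contrB b) + (2 : ℂ) • (contrJ a * contrB b) : Module.End ℂ (Cov n)) := by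
    intro a b
    rw [mul_assoc, contrB, contr_mul_numL, mul_add, ← mul_assoc, contrJ, contr_mul_numL, add_mul,
      mul_assoc, two_smul, add_assoc]
  simp only [lam, smul_mul_assoc, mul_smul_comm, Finset.sum_mul, Finset.mul_sum, h, smul_add,
    Finset.sum_add_distrib, Finset.smul_sum, smul_smul]
  congr 1
  refine Finset.sum_congr rfl fun a _ => Finset.sum_congr rfl fun b _ => ?_
  congr 1; ring

theorem sharp_mul_numL (P : Matrix (Idx n) (Idx n) ℝ) (ξ : Model n →L[ℝ] ℂ) :
    sharp P ξ * numL = numL * sharp P ξ + sharp P ξ := by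
  simp only [sharp, smul_mul_assoc, mul_smul_comm, Finset.sum_mul, Finset.mul_sum, contrB,
    contr_mul_numL, smul_add, Finset.sum_add_distrib]

/-- The adjoint of the commutator `lam_mul_ext`, read off by uniqueness. -/
theorem sharp_mul_lef (hJ : JInvariant P) (hs : P.IsSymm) (hPd : P.PosDef)
    {G : Matrix (Idx n) (Idx n) ℝ} (hG : lefAdj P G = lam P)
    {ξ : Model n →L[ℝ] ℂ} (hξ : IsRealCovector ξ) :
    sharp P ξ * lef G = lef G * sharp P ξ - ext (compJ ξ) := by
  have h1 := isAdj_ext hs hξ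
  have h2 := isAdj_lef hs G
  rw [hG] at h2
  have hξ' : IsRealCovector (compJ ξ) := fun v => hξ _
  have h3 := ((h1.mul (h2.symm hs)).sub ((h2.symm hs).mul h1))
  have e : ext ξ * lam P - lam P * ext ξ = sharp P (compJ ξ) := by
    rw [lam_mul_ext hJ hs]; abel
  rw [e] at h3
  have h4 := h3.unique hPd ((isAdj_ext hs hξ').symm hs)
  rw [← h4]
  abel

/-- The adjoint of `[Λ, γ ∧ ω ∧ ·]`. -/
def wedgeTorsAdj (P G : Matrix (Idx n) (Idx n) ℝ) (γ : Model n →L[ℝ] ℂ) : Module.End ℂ (Cov n) :=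
  lam P * (sharp P γ * lef G) - lef G * (lam P * sharp P γ)

/-- Uses only `[Λ, L] = n - N`, `[γ♯, L] = -(γ ∘ J) ∧ ·`, `[Λ, (γ ∘ J) ∧ ·] = γ♯` and the degrees of
the operators, with `L` multiplication by the `(1, 1)`-form. The contraction `γ♯` is finally
rewritten as a commutator with `(γ ∘ J) ∧ ·`, to match the zero order terms produced by `dᶜ`. -/
theorem wedgeTorsAdj_eq (hw : IsReal11 w) (hpos : (gramOf w).PosDef)
    {γ : Model n →L[ℝ] ℂ} (hγ : IsRealCovector γ) (α : Cov n) :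
    wedgeTorsAdj (gramOf w)⁻¹ (gramOf w) γ α =
      (n : ℂ) • (lam (gramOf w)⁻¹ (ext (compJ γ) α) - ext (compJ γ) (lam (gramOf w)⁻¹ α)) -
      lam (gramOf w)⁻¹ (ext (compJ γ) (numL α)) + ext (compJ γ) (numL (lam (gramOf w)⁻¹ α)) +
      ext (compJ γ) (lam (gramOf w)⁻¹ α) := by
  have hdet : IsUnit (gramOf w).det := hpos.det_pos.ne'.isUnit
  have hs : ((gramOf w)⁻¹).IsSymm := by
    rw [Matrix.IsSymm, Matrix.transpose_nonsing_inv, hw.symm.eq]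
  have hJ : JInvariant (gramOf w)⁻¹ := hw.jInvariant.inv (Matrix.nonsing_inv_mul _ hdet)
  have hadj : lefAdj (gramOf w)⁻¹ (gramOf w) = lam (gramOf w)⁻¹ := by
    rw [lefAdj_eq hJ hs hw.symm, Matrix.nonsing_inv_mul _ hdet, Matrix.one_mul]
  have ha : lam (gramOf w)⁻¹ * ext (compJ γ) =
      (ext (compJ γ) * lam (gramOf w)⁻¹ + sharp (gramOf w)⁻¹ γ : Module.End ℂ (Cov n)) := by
    rw [lam_mul_ext hJ hs, compJ_compJ, ← neg_one_smul ℂ, sharp_smul, neg_one_smul, sub_neg_eq_add]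
  have hb := sharp_mul_lef hJ hs hpos.inv hadj hγ
  have hc := lam_mul_lef hJ hs hw.jInvariant hw.symm
  rw [lefBracket_self hw hpos] at hc
  have hd := sharp_mul_numL (gramOf w)⁻¹ γ
  have he := lam_numL (gramOf w)⁻¹
  have key : wedgeTorsAdj (gramOf w)⁻¹ (gramOf w) γ =
      (n : ℂ) • (lam (gramOf w)⁻¹ * ext (compJ γ) - ext (compJ γ) * lam (gramOf w)⁻¹) -
      lam (gramOf w)⁻¹ * (ext (compJ γ) * numL) + ext (compJ γ) * (numL * lam (gramOf w)⁻¹) +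
      ext (compJ γ) * lam (gramOf w)⁻¹ := by
    rw [wedgeTorsAdj, hb]
    generalize lam (gramOf w)⁻¹ = Λ at *
    generalize lef (gramOf w) = L at *
    generalize sharp (gramOf w)⁻¹ γ = S at *
    generalize (ext (compJ γ) : Module.End ℂ (Cov n)) = J at *
    have e1 : Λ * (L * S - J) - L * (Λ * S) = (n : ℂ) • S - numL * S - Λ * J := by
      rw [mul_sub, ← mul_assoc, hc, add_mul, sub_mul, smul_mul_assoc, one_mul, mul_assoc L]
      abel
    have e2 : Λ * (J * numL) = J * (numL * Λ) + (2 : ℂ) • (J * Λ) + numL * S + S := by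
      rw [← mul_assoc, ha, add_mul, mul_assoc, he, mul_add, mul_smul_comm, hd]
      abel
    rw [e1, e2, ha, two_smul]
    have e3 : J * Λ + S - J * Λ = S := by abel
    rw [e3]
    abel
  exact LinearMap.congr_fun key α

end Pointwise

theorem theta_add {n : ℕ} {X : Type*} (η : X → ℝ) (u v : Form n X) :
    theta η (u + v) = theta η u + theta η v :=
  funext fun x => (thetaL (η x)).map_add (u x) (v x)

section Operators

variable {n : ℕ} {X : Type*} [TopologicalSpace X] [ChartedSpace (Model n) X]

/-! ### Smooth functions and smooth forms -/

/-- Real functions which are smooth in the preferred charts. -/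
def SmoothFn (n : ℕ) {X : Type*} [TopologicalSpace X] [ChartedSpace (Model n) X] (f : X → ℝ) :
    Prop :=
  ∀ x₀ : X, ContDiffOn ℝ ∞ (fun y => f ((chartAt (Model n) x₀).symm y))
    (chartAt (Model n) x₀).target

/-- The differential of a function, at `x` in the preferred chart at `x`. -/
def dFn (n : ℕ) {X : Type*} [TopologicalSpace X] [ChartedSpace (Model n) X] (f : X → ℝ) (x : X) :
    Model n →L[ℝ] ℂ :=
  fderiv ℝ (fun y => (f ((chartAt (Model n) x).symm y) : ℂ)) (chartAt (Model n) x x)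

theorem SmoothFn.neg {f : X → ℝ} (hf : SmoothFn n f) : SmoothFn n (-f) := fun x₀ => (hf x₀).neg

theorem SmoothFn.inv {f : X → ℝ} (hf : SmoothFn n f) (h0 : ∀ x, f x ≠ 0) : SmoothFn n f⁻¹ :=
  fun x₀ => (hf x₀).inv fun _ _ => h0 _

theorem smoothFn_const (c : ℝ) : SmoothFn n (fun _ : X => c) := fun _ => contDiffOn_const

theorem symm_chart_self (x : X) : (chartAt (Model n) x).symm (chartAt (Model n) x x) = x :=
  (chartAt (Model n) x).left_inv (mem_chart_source _ x)

theorem SmoothFn.hasFDerivAt {f : X → ℝ} (hf : SmoothFn n f) (x : X) :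
    HasFDerivAt (fun y => (f ((chartAt (Model n) x).symm y) : ℂ)) (dFn n f x)
      (chartAt (Model n) x x) :=
  (((contDiffOn_ofReal (hf x)).contDiffAt ((chartAt (Model n) x).open_target.mem_nhds
    (mem_chart_target _ x))).differentiableAt (by simp)).hasFDerivAt

theorem isRealCovector_dFn {f : X → ℝ} (hf : SmoothFn n f) (x : X) :
    IsRealCovector (dFn n f x) := by
  intro v
  have h1 := (((hf x).contDiffAt ((chartAt (Model n) x).open_target.mem_nhds
    (mem_chart_target _ x))).differentiableAt (by simp)).hasFDerivAt
  have h2 := (Complex.ofRealCLM.hasFDerivAt.comp _ h1).unique (hf.hasFDerivAt x)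
  rw [← h2]
  simp

theorem dFn_neg (f : X → ℝ) (x : X) : dFn n (-f) x = -dFn n f x := by
  rw [dFn, dFn, ← fderiv_neg]
  congr 1
  funext y
  simp

theorem dFn_inv {f : X → ℝ} (hf : SmoothFn n f) (h0 : ∀ x, f x ≠ 0) (x : X) :
    dFn n f⁻¹ x = (-((f x : ℂ)⁻¹ * (f x : ℂ)⁻¹)) • dFn n f x := by
  have h := (hf.hasFDerivAt x)
  have h1 : (f ((chartAt (Model n) x).symm (chartAt (Model n) x x)) : ℂ) ≠ 0 := by
    exact_mod_cast h0 _
  have h2 := HasDerivAt.comp_hasFDerivAt (f := fun y => (f ((chartAt (Model n) x).symm y) : ℂ)) _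
    (hasDerivAt_inv h1) h
  have h3 : (fun y => (f⁻¹ ((chartAt (Model n) x).symm y) : ℂ)) =
      Inv.inv ∘ fun y => (f ((chartAt (Model n) x).symm y) : ℂ) := by
    funext y
    simp
  rw [dFn, h3, h2.fderiv, symm_chart_self, sq, mul_inv]

theorem IsSmoothForm.add {u v : Form n X} (hu : IsSmoothForm u) (hv : IsSmoothForm v) :
    IsSmoothForm (u + v) := isSmoothForm_iff.2 fun x₀ =>
  ((isSmoothForm_iff.1 hu x₀).add (isSmoothForm_iff.1 hv x₀)).congr fun y _ => loc_add x₀ u v y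

theorem IsSmoothForm.sub {u v : Form n X} (hu : IsSmoothForm u) (hv : IsSmoothForm v) :
    IsSmoothForm (u - v) := isSmoothForm_iff.2 fun x₀ =>
  ((isSmoothForm_iff.1 hu x₀).sub (isSmoothForm_iff.1 hv x₀)).congr fun y _ => loc_sub x₀ u v y

theorem IsSmoothForm.smulFn {f : X → ℝ} (hf : SmoothFn n f) {u : Form n X} (hu : IsSmoothForm u) :
    IsSmoothForm (fun x => (f x : ℂ) • u x) := isSmoothForm_iff.2 fun x₀ =>
  (FSmooth.smul (contDiffOn_ofReal (hf x₀)) (isSmoothForm_iff.1 hu x₀)).congr fun y _ =>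
    loc_smul x₀ (fun x => (f x : ℂ)) u y

theorem IsSmoothForm.const_smul (c : ℂ) {u : Form n X} (hu : IsSmoothForm u) :
    IsSmoothForm (c • u) := isSmoothForm_iff.2 fun x₀ =>
  (FSmooth.smul (c := fun _ => c) contDiffOn_const (isSmoothForm_iff.1 hu x₀)).congr fun y _ =>
    loc_smul x₀ (fun _ => c) u y

theorem isSmoothForm_conj {u : Form n X} (hu : IsSmoothForm u) : IsSmoothForm (conjForm u) :=
  isSmoothForm_iff.2 fun x₀ => (isSmoothForm_iff.1 hu x₀).conj

variable [IsManifold 𝓘(ℂ, Model n) ω X]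

theorem smoothFn_of_contMDiff {f : X → ℝ} (hf : ContMDiff 𝓘(ℝ, Model n) 𝓘(ℝ, ℝ) ∞ f) :
    SmoothFn n f := by
  intro x₀
  have := isManifold_real n X
  have h := hf.comp_contMDiffOn
    (contMDiffOn_symm_of_mem_maximalAtlas (I := 𝓘(ℝ, Model n)) (n := ∞)
      (IsManifold.chart_mem_maximalAtlas (I := 𝓘(ℝ, Model n)) (n := ∞) x₀))
  exact h.contDiffOn

theorem IsSmoothForm.theta {η : X → ℝ} (hη : SmoothFn n η) {u : Form n X}
    (hu : IsSmoothForm u) : IsSmoothForm (theta η u) := isSmoothForm_iff.2 fun x₀ =>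
  ((isSmoothForm_iff.1 hu x₀).thetaL (hη x₀)).congr fun _ hy => loc_theta x₀ η u hy

theorem IsSmoothForm.lam (g : HermitianMetric n X) {u : Form n X} (hu : IsSmoothForm u) :
    IsSmoothForm (fun x => lamAt g x (u x)) := isSmoothForm_iff.2 fun x₀ =>
  ((flatMetric g x₀).fsmooth_lam (isSmoothForm_iff.1 hu x₀)).congr fun _ hy => loc_lam g x₀ u hy

theorem IsSmoothForm.torsAdj (g : HermitianMetric n X) {u : Form n X} (hu : IsSmoothForm u) :
    IsSmoothForm (fun x => torsAdj g x (u x)) := isSmoothForm_iff.2 fun x₀ =>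
  ((flatMetric g x₀).fsmooth_flatTors (isSmoothForm_iff.1 hu x₀)).congr fun _ hy =>
    loc_torsAdj g x₀ u hy

/-! ### The operators `d` and `dᶜ` -/

theorem extD_add {u v : Form n X} (hu : IsSmoothForm u) (hv : IsSmoothForm v) :
    extD (u + v) = extD u + extD v := by
  funext x
  rw [extD_eq (hu.add hv), Pi.add_apply, extD_eq hu, extD_eq hv]
  have := flatD_add (isSmoothForm_iff.1 hu x) (isSmoothForm_iff.1 hv x)
    (chartAt (Model n) x).open_target (mem_chart_target _ x)
  rw [← this]
  exact congrArg (fun F => flatD F _) (funext fun y => loc_add x u v y)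

theorem extD_smulFn {f : X → ℝ} (hf : SmoothFn n f) {u : Form n X} (hu : IsSmoothForm u) (x : X) :
    extD (fun x => (f x : ℂ) • u x) x = (f x : ℂ) • extD u x + ext (dFn n f x) (u x) := by
  rw [extD_eq (hu.smulFn hf), extD_eq hu]
  have h : loc x (fun x => (f x : ℂ) • u x) =
      fun y => (f ((chartAt (Model n) x).symm y) : ℂ) • loc x u y :=
    funext fun y => loc_smul x (fun x => (f x : ℂ)) u y
  rw [h, flatD_smul (contDiffOn_ofReal (hf x)) (isSmoothForm_iff.1 hu x)
    (chartAt (Model n) x).open_target (mem_chart_target _ x), symm_chart_self, loc_self]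
  rfl

/-- The operator `dᶜ = i (∂ - ∂̄)`. -/
def dcOp : Op n X := fun u x => flatDc (loc x u) (chartAt (Model n) x x)

/-- The case `f = 1` of `flatD_degL_thetaL`. Through it, `dᶜ` inherits naturality and smoothness
from `d`. -/
theorem flatDc_eq_flatD {u : Model n → Cov n} {s : Set (Model n)} {y : Model n} (hu : FSmooth u s)
    (hs : IsOpen s) (hy : y ∈ s) :
    flatDc u y = -Complex.I • thetaL (-1) (flatD (fun z => thetaL (-1) (u z)) y) := by
  have h := flatD_degL_thetaL (f := fun _ => (1 : ℝ)) contDiffOn_const (fun _ _ => one_ne_zero)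
    hu hs hy
  have h0 : compJ (0 : Model n →L[ℝ] ℂ) = 0 := by ext; simp [compJ]
  have h1 : (ext 0 : Cov n →ₗ[ℂ] Cov n) = 0 := by simp [ext]
  simp only [inv_one, degL_one, fderiv_fun_const, Complex.ofReal_one, one_smul, Pi.zero_apply, h0,
    h1, LinearMap.zero_apply, smul_zero, sub_zero] at h
  rw [h, smul_smul]
  simp

theorem loc_thetaConst (x₀ : X) (c : ℝ) (u : Form n X) {y : Model n}
    (hy : y ∈ (chartAt (Model n) x₀).target) :
    loc x₀ (theta (fun _ => c) u) y = thetaL c (loc x₀ u y) := loc_theta x₀ _ u hy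

theorem flatD_congr {u v : Model n → Cov n} {s : Set (Model n)} {y : Model n} (hs : IsOpen s)
    (hy : y ∈ s) (h : ∀ z ∈ s, u z = v z) : flatD u y = flatD v y := by
  rw [flatD, flatD]
  exact Finset.sum_congr rfl fun a _ => by rw [pd_congr hs hy h]

theorem flatDc_congr {u v : Model n → Cov n} {s : Set (Model n)} {y : Model n} (hs : IsOpen s)
    (hy : y ∈ s) (h : ∀ z ∈ s, u z = v z) : flatDc u y = flatDc v y := by
  rw [flatDc, flatDc]
  exact Finset.sum_congr rfl fun a _ => by rw [pd_congr hs hy h]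

theorem flatDc_loc {u : Form n X} (hu : IsSmoothForm u) (x₀ : X) {y : Model n}
    (hy : y ∈ (chartAt (Model n) x₀).target) : flatDc (loc x₀ u) y =
      loc x₀ (-Complex.I • theta (fun _ => -1) (extD (theta (fun _ => -1) u))) y := by
  have hs := (chartAt (Model n) x₀).open_target
  have h1 := hu.theta (smoothFn_const (-1))
  rw [flatDc_eq_flatD (isSmoothForm_iff.1 hu x₀) hs hy,
    flatD_congr hs hy fun z hz => (loc_thetaConst x₀ (-1) u hz).symm, ← loc_extD h1 x₀ hy,
    ← loc_thetaConst x₀ (-1) _ hy]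
  exact (loc_smul x₀ (fun _ => -Complex.I) _ y).symm

theorem dcOp_eq {u : Form n X} (hu : IsSmoothForm u) :
    dcOp u = -Complex.I • theta (fun _ => -1) (extD (theta (fun _ => -1) u)) := by
  funext x
  rw [dcOp, flatDc_loc hu x (mem_chart_target _ x), loc_self]

theorem loc_dcOp {u : Form n X} (hu : IsSmoothForm u) (x₀ : X) {y : Model n}
    (hy : y ∈ (chartAt (Model n) x₀).target) : loc x₀ (dcOp u) y = flatDc (loc x₀ u) y := by
  rw [flatDc_loc hu x₀ hy, dcOp_eq hu]

theorem isSmoothForm_dcOp {u : Form n X} (hu : IsSmoothForm u) : IsSmoothForm (dcOp u) :=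
  isSmoothForm_iff.2 fun x₀ => ((isSmoothForm_iff.1 hu x₀).flatDc
    (chartAt (Model n) x₀).open_target).congr fun _ hy => loc_dcOp hu x₀ hy

theorem dcOp_smulFn {f : X → ℝ} (hf : SmoothFn n f) {u : Form n X} (hu : IsSmoothForm u) (x : X) :
    dcOp (fun x => (f x : ℂ) • u x) x = (f x : ℂ) • dcOp u x + ext (compJ (dFn n f x)) (u x) := by
  rw [dcOp, dcOp]
  have h : loc x (fun x => (f x : ℂ) • u x) =
      fun y => (f ((chartAt (Model n) x).symm y) : ℂ) • loc x u y :=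
    funext fun y => loc_smul x (fun x => (f x : ℂ)) u y
  rw [h, flatDc_smul (contDiffOn_ofReal (hf x)) (isSmoothForm_iff.1 hu x)
    (chartAt (Model n) x).open_target (mem_chart_target _ x), symm_chart_self, loc_self]
  rfl

/-- `(df ∘ J) ∧ ·` is the commutator of `dᶜ` with multiplication by `f`, and both products preserve
smooth forms. -/
theorem IsSmoothForm.extJ {f : X → ℝ} (hf : SmoothFn n f) {u : Form n X} (hu : IsSmoothForm u) :
    IsSmoothForm (fun x => ext (compJ (dFn n f x)) (u x)) := by
  have h : (fun x => ext (compJ (dFn n f x)) (u x)) =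
      dcOp (fun x => (f x : ℂ) • u x) - fun x => (f x : ℂ) • dcOp u x := by
    funext x
    rw [Pi.sub_apply, dcOp_smulFn hf hu]
    abel
  rw [h]
  exact (isSmoothForm_dcOp (hu.smulFn hf)).sub ((isSmoothForm_dcOp hu).smulFn hf)

/-! ### The codifferential -/

/-- The formal adjoint of the exterior derivative. -/
def cod (g : HermitianMetric n X) : Op n X := fun v x =>
  dcOp (fun z => lamAt g z (v z)) x - lamAt g x (dcOp v x) - torsAdj g x (v x)

theorem loc_cod (g : HermitianMetric n X) {v : Form n X} (hv : IsSmoothForm v) (x₀ : X)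
    {y : Model n} (hy : y ∈ (chartAt (Model n) x₀).target) :
    loc x₀ (cod g v) y = flatCod (locForm g x₀) (loc x₀ v) y := by
  have hs := (chartAt (Model n) x₀).open_target
  have e : cod g v = dcOp (fun z => lamAt g z (v z)) - (fun x => lamAt g x (dcOp v x)) -
      fun x => torsAdj g x (v x) := rfl
  rw [e, loc_sub, loc_sub, loc_dcOp (hv.lam g) x₀ hy, loc_lam g x₀ _ hy, loc_torsAdj g x₀ _ hy,
    loc_dcOp hv x₀ hy, flatCod, flatDc_congr hs hy fun z hz => loc_lam g x₀ v hz]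

theorem isSmoothForm_cod (g : HermitianMetric n X) {v : Form n X} (hv : IsSmoothForm v) :
    IsSmoothForm (cod g v) :=
  ((isSmoothForm_dcOp (hv.lam g)).sub ((isSmoothForm_dcOp hv).lam g)).sub (hv.torsAdj g)

/-! ### The twisted derivatives -/

theorem isSmoothForm_twistedD {η : X → ℝ} (hη : SmoothFn n η) (h0 : ∀ x, η x ≠ 0) {u : Form n X}
    (hu : IsSmoothForm u) : IsSmoothForm (twistedD η u) :=
  (isSmoothForm_extD (hu.theta (hη.inv h0))).theta hη

theorem twistedD_add {η : X → ℝ} (hη : SmoothFn n η) (h0 : ∀ x, η x ≠ 0) {u v : Form n X}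
    (hu : IsSmoothForm u) (hv : IsSmoothForm v) :
    twistedD η (u + v) = twistedD η u + twistedD η v := by
  rw [twistedD, theta_add, extD_add (hu.theta (hη.inv h0)) (hv.theta (hη.inv h0)), theta_add]
  rfl

/-- The conjugate of `D_{-η}` in terms of `dᶜ`. -/
theorem conj_twistedD_neg {η : X → ℝ} (hη : SmoothFn n η) (h0 : ∀ x, η x ≠ 0) {u : Form n X}
    (hu : IsSmoothForm u) (x : X) :
    conjOp (twistedD (-η)) u x = thetaL (η x)⁻¹
      (-((η x : ℂ) • (Complex.I • dcOp (theta η u) x)) +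
        Complex.I • ext (compJ (dFn n η x)) (numL (thetaL (η x) (u x)))) := by
  have hs := (chartAt (Model n) x).open_target
  have hx := mem_chart_target (Model n) x
  have hneg : ∀ z, (-η) z ≠ 0 := fun z => neg_ne_zero.2 (h0 z)
  have hu' := (isSmoothForm_conj hu).theta (hη.neg.inv hneg)
  have hv := hu.theta hη
  have hvx := isSmoothForm_iff.1 hv x
  -- The conjugate of `θ_{-1/η}` multiplies by `(-1/η) ^ k` and applies `θ_{-η} = θ_{-1} θ_η`.
  -- Grouping `θ_η` with `u` leaves the operator treated in `flatD_degL_thetaL`, with `f = -η`.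
  have e1 : ∀ z ∈ (chartAt (Model n) x).target, loc x (theta (-η)⁻¹ (conjForm u)) z =
      conjCov (degL (-η ((chartAt (Model n) x).symm z))⁻¹
        (thetaL (-1) (loc x (theta η u) z))) := by
    intro z hz
    have h1 := conjCov_thetaL (inv_ne_zero (hneg ((chartAt (Model n) x).symm z))) (loc x u z)
    rw [loc_theta x _ _ hz, loc_theta x _ _ hz, loc_conjForm, thetaL_thetaL, neg_one_mul]
    rw [inv_inv] at h1
    rw [Pi.neg_apply] at h1
    rw [← h1, conjCov_conjCov]
    rfl
  have hsm : FSmooth (fun z => degL (-η ((chartAt (Model n) x).symm z))⁻¹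
      (thetaL (-1) (loc x (theta η u) z))) (chartAt (Model n) x).target :=
    (FSmooth.thetaL contDiffOn_const hvx).degL ((hη.neg x).inv fun z _ => hneg _)
  have e2 : conjOp (twistedD (-η)) u x = degL (-η x) (thetaL (-η x)⁻¹
      (flatD (fun z => degL (-η ((chartAt (Model n) x).symm z))⁻¹
        (thetaL (-1) (loc x (theta η u) z))) (chartAt (Model n) x x))) := by
    have e3 : conjOp (twistedD (-η)) u x =
        conjCov (thetaL (-η x) (extD (theta (-η)⁻¹ (conjForm u)) x)) := rfl
    rw [e3, extD_eq hu', flatD_congr hs hx e1, flatD_conj hsm hs hx,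
      conjCov_thetaL (c := -η x) (hneg x)]
  -- Splits the outer factor as `θ_{1/η} θ_{-1}`: the first is the conjugation that stays outside,
  -- the second belongs to `dᶜ`.
  have e4 : (-η x)⁻¹ = (η x)⁻¹ * -1 := by rw [inv_neg, mul_neg_one]
  have h5 := flatD_degL_thetaL (f := fun z => -η ((chartAt (Model n) x).symm z)) (hη.neg x)
    (fun z _ => hneg _) hvx hs hx
  rw [symm_chart_self] at h5
  rw [e2, e4, ← thetaL_thetaL, ← thetaL_degL, h5]
  congr 1
  have e6 : fderiv ℝ (fun z => ((-η ((chartAt (Model n) x).symm z) : ℝ) : ℂ))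
      (chartAt (Model n) x x) = -dFn n η x := dFn_neg η x
  have e7 : compJ (-dFn n η x) = (-1 : ℂ) • compJ (dFn n η x) := by
    ext v; simp [compJ_apply]
  rw [e6, e7, ext_smul, LinearMap.smul_apply, loc_self]
  change _ - _ • (-1 : ℂ) • ext _ (numL (thetaL (η x) (u x))) = _
  rw [dcOp]
  push_cast
  module

end Operators

/-! ### Functions as forms of degree zero -/

theorem ofFunction_eq {n : ℕ} {X : Type*} (f : X → ℝ) :
    (ofFunction f : Form n X) = fun x => (f x : ℂ) • scalar 1 := by
  funext x
  have h : (ofFunction f : Form n X) x = scalar (f x : ℂ) := rfl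
  rw [h, scalar, scalar, ← Pi.single_smul]
  congr 1
  ext v
  simp

theorem conjForm_ofFunction {n : ℕ} {X : Type*} (f : X → ℝ) :
    conjForm (ofFunction f : Form n X) = ofFunction f := by
  funext x k
  match k with
  | 0 => ext v; simp [conjForm, conjCov_apply, ofFunction, ofDegree]
  | k + 1 => ext v; simp [conjForm, conjCov_apply, ofFunction, ofDegree]

theorem typePart_zero {n k p : ℕ} : typePart p (0 : Alt n k) = 0 := by
  ext v
  change ∑ S ∈ Finset.powersetCard p (Finset.univ : Finset (Fin k)), slotPart (0 : Alt n k) S v = 0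
  simp [slotPart]

theorem component_ofFunction_zero {n : ℕ} {X : Type*} (f : X → ℝ) :
    component 0 0 (ofFunction f : Form n X) = ofFunction f := by
  funext x
  have h : typePart 0 ((ofFunction f : Form n X) x 0) = (ofFunction f : Form n X) x 0 := by
    have h1 := congrFun (thetaL_one ((ofFunction f : Form n X) x)) 0
    rw [thetaL_apply, thetaCov, Finset.sum_range_one] at h1
    simpa using h1
  change Pi.single 0 (typePart 0 ((ofFunction f : Form n X) x 0)) = _
  rw [h]
  congr 1

theorem component_ofFunction_succ {n : ℕ} {X : Type*} (f : X → ℝ) (p k : ℕ) :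
    component p (k + 1) (ofFunction f : Form n X) = 0 := by
  funext x
  have h : (ofFunction f : Form n X) x (k + 1) = 0 :=
    Pi.single_eq_of_ne (M := fun k => Alt n k) (Nat.succ_ne_zero k)
      (ContinuousAlternatingMap.constOfIsEmpty ℝ (Model n) (Fin 0) (f x : ℂ))
  change Pi.single (k + 1) (typePart p ((ofFunction f : Form n X) x (k + 1))) = 0
  rw [h, typePart_zero, Pi.single_zero]

section PointwiseAdjoints

variable {n : ℕ} {X : Type*} [TopologicalSpace X] [ChartedSpace (Model n) X]
  (g : HermitianMetric n X)

/-! ### Pointwise adjoints -/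

/-- Adjointness is tested pointwise, so constant families `fun _ => α` suffice as test forms, smooth
or not, and positivity makes the chosen adjoint equal to any given one. -/
theorem pointwiseAdjoint_eq {T S : Op n X} (h : IsPointwiseAdjoint g T S) :
    pointwiseAdjoint g T = S := by
  have hex : ∃ S, IsPointwiseAdjoint g T S := ⟨S, h⟩
  rw [pointwiseAdjoint, dif_pos hex]
  funext v x
  refine eq_of_innerP (coGram_posDef g x) fun α => ?_
  have h1 := hex.choose_spec (fun _ => α) v x
  have h2 := h (fun _ => α) v x
  rw [h2, inner_eq, inner_eq] at h1
  exact h1.symm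

theorem isPointwiseAdjoint_of_isAdj {A B : X → Module.End ℂ (Cov n)}
    (h : ∀ x, IsAdj (coGram g x) (A x) (B x)) :
    IsPointwiseAdjoint g (fun u x => A x (u x)) (fun u x => B x (u x)) := fun u v x => by
  rw [inner_eq, inner_eq]
  exact h x (u x) (v x)

theorem IsPointwiseAdjoint.conj {T S : Op n X} (h : IsPointwiseAdjoint g T S) :
    IsPointwiseAdjoint g (conjOp T) (conjOp S) := fun u v x => by
  have h1 := h (conjForm u) (conjForm v) x
  rw [inner_eq, inner_eq] at h1
  have h2 := congrArg (starRingEnd ℂ) h1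
  rw [← innerP_conjCov, ← innerP_conjCov] at h2
  simp only [conjForm, conjCov_conjCov] at h2
  rw [inner_eq, inner_eq]
  exact h2

theorem isPointwiseAdjoint_omega :
    IsPointwiseAdjoint g (wedgeOp g.omega) (fun u x => lamAt g x (u x)) :=
  isPointwiseAdjoint_of_isAdj g (A := fun x => wedgeL (g.omega x)) (isAdj_lamAt g)

theorem lambdaOp_eq : lambdaOp g = fun u x => lamAt g x (u x) :=
  pointwiseAdjoint_eq g (isPointwiseAdjoint_omega g)

theorem isPointwiseAdjoint_lambdaOp :
    IsPointwiseAdjoint g (wedgeOp g.omega) (lambdaOp g) := by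
  rw [lambdaOp_eq]
  exact isPointwiseAdjoint_omega g

theorem IsPointwiseAdjoint.spec {T S : Op n X} (h : IsPointwiseAdjoint g T S) :
    IsPointwiseAdjoint g T (pointwiseAdjoint g T) := by
  rwa [pointwiseAdjoint_eq g h]

theorem lamAt_thetaL (x : X) (c : ℝ) (α : Cov n) :
    lamAt g x (thetaL c α) = (c : ℂ) • thetaL c (lamAt g x α) :=
  lam_thetaL (isReal11_form g x) (gram_posDef g x) c α

theorem lamAt_thetaL_inv (x : X) {c : ℝ} (α : Cov n) :
    lamAt g x (thetaL c⁻¹ α) = (c : ℂ)⁻¹ • thetaL c⁻¹ (lamAt g x α) := by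
  rw [lamAt_thetaL, Complex.ofReal_inv]

/-! ### The torsion operators -/

theorem theta_inv_omega (η : X → ℝ) :
    theta η⁻¹ g.omega = fun x => ((η⁻¹ x : ℝ) : ℂ) • g.omega x :=
  funext fun x => thetaL_single_two (isReal11_form g x) _

theorem wedgeL_omega (x : X) : wedgeL (g.omega x) = lef (g.gram x) :=
  wedgeL_single_two (isReal11_form g x)

theorem loc_scalar (x₀ : X) (c : ℂ) (y : Model n) :
    loc x₀ (fun _ => scalar c) y = scalar c := by
  rw [loc_eq, scalar, pullback_single]
  congr 1

theorem isSmoothForm_scalar (c : ℂ) : IsSmoothForm (fun _ : X => (scalar c : Cov n)) :=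
  isSmoothForm_iff.2 fun x₀ k w => by
    simp only [loc_scalar]
    exact contDiffOn_const

theorem dFn_const (c : ℝ) (x : X) : dFn n (fun _ => c) x = 0 := by
  rw [dFn, fderiv_fun_const]; rfl

theorem isAdj_wedgeTors (x : X) {γ : Model n →L[ℝ] ℂ} (hγ : IsRealCovector γ) :
    IsAdj (coGram g x) (lamAt g x * (ext γ * lef (g.gram x)) - ext γ * lef (g.gram x) * lamAt g x)
      (wedgeTorsAdj (coGram g x) (g.gram x) γ) := by
  have h1 := isAdj_ext (coGram_symm g x) hγ
  have h2 := isAdj_lamAt g x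
  rw [wedgeL_omega] at h2
  have h3 := h2.symm (coGram_symm g x)
  have h4 := (h3.mul (h1.mul h2)).sub ((h1.mul h2).mul h3)
  rw [mul_assoc] at h4
  exact h4

theorem wedgeTors_eq (x : X) (γ : Model n →L[ℝ] ℂ) (α : Cov n) :
    wedge (ext γ (g.omega x)) α = (ext γ * lef (g.gram x)) α := by
  rw [Module.End.mul_apply, ← wedgeL_omega, wedgeL_apply, ext_apply, ext_apply, wedge_assoc]

variable [IsManifold 𝓘(ℂ, Model n) ω X]

/-- `θ_{1/η}` multiplies the `(1, 1)`-form `ω` by `η⁻¹`, and then the Leibniz rule applies with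
`d(η⁻¹) = -η⁻² dη`. -/
theorem twistedD_omega {η : X → ℝ} (hη : SmoothFn n η) (h0 : ∀ x, η x ≠ 0) (x : X) :
    twistedD η g.omega x = thetaL (η x) ((η x : ℂ)⁻¹ • extD g.omega x -
      ((η x : ℂ)⁻¹ * (η x : ℂ)⁻¹) • ext (dFn n η x) (g.omega x)) := by
  have h : twistedD η g.omega x = thetaL (η x) (extD (theta η⁻¹ g.omega) x) := rfl
  rw [h, theta_inv_omega, extD_smulFn (hη.inv h0) (isSmoothForm_omega g), dFn_inv hη h0, ext_smul,
    neg_smul, LinearMap.neg_apply, LinearMap.smul_apply, ← sub_eq_add_neg, Pi.inv_apply,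
    Complex.ofReal_inv]

/-- The pointwise adjoint of `τ_η`. -/
def tauAdj (η : X → ℝ) : Op n X := fun u x =>
  thetaL (η x)⁻¹ (torsAdj g x (thetaL (η x) (u x)) -
    (η x : ℂ)⁻¹ • wedgeTorsAdj (coGram g x) (g.gram x) (dFn n η x) (thetaL (η x) (u x)))

/-- Exhibits `τ_η` as a `θ_η`-conjugate, from which its adjoint can be written down. Moving `Λ` past
`θ_η` yields a factor `η`, which removes one power of `η⁻¹` from `twistedD_omega`. -/
theorem tau_eq {η : X → ℝ} (hη : SmoothFn n η) (h0 : ∀ x, η x ≠ 0) (u : Form n X) (x : X) :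
    tau g η u x = (thetaL (η x) * (torsAt g x - (η x : ℂ)⁻¹ • (lamAt g x *
      (ext (dFn n η x) * lef (g.gram x)) - ext (dFn n η x) * lef (g.gram x) * lamAt g x)) *
      thetaL (η x)⁻¹ : Module.End ℂ (Cov n)) (u x) := by
  have hc : (η x : ℂ) ≠ 0 := by exact_mod_cast h0 x
  obtain ⟨w, hw⟩ : ∃ w, u x = thetaL (η x) w := ⟨_, (thetaL_apply_inv _ (h0 x) _).symm⟩
  have h : tau g η u x = lamAt g x (wedge (twistedD η g.omega x) (u x)) -
      wedge (twistedD η g.omega x) (lamAt g x (u x)) := by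
    have h1 : ((-2 : ℤ) * 3).natAbs = 6 := rfl
    rw [tau, lambdaOp_eq, bracket, h1]
    have h2 : (-1 : ℤ) ^ 6 = 1 := by norm_num
    rw [h2, one_smul]
    rfl
  rw [h, twistedD_omega g hη h0, hw, lamAt_thetaL, ← wedgeL_apply _ ((η x : ℂ) • _), map_smul,
    wedgeL_apply, ← thetaL_wedge, ← thetaL_wedge, lamAt_thetaL, Module.End.mul_apply,
    Module.End.mul_apply, thetaL_inv_apply _ (h0 x), ← map_smul (thetaL (η x)),
    ← map_smul (thetaL (η x)), ← map_sub]
  congr 1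
  simp only [← wedgeL_apply, map_sub, map_smul, LinearMap.sub_apply, LinearMap.smul_apply, torsAt,
    Module.End.mul_apply]
  simp only [wedgeL_apply, wedgeTors_eq, Module.End.mul_apply]
  simp only [smul_sub, smul_smul, mul_inv_cancel₀ hc, one_smul, mul_inv_cancel_left₀ hc]
  abel

theorem isPointwiseAdjoint_tau {η : X → ℝ} (hη : SmoothFn n η) (h0 : ∀ x, η x ≠ 0) :
    IsPointwiseAdjoint g (tau g η) (tauAdj g η) := by
  have hθ := fun x c => isAdj_thetaL (coGram_jInvariant g x) c
  intro u v x
  have h := (((hθ x (η x)).mul ((isAdj_torsAt g x).sub ((isAdj_wedgeTors g x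
    (isRealCovector_dFn hη x)).smul_real (c := (η x : ℂ)⁻¹) (by simp)))).mul
      (hθ x (η x)⁻¹)) (u x) (v x)
  rw [tau_eq g hη h0, inner_eq, inner_eq, h]
  rfl

/-! ### The exterior derivative of a function -/

theorem ext_scalar_one (ξ : Model n →L[ℝ] ℂ) : ext ξ (scalar 1) = oneForm ξ := by
  refine cov_ext_contr ?_ fun v => ?_
  · rw [ext_zero_deg]; simp [oneForm_def]
  · rw [contr_ext, contr_scalar, map_zero, sub_zero, contr_oneForm, scalar, scalar,
      ← Pi.single_smul]
    congr 1
    ext v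
    simp

theorem extD_zero : extD (0 : Form n X) = 0 := by
  funext x
  have h := extD_smulFn (smoothFn_const (n := n) (X := X) 0) (isSmoothForm_scalar 1) x
  have h0 : (ext 0 : Cov n →ₗ[ℂ] Cov n) = 0 := by simp [ext]
  have e : (fun _ : X => ((0 : ℝ) : ℂ) • (scalar 1 : Cov n)) = 0 := by
    funext x; simp
  rw [e, dFn_const, h0] at h
  simpa using h

theorem extD_scalar (c : ℂ) : extD (fun _ : X => (scalar c : Cov n)) = 0 := by
  funext x
  rw [extD_eq (isSmoothForm_scalar c), flatD]
  refine Finset.sum_eq_zero fun a _ => ?_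
  have h : pd a (loc x (fun _ : X => (scalar c : Cov n))) (chartAt (Model n) x x) = 0 :=
    pd_eq_of_hasCovDeriv (isSmoothForm_iff.1 (isSmoothForm_scalar c) x)
      (chartAt (Model n) x).open_target (mem_chart_target _ x) fun k w => by
        simp only [loc_scalar]
        exact hasDerivAt_const _ _
  rw [h, map_zero]

theorem extD_ofFunction {f : X → ℝ} (hf : SmoothFn n f) (x : X) :
    extD (ofFunction f) x = oneForm (dFn n f x) := by
  rw [ofFunction_eq, extD_smulFn hf (isSmoothForm_scalar 1), extD_scalar, Pi.zero_apply, smul_zero,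
    zero_add, ext_scalar_one]

/-- The part of type `(1, 0)` of a covector. -/
def partHol (γ : Model n →L[ℝ] ℂ) : Model n →L[ℝ] ℂ :=
  (1 / 2 : ℂ) • γ - (Complex.I / 2) • compJ γ

/-- The part of type `(0, 1)` of a covector. -/
def partAnti (γ : Model n →L[ℝ] ℂ) : Model n →L[ℝ] ℂ :=
  (1 / 2 : ℂ) • γ + (Complex.I / 2) • compJ γ

/-- `θ_0` is the projection to `p = 0`, because `0 ^ 0 = 1`; its value on covectors is known from
`thetaL_oneForm`. -/
theorem typePart_zero_one (γ : Model n →L[ℝ] ℂ) :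
    typePart 0 (oneForm γ 1) = oneForm (partAnti γ) 1 := by
  have h := congrFun (thetaL_oneForm 0 γ) 1
  rw [thetaL_apply, thetaCov, Finset.sum_range_succ, Finset.sum_range_one] at h
  simp only [Complex.ofReal_zero, pow_zero, one_smul, pow_one, zero_smul, add_zero] at h
  rw [h]
  have e : ((0 + 1 : ℂ) / 2) • γ - (Complex.I * (0 - 1) / 2) • compJ γ = partAnti γ := by
    ext v
    simp only [partAnti, sub_apply, add_apply, smul_apply, smul_eq_mul]
    ring
  rw [e]

theorem typePart_one_one (γ : Model n →L[ℝ] ℂ) :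
    typePart 1 (oneForm γ 1) = oneForm (partHol γ) 1 := by
  have h := congrFun (thetaL_oneForm 1 γ) 1
  rw [thetaL_apply, thetaCov, Finset.sum_range_succ, Finset.sum_range_one] at h
  simp only [Complex.ofReal_one, pow_zero, one_smul, pow_one] at h
  have e : ((1 + 1 : ℂ) / 2) • γ - (Complex.I * (1 - 1) / 2) • compJ γ =
      partAnti γ + partHol γ := by
    ext v
    simp only [partAnti, partHol, sub_apply, add_apply, smul_apply, smul_eq_mul]
    ring
  rw [typePart_zero_one, e, map_add, Pi.add_apply] at h
  exact add_left_cancel h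

theorem oneForm_apply_of_ne {k : ℕ} (hk : k ≠ 1) (ξ : Model n →L[ℝ] ℂ) : oneForm ξ k = 0 :=
  Pi.single_eq_of_ne hk _

theorem del_ofFunction {f : X → ℝ} (hf : SmoothFn n f) (x : X) :
    del (ofFunction f) x = oneForm (partHol (dFn n f x)) := by
  funext k
  match k with
  | 0 => rw [oneForm_apply_of_ne (by omega)]; rfl
  | 1 =>
    change ∑ p ∈ Finset.range 1, typePart (p + 1) (extD (component p 0 (ofFunction f)) x 1) = _
    rw [Finset.sum_range_one, component_ofFunction_zero, extD_ofFunction hf, typePart_one_one]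
  | k + 2 =>
    rw [oneForm_apply_of_ne (by omega)]
    refine Finset.sum_eq_zero fun p _ => ?_
    rw [component_ofFunction_succ, extD_zero]
    exact typePart_zero

theorem delbar_ofFunction {f : X → ℝ} (hf : SmoothFn n f) (x : X) :
    delbar (ofFunction f) x = oneForm (partAnti (dFn n f x)) := by
  funext k
  match k with
  | 0 => rw [oneForm_apply_of_ne (by omega)]; rfl
  | 1 =>
    change ∑ p ∈ Finset.range 1, typePart p (extD (component p 0 (ofFunction f)) x 1) = _
    rw [Finset.sum_range_one, component_ofFunction_zero, extD_ofFunction hf, typePart_zero_one]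
  | k + 2 =>
    rw [oneForm_apply_of_ne (by omega)]
    refine Finset.sum_eq_zero fun p _ => ?_
    rw [component_ofFunction_succ, extD_zero]
    exact typePart_zero

theorem dEta_ofFunction (a : X → ℝ) {f : X → ℝ} (hf : SmoothFn n f) (x : X) :
    dEta a (ofFunction f) x =
      oneForm ((a x : ℂ) • partHol (dFn n f x) + partAnti (dFn n f x)) := by
  rw [map_add, map_smul, ← del_ofFunction hf, ← delbar_ofFunction hf]
  rfl

theorem conj_partHol {γ : Model n →L[ℝ] ℂ} (hγ : IsRealCovector γ) (c : ℝ) :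
    conjCov (oneForm ((c : ℂ) • partHol γ + partAnti γ)) =
      oneForm (partHol γ + (c : ℂ) • partAnti γ) := by
  refine cov_ext_contr ?_ fun v => ?_
  · ext w; simp [conjCov_apply, oneForm_def]
  · have h1 := hγ v
    have h2 := hγ (Complex.I • v)
    rw [contr_conjCov, contr_oneForm, contr_oneForm]
    have hs : ∀ z : ℂ, conjCov (scalar z : Cov n) = scalar ((starRingEnd ℂ) z) := by
      intro z
      funext k
      match k with
      | 0 => ext v; simp [conjCov_apply, scalar]
      | k + 1 => ext v; simp [conjCov_apply, scalar]
    rw [hs]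
    congr 1
    simp only [partHol, partAnti, add_apply, sub_apply, smul_apply, compJ_apply, smul_eq_mul,
      map_add, map_sub, map_mul, map_div₀, Complex.conj_I, Complex.conj_ofReal, h1, h2, map_one,
      map_ofNat]
    ring

end PointwiseAdjoints

theorem conjForm_conjForm {n : ℕ} {X : Type*} (u : Form n X) : conjForm (conjForm u) = u :=
  funext fun x => conjCov_conjCov (u x)

section Commutators

variable {n : ℕ} {X : Type*} [TopologicalSpace X] [ChartedSpace (Model n) X]
  (g : HermitianMetric n X)

/-! ### The zero order terms -/

theorem conjCov_lam (P : Matrix (Idx n) (Idx n) ℝ) (α : Cov n) :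
    conjCov (lam P α) = lam P (conjCov α) := by
  simp only [lam, LinearMap.smul_apply, LinearMap.sum_apply, conjCov_smul, conjCov_sum, conj_half,
    Complex.conj_ofReal]
  rfl

/-- The operator `η⁻¹ [β ∧ ·, Λ]` for a form `β` of degree one. -/
def corr (η : X → ℝ) (β : Form n X) : Op n X :=
  mulFn η⁻¹ (bracket 1 (-2) (wedgeOp β) (lambdaOp g))

theorem corr_apply (η : X → ℝ) (β u : Form n X) (x : X) : corr g η β u x =
    (η x : ℂ)⁻¹ • (wedge (β x) (lamAt g x (u x)) - lamAt g x (wedge (β x) (u x))) := by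
  have h1 : ((1 : ℤ) * (-2)).natAbs = 2 := rfl
  have h2 : (-1 : ℤ) ^ 2 = 1 := by norm_num
  rw [corr, lambdaOp_eq, mulFn, bracket, h1, h2, one_smul, Pi.inv_apply, Complex.ofReal_inv]
  rfl

theorem corr_conj (η : X → ℝ) (β u : Form n X) :
    conjOp (corr g η β) u = corr g η (conjForm β) u := by
  funext x
  have h : conjOp (corr g η β) u x = conjCov (corr g η β (conjForm u) x) := rfl
  rw [h, corr_apply, corr_apply, conjCov_smul, conjCov_sub, conjCov_wedge, lamAt, conjCov_lam,
    conjCov_lam, conjCov_wedge]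
  simp only [conjForm, conjCov_conjCov, map_inv₀, Complex.conj_ofReal]

theorem corr_neg (η : X → ℝ) (β u : Form n X) : corr g (-η) β u = -corr g η β u := by
  funext x
  rw [Pi.neg_apply, corr_apply, corr_apply, Pi.neg_apply, Complex.ofReal_neg, inv_neg, neg_smul]

variable [IsManifold 𝓘(ℂ, Model n) ω X]

/-- Conjugation together with the change of sign of `η` exchanges the one-forms of the two
correction terms. The sign from conjugating `i` cancels the one from differentiating `-η`. -/
theorem conjForm_dEta_neg {η : X → ℝ} (hη : SmoothFn n η) :
    conjForm (Complex.I • conjOp (dEta (- -η)) (ofFunction (-η))) =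
      (Complex.I • dEta η (ofFunction η) : Form n X) := by
  funext x
  have h : conjForm (Complex.I • conjOp (dEta (- -η)) (ofFunction (-η)) : Form n X) x =
      -Complex.I • dEta η (conjForm (ofFunction (-η))) x := by
    change conjCov (Complex.I • conjCov (dEta (- -η) (conjForm (ofFunction (-η))) x)) = _
    rw [conjCov_smul, conjCov_conjCov, neg_neg, Complex.conj_I]
  rw [h, conjForm_ofFunction, Pi.smul_apply, dEta_ofFunction η hη.neg, dEta_ofFunction η hη,
    dFn_neg, neg_smul, ← smul_neg, ← map_neg]
  congr 2
  ext v
  simp only [partHol, partAnti, sub_apply, add_apply, smul_apply, smul_eq_mul, neg_apply,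
    compJ_apply]
  ring

/-- The form `i \overline{d_{-η}} η` after conjugation with `θ_η`. -/
theorem ext_conj_dEta {η : X → ℝ} (hη : SmoothFn n η) (h0 : ∀ x, η x ≠ 0) (x : X) (α : Cov n) :
    wedge ((Complex.I • conjOp (dEta (-η)) (ofFunction η) : Form n X) x) α =
      thetaL (η x)⁻¹ ((η x : ℂ) • ext (compJ (dFn n η x)) (thetaL (η x) α)) := by
  have hc : (η x : ℂ) ≠ 0 := by exact_mod_cast h0 x
  have h : (Complex.I • conjOp (dEta (-η)) (ofFunction η) : Form n X) x =
      Complex.I • conjCov (dEta (-η) (conjForm (ofFunction η)) x) := rfl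
  have h2 := conj_partHol (isRealCovector_dFn hη x) (-η x)
  rw [h, conjForm_ofFunction, dEta_ofFunction (-η) hη, Pi.neg_apply, h2, ← map_smul, ← ext_apply,
    map_smul, thetaL_ext, thetaL_inv_apply _ (h0 x), ← LinearMap.smul_apply, ← ext_smul]
  -- With `γ = dη` and its parts `γ'`, `γ''`, both covectors are `i (γ' - η γ'')`.
  congr 2
  ext v
  have hJ : Complex.I • Complex.I • v = -v := by
    rw [smul_smul, Complex.I_mul_I, neg_one_smul]
  simp only [partHol, partAnti, sub_apply, add_apply, smul_apply, smul_eq_mul,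
    compJ_apply, hJ, map_neg, Complex.ofReal_neg, Complex.ofReal_inv]
  field_simp
  linear_combination (-(1 + (η x : ℂ)) * (dFn n η x (Complex.I • v))) * Complex.I_sq

theorem corr_eq {η : X → ℝ} (hη : SmoothFn n η) (h0 : ∀ x, η x ≠ 0) (u : Form n X) (x : X) :
    corr g η (Complex.I • conjOp (dEta (-η)) (ofFunction η)) u x = thetaL (η x)⁻¹
      ((η x : ℂ)⁻¹ • (ext (compJ (dFn n η x)) (lamAt g x (thetaL (η x) (u x))) -
        lamAt g x (ext (compJ (dFn n η x)) (thetaL (η x) (u x))))) := by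
  have hc : (η x : ℂ) ≠ 0 := by exact_mod_cast h0 x
  obtain ⟨w, hw⟩ : ∃ w, u x = thetaL (η x)⁻¹ w := ⟨_, (thetaL_inv_apply _ (h0 x) _).symm⟩
  rw [corr_apply, ext_conj_dEta hη h0, ext_conj_dEta hη h0, hw, lamAt_thetaL_inv, lamAt_thetaL_inv]
  simp only [map_smul, map_sub, thetaL_apply_inv _ (h0 x), smul_smul, mul_inv_cancel₀ hc,
    inv_mul_cancel₀ hc, one_smul]

theorem isSmoothForm_corr {η : X → ℝ} (hη : SmoothFn n η) (h0 : ∀ x, η x ≠ 0) {u : Form n X}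
    (hu : IsSmoothForm u) :
    IsSmoothForm (corr g η (Complex.I • conjOp (dEta (-η)) (ofFunction η)) u) := by
  have hw := hu.theta hη
  have h := ((((hw.lam g).extJ hη).sub ((hw.extJ hη).lam g)).smulFn (hη.inv h0)).theta (hη.inv h0)
  have e : corr g η (Complex.I • conjOp (dEta (-η)) (ofFunction η)) u = _ :=
    funext fun x => corr_eq g hη h0 u x
  rw [e]
  have e2 : ∀ x, ((η⁻¹ x : ℝ) : ℂ) = (η x : ℂ)⁻¹ := fun x => by simp
  simp only [e2] at h
  exact h

/-! ### The formal adjoint of the twisted derivative -/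

/-- The operator `θ_η⁻¹ d⋆ θ_η`. -/
def codEta (η : X → ℝ) : Op n X := fun v => theta η⁻¹ (cod g (theta η v))

theorem isSmoothForm_codEta {η : X → ℝ} (hη : SmoothFn n η) (h0 : ∀ x, η x ≠ 0) {u : Form n X}
    (hu : IsSmoothForm u) : IsSmoothForm (codEta g η u) :=
  (isSmoothForm_cod g (hu.theta hη)).theta (hη.inv h0)

/-- Every term is brought to the form `θ_η⁻¹ (…) θ_η v`. The terms with the degree operator,
produced by `conj_twistedD_neg` and by the adjoint of `[Λ, dη ∧ ω ∧ ·]`, cancel, and only the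
multiple `n` of a commutator of `(dη ∘ J) ∧ ·` with `Λ` is left. -/
theorem codEta_apply {η : X → ℝ} (hη : SmoothFn n η) (h0 : ∀ x, η x ≠ 0) {v : Form n X}
    (hv : IsSmoothForm v) (x : X) : codEta g η v x =
      -Complex.I • (lamAt g x (conjOp (twistedD (-η)) v x) -
        conjOp (twistedD (-η)) (fun z => lamAt g z (v z)) x) - tauAdj g η v x +
      (n : ℂ) • corr g η (Complex.I • conjOp (dEta (-η)) (ofFunction η)) v x := by
  have hc : (η x : ℂ) ≠ 0 := by exact_mod_cast h0 x
  have hw := hv.theta hη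
  -- Taking `θ_η` through `Λ` leaves a factor `1/η`. Differentiating that factor produces `(dη ∘ J)
  -- ∧ Λ` without the degree operator, which accounts for the last term of `wedgeTorsAdj_eq`.
  have hL : theta η (fun z => lamAt g z (v z)) =
      fun z => ((η⁻¹ z : ℝ) : ℂ) • lamAt g z (theta η v z) := by
    funext z
    have hz : (η z : ℂ) ≠ 0 := by exact_mod_cast h0 z
    have h1 := lamAt_thetaL g z (η z) (v z)
    change thetaL (η z) (lamAt g z (v z)) = _ • lamAt g z (thetaL (η z) (v z))
    rw [h1, smul_smul, Pi.inv_apply, Complex.ofReal_inv, inv_mul_cancel₀ hz, one_smul]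
  have hLx : thetaL (η x) (lamAt g x (v x)) = (η x : ℂ)⁻¹ • lamAt g x (thetaL (η x) (v x)) := by
    have := congrFun hL x
    rw [Pi.inv_apply, Complex.ofReal_inv] at this
    exact this
  have hM := wedgeTorsAdj_eq (isReal11_form g x) (gram_posDef g x) (isRealCovector_dFn hη x)
    (thetaL (η x) (v x))
  have hcod : codEta g η v x = thetaL (η x)⁻¹ (dcOp (fun z => lamAt g z (theta η v z)) x -
      lamAt g x (dcOp (theta η v) x) - torsAdj g x (thetaL (η x) (v x))) := rfl
  rw [hcod, conj_twistedD_neg hη h0 hv, conj_twistedD_neg hη h0 (hv.lam g), hL,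
    dcOp_smulFn (hη.inv h0) (hw.lam g), dFn_inv hη h0, tauAdj, corr_eq g hη h0, lamAt_thetaL_inv,
    hLx, ← map_smul, ← map_smul (thetaL (η x)⁻¹), ← map_sub (thetaL (η x)⁻¹),
    ← map_smul (thetaL (η x)⁻¹), ← map_sub (thetaL (η x)⁻¹), ← map_add (thetaL (η x)⁻¹)]
  congr 1
  have hM' : wedgeTorsAdj (coGram g x) (g.gram x) (dFn n η x) (thetaL (η x) (v x)) = _ := hM
  have eJ : compJ ((-((η x : ℂ)⁻¹ * (η x : ℂ)⁻¹)) • dFn n η x) =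
      (-((η x : ℂ)⁻¹ * (η x : ℂ)⁻¹)) • compJ (dFn n η x) := rfl
  have hl : lam (gramOf (g.form x))⁻¹ = lamAt g x := rfl
  have ht : theta η v x = thetaL (η x) (v x) := rfl
  rw [hM', hl, eJ, ext_smul, LinearMap.smul_apply, ht, Pi.inv_apply, Complex.ofReal_inv]
  generalize thetaL (η x) (v x) = w
  simp only [map_add, map_smul, map_neg]
  -- Only a linear relation between fixed forms remains, with coefficients rational in `η x` and
  -- polynomial in `i`.
  match_scalars <;> field_simp <;> (try simp only [Complex.I_sq]) <;> ring

end Commutators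

/-- Complex linearity of an operator on smooth forms. -/
structure LinearOnSmooth {n : ℕ} {X : Type*} [TopologicalSpace X] [ChartedSpace (Model n) X]
    (A : Op n X) : Prop where
  add : ∀ u v, IsSmoothForm u → IsSmoothForm v → A (u + v) = A u + A v
  smul : ∀ (c : ℂ) u, IsSmoothForm u → A (c • u) = c • A u

theorem conjForm_add {n : ℕ} {X : Type*} (u v : Form n X) :
    conjForm (u + v) = conjForm u + conjForm v := funext fun x => conjCov_add (u x) (v x)

theorem conjForm_sub {n : ℕ} {X : Type*} (u v : Form n X) :
    conjForm (u - v) = conjForm u - conjForm v := funext fun x => conjCov_sub (u x) (v x)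

theorem conjForm_smul {n : ℕ} {X : Type*} (c : ℂ) (u : Form n X) :
    conjForm (c • u) = (starRingEnd ℂ) c • conjForm u := funext fun x => conjCov_smul c (u x)

theorem bracket_pos {n : ℕ} {X : Type*} (A B : Op n X) (u : Form n X) :
    bracket 1 1 A B u = A (B u) + B (A u) := by
  have h1 : ((1 : ℤ) * 1).natAbs = 1 := rfl
  rw [bracket, h1, pow_one, neg_one_smul, sub_neg_eq_add]

theorem bracket_neg {n : ℕ} {X : Type*} (A B : Op n X) (u : Form n X) :
    bracket 1 (-1) A B u = A (B u) + B (A u) := by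
  have h1 : ((1 : ℤ) * (-1)).natAbs = 1 := rfl
  rw [bracket, h1, pow_one, neg_one_smul, sub_neg_eq_add]

theorem bracket_even {n : ℕ} {X : Type*} (A B : Op n X) (u : Form n X) :
    bracket 2 (-2) A B u = A (B u) - B (A u) := by
  have h1 : ((2 : ℤ) * (-2)).natAbs = 4 := rfl
  have h2 : (-1 : ℤ) ^ 4 = 1 := by norm_num
  rw [bracket, h1, h2, one_smul]

/-! ### The commutation relations and the Bochner–Kodaira–Nakano identity -/

section Identity

variable {n : ℕ} {X : Type*} [TopologicalSpace X] [ChartedSpace (Model n) X]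
  (g : HermitianMetric n X)

theorem LinearOnSmooth.sub {A : Op n X} (hA : LinearOnSmooth A) {u v : Form n X}
    (hu : IsSmoothForm u) (hv : IsSmoothForm v) : A (u - v) = A u - A v := by
  rw [sub_eq_add_neg, ← neg_one_smul ℂ v, hA.add _ _ hu (hv.const_smul _), hA.smul _ _ hv,
    neg_one_smul, sub_eq_add_neg]

/-- The pattern of the right-hand sides of `codEta_eq` and `conj_codEta_eq`, so that a first-order
operator can be distributed over them. -/
theorem LinearOnSmooth.combination {A : Op n X} (hA : LinearOnSmooth A) {u₁ u₂ u₃ u₄ : Form n X}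
    (h₁ : IsSmoothForm u₁) (h₂ : IsSmoothForm u₂) (h₃ : IsSmoothForm u₃) (h₄ : IsSmoothForm u₄)
    (a b : ℂ) :
    A (a • (u₁ - u₂) - u₃ + b • u₄) = a • (A u₁ - A u₂) - A u₃ + b • A u₄ := by
  have h := (h₁.sub h₂).const_smul a
  rw [hA.add _ _ (h.sub h₃) (h₄.const_smul b), hA.sub h h₃, hA.smul _ _ (h₁.sub h₂), hA.sub h₁ h₂,
    hA.smul _ _ h₄]

theorem LinearOnSmooth.conj {A : Op n X} (hA : LinearOnSmooth A) : LinearOnSmooth (conjOp A) where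
  add u v hu hv := by
    rw [conjOp, conjForm_add, hA.add _ _ (isSmoothForm_conj hu) (isSmoothForm_conj hv),
      conjForm_add]
    rfl
  smul c u hu := by
    rw [conjOp, conjForm_smul, hA.smul _ _ (isSmoothForm_conj hu), conjForm_smul, Complex.conj_conj]
    rfl

theorem lambdaOp_conj (u : Form n X) : conjForm (lambdaOp g u) = lambdaOp g (conjForm u) := by
  rw [lambdaOp_eq]
  exact funext fun x => conjCov_lam _ _

variable [IsManifold 𝓘(ℂ, Model n) ω X]

theorem extD_smul (c : ℂ) {u : Form n X} (hu : IsSmoothForm u) : extD (c • u) = c • extD u := by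
  funext x
  rw [extD_eq (hu.const_smul c), Pi.smul_apply, extD_eq hu]
  have h : loc x (c • u) = fun y => c • loc x u y := funext fun y => loc_smul x (fun _ => c) u y
  have h0 : (ext 0 : Cov n →ₗ[ℂ] Cov n) = 0 := by simp [ext]
  rw [h, flatD_smul (f := fun _ => c) contDiffOn_const (isSmoothForm_iff.1 hu x)
    (chartAt (Model n) x).open_target (mem_chart_target _ x), fderiv_fun_const, Pi.zero_apply, h0,
    LinearMap.zero_apply, add_zero]

theorem linearOnSmooth_twistedD {η : X → ℝ} (hη : SmoothFn n η) (h0 : ∀ x, η x ≠ 0) :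
    LinearOnSmooth (twistedD η : Op n X) where
  add u v hu hv := twistedD_add hη h0 hu hv
  smul c u hu := by
    have hθ : ∀ (η : X → ℝ) (u : Form n X), theta η (c • u) = c • theta η u := fun η u =>
      funext fun x => (thetaL (η x)).map_smul c (u x)
    rw [twistedD, hθ, extD_smul c (hu.theta (hη.inv h0)), hθ]
    rfl

theorem isSmoothForm_conj_twistedD {η : X → ℝ} (hη : SmoothFn n η) (h0 : ∀ x, η x ≠ 0)
    {u : Form n X} (hu : IsSmoothForm u) : IsSmoothForm (conjOp (twistedD (-η)) u) :=
  isSmoothForm_conj (isSmoothForm_twistedD hη.neg (fun x => neg_ne_zero.2 (h0 x))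
    (isSmoothForm_conj hu))

theorem codEta_eq {η : X → ℝ} (hη : SmoothFn n η) (h0 : ∀ x, η x ≠ 0) {v : Form n X}
    (hv : IsSmoothForm v) : codEta g η v =
      -Complex.I • (lambdaOp g (conjOp (twistedD (-η)) v) - conjOp (twistedD (-η)) (lambdaOp g v)) -
        pointwiseAdjoint g (tau g η) v +
      (n : ℂ) • corr g η (Complex.I • conjOp (dEta (-η)) (ofFunction η)) v := by
  rw [lambdaOp_eq, pointwiseAdjoint_eq g (isPointwiseAdjoint_tau g hη h0)]
  exact funext fun x => codEta_apply g hη h0 hv x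

theorem pointwiseAdjoint_conj_tau {η : X → ℝ} (hη : SmoothFn n η) (h0 : ∀ x, η x ≠ 0) :
    pointwiseAdjoint g (conjOp (tau g η)) = conjOp (pointwiseAdjoint g (tau g η)) := by
  have h := isPointwiseAdjoint_tau g hη h0
  rw [pointwiseAdjoint_eq g h, pointwiseAdjoint_eq g h.conj]

/-- The conjugate of `codEta_eq` with `-η` in place of `η`. The coefficient `-i` becomes `i`, and
the correction term changes sign through the factor `1 / (-η)`. -/
theorem conj_codEta_eq {η : X → ℝ} (hη : SmoothFn n η) (h0 : ∀ x, η x ≠ 0) {v : Form n X}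
    (hv : IsSmoothForm v) : conjOp (codEta g (-η)) v =
      Complex.I • (lambdaOp g (twistedD η v) - twistedD η (lambdaOp g v)) -
        pointwiseAdjoint g (conjOp (tau g (-η))) v +
      (-n : ℂ) • corr g η (Complex.I • dEta η (ofFunction η)) v := by
  have hneg : ∀ x, (-η) x ≠ 0 := fun x => neg_ne_zero.2 (h0 x)
  have h : conjOp (codEta g (-η)) v = conjForm (codEta g (-η) (conjForm v)) := rfl
  have h2 : conjForm (corr g (-η) (Complex.I • conjOp (dEta (- -η)) (ofFunction (-η)))
      (conjForm v)) = -corr g η (Complex.I • dEta η (ofFunction η)) v := by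
    have := corr_conj g (-η) (Complex.I • conjOp (dEta (- -η)) (ofFunction (-η))) v
    rw [conjForm_dEta_neg hη, corr_neg] at this
    exact this
  rw [h, codEta_eq g hη.neg hneg (isSmoothForm_conj hv), conjForm_add, conjForm_sub, conjForm_smul,
    conjForm_smul, conjForm_sub, h2, lambdaOp_conj, pointwiseAdjoint_conj_tau g hη.neg hneg,
    neg_neg]
  simp only [conjOp, conjForm_conjForm, map_neg, Complex.conj_I, neg_neg, Complex.conj_natCast,
    lambdaOp_conj, smul_neg, neg_smul]

theorem isSmoothForm_lambdaOp {u : Form n X} (hu : IsSmoothForm u) :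
    IsSmoothForm (lambdaOp g u) := by
  rw [lambdaOp_eq]
  exact hu.lam g

/-- `τ_η⋆ u` is isolated from `codEta_eq`, whose other terms are already known to be smooth. -/
theorem isSmoothForm_tauAdj {η : X → ℝ} (hη : SmoothFn n η) (h0 : ∀ x, η x ≠ 0) {u : Form n X}
    (hu : IsSmoothForm u) : IsSmoothForm (pointwiseAdjoint g (tau g η) u) := by
  have h := codEta_eq g hη h0 hu
  have h1 := (((isSmoothForm_lambdaOp g (isSmoothForm_conj_twistedD hη h0 hu)).sub
    (isSmoothForm_conj_twistedD hη h0 (isSmoothForm_lambdaOp g hu))).const_smul (-Complex.I)).add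
      ((isSmoothForm_corr g hη h0 hu).const_smul n)
  have e : ∀ a b c d : Form n X, a = b - c + d → c = b + d - a := fun a b c d h => by
    rw [h]; abel
  rw [e _ _ _ _ h]
  exact h1.sub (isSmoothForm_codEta g hη h0 hu)

theorem isSmoothForm_corr_conj {η : X → ℝ} (hη : SmoothFn n η) (h0 : ∀ x, η x ≠ 0) {u : Form n X}
    (hu : IsSmoothForm u) : IsSmoothForm (corr g η (Complex.I • dEta η (ofFunction η)) u) := by
  have hneg : ∀ x, (-η) x ≠ 0 := fun x => neg_ne_zero.2 (h0 x)
  have h := isSmoothForm_conj (isSmoothForm_corr g hη.neg hneg (isSmoothForm_conj hu))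
  have e := corr_conj g (-η) (Complex.I • conjOp (dEta (- -η)) (ofFunction (-η))) u
  rw [conjForm_dEta_neg hη, corr_neg] at e
  have h2 := (show IsSmoothForm (-corr g η (Complex.I • dEta η (ofFunction η)) u) from
    e ▸ h).const_smul (-1)
  rwa [neg_one_smul, neg_neg] at h2

/-- The Bochner–Kodaira–Nakano identity, in terms of the operators `θ_η⁻¹ d⋆ θ_η`. -/
theorem bochnerKodairaNakano {η : X → ℝ} (hη : SmoothFn n η) (h0 : ∀ x, η x ≠ 0) {u : Form n X}
    (hu : IsSmoothForm u) :
    twistedD η (codEta g η u) + codEta g η (twistedD η u) =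
      conjOp (twistedD (-η)) (conjOp (codEta g (-η)) u) +
        conjOp (codEta g (-η)) (conjOp (twistedD (-η)) u)
      + Complex.I • bracket 2 (-2)
              (bracket 1 1 (twistedD η) (conjOp (twistedD (-η)))) (lambdaOp g) u
      + bracket 1 (-1) (conjOp (twistedD (-η))) (pointwiseAdjoint g (conjOp (tau g (-η)))) u
      - bracket 1 (-1) (twistedD η) (pointwiseAdjoint g (tau g η)) u
      + (n : ℂ) • bracket 1 (-1) (twistedD η)
          (corr g η (Complex.I • conjOp (dEta (-η)) (ofFunction η))) u
      + (n : ℂ) • bracket 1 (-1) (conjOp (twistedD (-η)))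
          (corr g η (Complex.I • dEta η (ofFunction η))) u := by
  have hneg : ∀ x, (-η) x ≠ 0 := fun x => neg_ne_zero.2 (h0 x)
  have hD := linearOnSmooth_twistedD hη h0
  have hDb := (linearOnSmooth_twistedD hη.neg hneg).conj
  have s1 := isSmoothForm_twistedD hη h0 hu
  have s2 := isSmoothForm_conj_twistedD hη h0 hu
  have s3 := isSmoothForm_lambdaOp g hu
  have hT := isSmoothForm_tauAdj g hη h0 hu
  have hTb : IsSmoothForm (pointwiseAdjoint g (conjOp (tau g (-η))) u) := by
    rw [pointwiseAdjoint_conj_tau g hη.neg hneg]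
    exact isSmoothForm_conj (isSmoothForm_tauAdj g hη.neg hneg (isSmoothForm_conj hu))
  rw [codEta_eq g hη h0 hu, codEta_eq g hη h0 s1, conj_codEta_eq g hη h0 hu,
    conj_codEta_eq g hη h0 s2,
    hD.combination (isSmoothForm_lambdaOp g s2) (isSmoothForm_conj_twistedD hη h0 s3) hT
      (isSmoothForm_corr g hη h0 hu),
    hDb.combination (isSmoothForm_lambdaOp g s1) (isSmoothForm_twistedD hη h0 s3) hTb
      (isSmoothForm_corr_conj g hη h0 hu),
    bracket_even, bracket_neg, bracket_neg, bracket_neg, bracket_neg, bracket_pos, bracket_pos]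
  have hL : lambdaOp g (twistedD η (conjOp (twistedD (-η)) u) +
      conjOp (twistedD (-η)) (twistedD η u)) = lambdaOp g (twistedD η (conjOp (twistedD (-η)) u)) +
      lambdaOp g (conjOp (twistedD (-η)) (twistedD η u)) := by
    rw [lambdaOp_eq]
    exact funext fun x => map_add _ _ _
  rw [hL]
  -- With `D = D_η` and `D̄ = D̄_{-η}`, the double commutators match by the graded Jacobi identity
  -- `[D, [Λ, D̄]] + [D̄, [Λ, D]] = -[[D, D̄], Λ]`; the remaining terms appear verbatim on both
  -- sides.
  module

end Identity

open MeasureTheory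

/-! ### Stokes' theorem in a chart -/

section FlatStokes

variable {n : ℕ} {s K : Set (Model n)}

theorem indicator_eventuallyEq_zero {f : Model n → ℂ} (hK : IsClosed K)
    (h0 : ∀ y ∈ s, y ∉ K → f y = 0) {y : Model n} (hy : y ∉ K) :
    s.indicator f =ᶠ[nhds y] fun _ => 0 := by
  filter_upwards [hK.isOpen_compl.mem_nhds hy] with z hz
  by_cases hzs : z ∈ s
  · rw [Set.indicator_of_mem hzs, h0 z hzs hz]
  · rw [Set.indicator_of_notMem hzs]

theorem indicator_eventuallyEq {f : Model n → ℂ} (hs : IsOpen s) {y : Model n} (hy : y ∈ s) :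
    s.indicator f =ᶠ[nhds y] f := by
  filter_upwards [hs.mem_nhds hy] with z hz
  rw [Set.indicator_of_mem hz]

/-- The integral of a partial derivative of a compactly supported function vanishes. -/
theorem integral_fderiv_eq_zero {f : Model n → ℂ} (hs : IsOpen s) (hK : IsCompact K) (hKs : K ⊆ s)
    (hf : ContDiffOn ℝ ∞ f s) (h0 : ∀ y ∈ s, y ∉ K → f y = 0) (v : Model n) :
    IntegrableOn (fun y => fderiv ℝ f y v) s ∧ ∫ y in s, fderiv ℝ f y v = 0 := by
  -- The extension by zero is smooth on the whole space, because `f` vanishes on `s` outside the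
  -- compact set `K ⊆ s`.
  set F := s.indicator f with hF
  have hFs : ContDiff ℝ ∞ F := contDiff_iff_contDiffAt.2 fun y => by
    by_cases hy : y ∈ K
    · exact (hf.contDiffAt (hs.mem_nhds (hKs hy))).congr_of_eventuallyEq
        (indicator_eventuallyEq hs (hKs hy))
    · exact contDiffAt_const.congr_of_eventuallyEq (indicator_eventuallyEq_zero hK.isClosed h0 hy)
  have hsupp : HasCompactSupport F := HasCompactSupport.intro hK fun y hy =>
    (indicator_eventuallyEq_zero hK.isClosed h0 hy).eq_of_nhds
  have hc : Continuous fun y => fderiv ℝ F y v :=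
    (hFs.continuous_fderiv (by simp)).clm_apply continuous_const
  have hsupp' : HasCompactSupport fun y => fderiv ℝ F y v :=
    HasCompactSupport.intro hK fun y hy => by
      rw [(indicator_eventuallyEq_zero hK.isClosed h0 hy).fderiv_eq, fderiv_fun_const]
      rfl
  have hint : Integrable fun y => fderiv ℝ F y v := hc.integrable_of_hasCompactSupport hsupp'
  have heq : s.indicator (fun y => fderiv ℝ f y v) = fun y => fderiv ℝ F y v := by
    funext y
    by_cases hy : y ∈ s
    · rw [Set.indicator_of_mem hy, (indicator_eventuallyEq hs hy).fderiv_eq]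
    · rw [Set.indicator_of_notMem hy, (indicator_eventuallyEq_zero hK.isClosed h0
        fun h => hy (hKs h)).fderiv_eq, fderiv_fun_const]
      rfl
  refine ⟨(integrable_indicator_iff hs.measurableSet).1 (heq ▸ hint), ?_⟩
  rw [← integral_indicator hs.measurableSet, heq]
  -- Integration by parts against the constant function `1`.
  have h := integral_bilinear_hasLineDerivAt_right_eq_neg_left_of_integrable (μ := volume)
    (f := fun _ : Model n => (1 : ℝ)) (f' := fun _ => 0) (g := F) (g' := fun y => fderiv ℝ F y v)
    (v := v) (B := ContinuousLinearMap.lsmul ℝ ℝ) (by simp) (by simpa using hint)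
    (by simpa using hFs.continuous.integrable_of_hasCompactSupport hsupp)
    (fun y _ => (hasFDerivAt_const (1 : ℝ) y).hasLineDerivAt v)
    (fun y _ => ((hFs.differentiable (by simp)) y).hasFDerivAt.hasLineDerivAt v)
  simpa using h

/-- By `divergence` the integrand is a sum of partial derivatives of functions which vanish outside
`K`. -/
theorem FlatMetric.integral_eq_zero {w : Model n → Alt n 2} (hw : FlatMetric w s)
    (hK : IsCompact K) (hKs : K ⊆ s) {u v : Model n → Cov n} (hu : FSmooth u s)
    (hv : FSmooth v s) (h0 : ∀ y ∈ s, y ∉ K → u y = 0) :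
    ∫ y in s, (innerP (gramInv w y) (flatD u y) (v y) -
      innerP (gramInv w y) (u y) (flatCod w v y)) * (Real.sqrt (gramOf (w y)).det : ℂ) = 0 := by
  have h := fun a : Idx n => integral_fderiv_eq_zero hw.isOpen hK hKs
    (f := fun z => innerP (gramInv w z) (u z) (sharpB (gramInv w z) a (v z)) *
      (Real.sqrt (gramOf (w z)).det : ℂ))
    ((contDiffOn_innerP hw.contDiffOn_gramInv hu
      (opSmooth_sharpB hw.contDiffOn_gramInv a _ hv)).mul (contDiffOn_ofReal hw.contDiffOn_density))
    (fun y hy hyK => by rw [h0 y hy hyK, map_zero, LinearMap.zero_apply, zero_mul])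
    (realBasis n a)
  rw [← setIntegral_congr_fun hw.isOpen.measurableSet fun y hy => hw.divergence hu hv hy,
    integral_finsetSum _ fun a _ => (h a).1]
  exact Finset.sum_eq_zero fun a _ => (h a).2

end FlatStokes

/-! ### Determinants -/

/-- The coordinates with respect to the real basis. -/
def coordEquiv (n : ℕ) : Model n ≃ₗ[ℝ] (Idx n → ℝ) where
  toFun v a := coordR a v
  map_add' v w := by
    funext a
    simp only [coordR, Pi.add_apply]
    split_ifs <;> simp
  map_smul' c v := by
    funext a
    simp only [coordR, Pi.smul_apply]
    split_ifs <;> simp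
  invFun c := ∑ a, c a • realBasis n a
  left_inv v := sum_coordR v
  right_inv c := by
    funext a
    have h : (coordR a (∑ b, c b • realBasis n b) : ℂ) = c a := by
      rw [← coord_apply, map_sum]
      simp only [map_smul, coord_realBasis]
      simp
    exact_mod_cast h

theorem det_realMatrix {n : ℕ} (A : Model n →L[ℝ] Model n) : (realMatrix A).det = A.det := by
  have h : realMatrix A = LinearMap.toMatrix (Module.Basis.ofEquivFun (coordEquiv n))
      (Module.Basis.ofEquivFun (coordEquiv n)) A.toLinearMap := by
    ext a b
    rw [LinearMap.toMatrix_apply]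
    have hb : Module.Basis.ofEquivFun (coordEquiv n) b = realBasis n b := by
      rw [Module.Basis.coe_ofEquivFun]
      change ∑ a, (Pi.single b 1 : Idx n → ℝ) a • realBasis n a = _
      rw [Finset.sum_eq_single b]
      · simp
      · intro c _ hc; simp [hc]
      · simp
    rw [hb]
    rfl
  rw [h, LinearMap.det_toMatrix]

/-! ### The Riemannian volume -/

section Volume

variable {n : ℕ} {X : Type*} [TopologicalSpace X] [ChartedSpace (Model n) X]
  (g : HermitianMetric n X)

theorem measurableSet_preimage_symm [MeasurableSpace X] [BorelSpace X] (x₀ : X) {A : Set X}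
    (hA : MeasurableSet A) :
    MeasurableSet ((chartAt (Model n) x₀).target ∩ (chartAt (Model n) x₀).symm ⁻¹' A) := by
  have hT := (chartAt (Model n) x₀).open_target.measurableSet
  have h := hT.subtype_image ((continuousOn_iff_continuous_domRestrict.1
    (chartAt (Model n) x₀).continuousOn_symm).measurable hA)
  convert h using 1
  ext y
  simp [and_comm]

theorem aemeasurable_symm [MeasurableSpace X] [BorelSpace X] (x₀ : X) :
    AEMeasurable (chartAt (Model n) x₀).symm
    (((volume : Measure (Model n)).restrict (chartAt (Model n) x₀).target).withDensity
      fun y => ENNReal.ofReal (g.density x₀ y)) :=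
  ((chartAt (Model n) x₀).continuousOn_symm.aemeasurable
    (chartAt (Model n) x₀).open_target.measurableSet).mono_ac
      (withDensity_absolutelyContinuous _ _)

theorem chartVolume_apply [MeasurableSpace X] [BorelSpace X] (x₀ : X) {A : Set X}
    (hA : MeasurableSet A) :
    g.chartVolume x₀ A =
      ∫⁻ y in (chartAt (Model n) x₀).target ∩ (chartAt (Model n) x₀).symm ⁻¹' A,
        ENNReal.ofReal (g.density x₀ y) := by
  rw [HermitianMetric.chartVolume, Measure.map_apply_of_aemeasurable (aemeasurable_symm g x₀) hA,
    withDensity_apply', Measure.restrict_restrict'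
      (chartAt (Model n) x₀).open_target.measurableSet, Set.inter_comm]

theorem chartVolume_compl_source [MeasurableSpace X] [BorelSpace X] (x₀ : X) :
    g.chartVolume x₀ (chartAt (Model n) x₀).sourceᶜ = 0 := by
  rw [chartVolume_apply g x₀ (chartAt (Model n) x₀).open_source.measurableSet.compl]
  have h : (chartAt (Model n) x₀).target ∩
      (chartAt (Model n) x₀).symm ⁻¹' (chartAt (Model n) x₀).sourceᶜ = ∅ := by
    ext y
    simp only [Set.mem_inter_iff, Set.mem_preimage, Set.mem_compl_iff, Set.mem_empty_iff_false,
      iff_false, not_and, not_not]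
    exact fun hy => (chartAt (Model n) x₀).map_target hy
  rw [h, Measure.restrict_empty, lintegral_zero_measure]

variable [IsManifold 𝓘(ℂ, Model n) ω X]

theorem density_eq (x₀ : X) {y : Model n} (hy : y ∈ (chartAt (Model n) x₀).target) :
    g.density x₀ y = Real.sqrt (gramOf (locForm g x₀ y)).det := by
  rw [HermitianMetric.density]
  congr 2
  ext a b
  change (g.form _ ![dSymm x₀ y (realBasis n a), Complex.I • dSymm x₀ y (realBasis n b)]).re =
    (locForm g x₀ y ![realBasis n a, Complex.I • realBasis n b]).re
  rw [locForm, comp_apply_two, dSymm_smul x₀ hy]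

theorem continuousOn_density (x₀ : X) :
    ContinuousOn (g.density x₀) (chartAt (Model n) x₀).target :=
  ((flatMetric g x₀).contDiffOn_density.continuousOn).congr fun _ hy => density_eq g x₀ hy

theorem density_pos (x₀ : X) {y : Model n} (hy : y ∈ (chartAt (Model n) x₀).target) :
    0 < g.density x₀ y := by
  rw [density_eq g x₀ hy]
  exact Real.sqrt_pos.2 ((flatMetric g x₀).det_pos hy)

theorem locForm_trans (x₀ x₁ : X) {y : Model n} (hy : y ∈ transDom x₀ x₁) :
    locForm g x₀ y =
      (locForm g x₁ (trans x₀ x₁ y)).compContinuousLinearMap (dTrans x₀ x₁ y) := by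
  have h := loc_trans x₀ x₁ g.omega hy
  rw [loc_omega, loc_omega, pullback_single] at h
  exact Pi.single_injective 2 h

/-- The Gram matrices are congruent through the Jacobian matrix, so the square root of the
determinant picks up the absolute value of the Jacobian determinant, as the change of variables
formula demands. -/
theorem density_trans (x₀ x₁ : X) {y : Model n} (hy : y ∈ transDom x₀ x₁) :
    g.density x₀ y = |(dTrans x₀ x₁ y).det| * g.density x₁ (trans x₀ x₁ y) := by
  have hy1 := (trans_mem x₀ x₁ hy).1
  rw [density_eq g x₀ hy.1, density_eq g x₁ hy1, locForm_trans g x₀ x₁ hy,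
    (isReal11_locForm g x₁ hy1).gramOf_comp (dTrans_smul x₀ x₁ hy), Matrix.det_mul, Matrix.det_mul,
    Matrix.det_transpose, det_realMatrix, mul_right_comm, ← sq, Real.sqrt_mul (sq_nonneg _),
    Real.sqrt_sq_eq_abs]

theorem aemeasurable_density (x₀ : X) : AEMeasurable (fun y => ENNReal.ofReal (g.density x₀ y))
    ((volume : Measure (Model n)).restrict (chartAt (Model n) x₀).target) :=
  ((continuousOn_density g x₀).aemeasurable
    (chartAt (Model n) x₀).open_target.measurableSet).ennreal_ofReal

variable [MeasurableSpace X] [BorelSpace X]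

/-- The chart volumes agree on overlaps. -/
theorem chartVolume_eq (x₀ x₁ : X) {A : Set X} (hA : MeasurableSet A)
    (h0 : A ⊆ (chartAt (Model n) x₀).source) (h1 : A ⊆ (chartAt (Model n) x₁).source) :
    g.chartVolume x₀ A = g.chartVolume x₁ A := by
  rw [chartVolume_apply g x₀ hA, chartVolume_apply g x₁ hA]
  set B := (chartAt (Model n) x₀).target ∩ (chartAt (Model n) x₀).symm ⁻¹' A with hB
  have hBm : MeasurableSet B := measurableSet_preimage_symm x₀ hA
  have hBt : ∀ y ∈ B, y ∈ transDom x₀ x₁ := fun y hy => ⟨hy.1, h1 hy.2⟩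
  have himg : trans x₀ x₁ '' B =
      (chartAt (Model n) x₁).target ∩ (chartAt (Model n) x₁).symm ⁻¹' A := by
    ext z
    constructor
    · rintro ⟨y, hy, rfl⟩
      refine ⟨(trans_mem x₀ x₁ (hBt y hy)).1, ?_⟩
      rw [Set.mem_preimage, symm_trans x₀ x₁ (hBt y hy)]
      exact hy.2
    · rintro ⟨hz, hzA⟩
      have hz' : z ∈ transDom x₁ x₀ := ⟨hz, h0 hzA⟩
      refine ⟨trans x₁ x₀ z, ⟨(trans_mem x₁ x₀ hz').1, ?_⟩, ?_⟩
      · rw [Set.mem_preimage, symm_trans x₁ x₀ hz']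
        exact hzA
      · rw [trans_trans x₁ x₀ x₁ hz', trans_self x₁ hz]
  have hinj : Set.InjOn (trans x₀ x₁) B := fun y hy z hz h => by
    have h2 := congrArg (trans x₁ x₀) h
    rwa [trans_trans x₀ x₁ x₀ (hBt y hy), trans_trans x₀ x₁ x₀ (hBt z hz), trans_self x₀ hy.1,
      trans_self x₀ hz.1] at h2
  rw [← himg, lintegral_image_eq_lintegral_abs_det_fderiv_mul volume hBm
    (fun y hy => (differentiableAt_trans x₀ x₁ (hBt y hy)).hasFDerivAt.hasFDerivWithinAt) hinj]
  refine setLIntegral_congr_fun hBm fun y hy => ?_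
  change ENNReal.ofReal _ = ENNReal.ofReal |(dTrans x₀ x₁ y).det| * _
  rw [density_trans g x₀ x₁ (hBt y hy), ENNReal.ofReal_mul (abs_nonneg _)]

/-- On the source at `x₀` no chart volume exceeds the one of `x₀`: two of them agree on the common
domain, and each vanishes outside its own source. Hence the supremum of measures is attained there
by the chart volume of `x₀`. -/
theorem vol_restrict_source (x₀ : X) :
    g.vol.restrict (chartAt (Model n) x₀).source = g.chartVolume x₀ := by
  have hS := (chartAt (Model n) x₀).open_source.measurableSet
  have hself : (g.chartVolume x₀).restrict (chartAt (Model n) x₀).source = g.chartVolume x₀ := by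
    refine Measure.restrict_eq_self_of_ae_mem ?_
    rw [ae_iff]
    exact chartVolume_compl_source g x₀
  have hle : g.vol ≤ g.chartVolume x₀ + g.vol.restrict (chartAt (Model n) x₀).sourceᶜ := by
    refine iSup_le fun x => Measure.le_iff.2 fun A hA => ?_
    rw [Measure.add_apply, Measure.restrict_apply hA, ← measure_inter_add_sdiff A hS]
    refine add_le_add ?_ ?_
    · have e : g.chartVolume x (A ∩ (chartAt (Model n) x₀).source) =
          g.chartVolume x (A ∩ (chartAt (Model n) x₀).source ∩ (chartAt (Model n) x).source) := by
        refine (measure_inter_conull ?_).symm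
        exact chartVolume_compl_source g x
      rw [e, chartVolume_eq g x x₀ ((hA.inter hS).inter
        (chartAt (Model n) x).open_source.measurableSet) (fun y hy => hy.2) (fun y hy => hy.1.2)]
      exact measure_mono fun y hy => hy.1.1
    · exact le_iSup (fun x => g.chartVolume x) x _
  refine le_antisymm ?_ ?_
  · refine (Measure.restrict_mono le_rfl hle).trans ?_
    rw [Measure.restrict_add, hself, Measure.restrict_restrict hS, Set.inter_compl_self,
      Measure.restrict_empty, add_zero]
  · rw [← hself]
    exact Measure.restrict_mono le_rfl (le_iSup (fun x => g.chartVolume x) x₀)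

theorem vol_apply (x₀ : X) {A : Set X} (hA : MeasurableSet A)
    (h : A ⊆ (chartAt (Model n) x₀).source) : g.vol A =
      ∫⁻ y in (chartAt (Model n) x₀).target ∩ (chartAt (Model n) x₀).symm ⁻¹' A,
        ENNReal.ofReal (g.density x₀ y) := by
  rw [← chartVolume_apply g x₀ hA, ← vol_restrict_source, Measure.restrict_apply hA,
    Set.inter_eq_left.2 h]

theorem integral_vol (x₀ : X) {f : X → ℂ} (hf : Continuous f)
    (h : ∀ x ∉ (chartAt (Model n) x₀).source, f x = 0) : ∫ x, f x ∂g.vol =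
      ∫ y in (chartAt (Model n) x₀).target,
        f ((chartAt (Model n) x₀).symm y) * (g.density x₀ y : ℂ) := by
  have h1 : ∫ x, f x ∂g.vol = ∫ x in (chartAt (Model n) x₀).source, f x ∂g.vol :=
    (setIntegral_eq_integral_of_forall_compl_eq_zero h).symm
  rw [h1, vol_restrict_source, HermitianMetric.chartVolume,
    integral_map (aemeasurable_symm g x₀) hf.aestronglyMeasurable,
    integral_withDensity_eq_integral_toReal_smul₀ (aemeasurable_density g x₀) (by simp)]
  refine setIntegral_congr_fun (chartAt (Model n) x₀).open_target.measurableSet fun y hy => ?_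
  rw [ENNReal.toReal_ofReal (density_pos g x₀ hy).le, Complex.real_smul, mul_comm]

theorem isLocallyFiniteMeasure_vol : IsLocallyFiniteMeasure g.vol := ⟨fun x => by
  have hx := mem_chart_target (Model n) x
  obtain ⟨N, hN, hNt, hNc⟩ := local_compact_nhds
    ((chartAt (Model n) x).open_target.mem_nhds hx)
  refine ⟨(chartAt (Model n) x).source ∩ chartAt (Model n) x ⁻¹' interior N,
    ((chartAt (Model n) x).isOpen_inter_preimage isOpen_interior).mem_nhds
      ⟨mem_chart_source _ x, mem_interior_iff_mem_nhds.2 hN⟩, ?_⟩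
  rw [vol_apply g x ((chartAt (Model n) x).isOpen_inter_preimage isOpen_interior).measurableSet
    fun y hy => hy.1]
  refine (lintegral_mono_set fun y hy => ?_).trans_lt
    (((continuousOn_density g x).mono hNt).integrableOn_compact hNc).lintegral_lt_top
  have h2 := hy.2.2
  rw [Set.mem_preimage, (chartAt (Model n) x).right_inv hy.1] at h2
  exact interior_subset h2⟩

/-- Needed for the uniqueness of formal adjoints: a nonnegative continuous function with compact
support and vanishing integral must be zero. It holds because the density is positive in every
chart. -/
theorem isOpenPosMeasure_vol : Measure.IsOpenPosMeasure g.vol := ⟨fun U hU ⟨x, hx⟩ h0 => by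
  have hO := hU.inter (chartAt (Model n) x).open_source
  have h1 : g.vol (U ∩ (chartAt (Model n) x).source) = 0 :=
    measure_mono_null (fun y hy => hy.1) h0
  have hB := (chartAt (Model n) x).isOpen_inter_preimage_symm hO
  rw [vol_apply g x hO.measurableSet fun y hy => hy.2,
    setLIntegral_eq_zero_iff' hB.measurableSet
      ((aemeasurable_density g x).mono_set fun y hy => hy.1)] at h1
  have h2 : (volume : Measure (Model n)) ((chartAt (Model n) x).target ∩
      (chartAt (Model n) x).symm ⁻¹' (U ∩ (chartAt (Model n) x).source)) = 0 := by
    refine measure_mono_null (fun y hy => ?_) h1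
    intro hcon
    have := hcon hy
    rw [ENNReal.ofReal_eq_zero] at this
    exact absurd (density_pos g x hy.1) (not_lt.2 this)
  refine hB.measure_ne_zero volume ⟨chartAt (Model n) x x, mem_chart_target _ x, ?_⟩ h2
  rw [Set.mem_preimage, symm_chart_self]
  exact ⟨hx, mem_chart_source _ x⟩⟩

end Volume

/-! ### Formal adjoints -/

theorem hasCompactSupport_theta {n : ℕ} {X : Type*} [TopologicalSpace X] (η : X → ℝ)
    {u : Form n X} (hc : HasCompactSupport u) :
    HasCompactSupport (theta η u) :=
  hc.mono fun x hx h => hx ((congrArg (thetaL (η x)) h).trans (map_zero _))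

section FormalAdjoint

variable {n : ℕ} {X : Type*} [TopologicalSpace X] [ChartedSpace (Model n) X]
  (g : HermitianMetric n X)

theorem loc_eq_zero (x₀ : X) {u : Form n X} {y : Model n}
    (h : u ((chartAt (Model n) x₀).symm y) = 0) : loc x₀ u y = 0 := by
  rw [loc_eq, h, map_zero]

theorem hasCompactSupport_inner {u : Form n X} (hc : HasCompactSupport u) (v : Form n X) :
    HasCompactSupport fun x => g.inner x (u x) (v x) :=
  hc.mono fun x hx h => hx (by simp only; rw [inner_eq, h, map_zero, LinearMap.zero_apply])

theorem formalAdjoint_spec [MeasurableSpace X] {P Q : Op n X} (h : IsFormalAdjoint g P Q) :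
    IsFormalAdjoint g P (formalAdjoint g P) := by
  have hex : ∃ Q, IsFormalAdjoint g P Q := ⟨Q, h⟩
  rw [formalAdjoint, dif_pos hex]
  exact hex.choose_spec

variable [IsManifold 𝓘(ℂ, Model n) ω X]

theorem inner_symm_chart (x₀ : X) (u v : Form n X) {y : Model n}
    (hy : y ∈ (chartAt (Model n) x₀).target) :
    g.inner ((chartAt (Model n) x₀).symm y) (u ((chartAt (Model n) x₀).symm y))
      (v ((chartAt (Model n) x₀).symm y)) =
      innerP (gramInv (locForm g x₀) y) (loc x₀ u y) (loc x₀ v y) := by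
  rw [inner_eq, loc_eq, loc_eq, innerP_loc g x₀ hy]

theorem continuous_inner {u v : Form n X} (hu : IsSmoothForm u) (hv : IsSmoothForm v) :
    Continuous fun x => g.inner x (u x) (v x) := by
  refine continuous_iff_continuousAt.2 fun x => ?_
  have hx := mem_chart_source (Model n) x
  have h := (contDiffOn_innerP (flatMetric g x).contDiffOn_gramInv (isSmoothForm_iff.1 hu x)
    (isSmoothForm_iff.1 hv x)).continuousOn.comp (chartAt (Model n) x).continuousOn
      (chartAt (Model n) x).mapsTo
  refine (h.continuousAt ((chartAt (Model n) x).open_source.mem_nhds hx)).congr ?_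
  filter_upwards [(chartAt (Model n) x).open_source.mem_nhds hx] with z hz
  have h1 := inner_symm_chart g x u v ((chartAt (Model n) x).map_source hz)
  rw [(chartAt (Model n) x).left_inv hz] at h1
  exact h1.symm

theorem extD_eq_zero {u : Form n X} (hu : IsSmoothForm u) {x : X} (hx : x ∉ tsupport u) :
    extD u x = 0 := by
  have hO := (chartAt (Model n) x).isOpen_inter_preimage_symm (isClosed_tsupport u).isOpen_compl
  rw [extD_eq hu, flatD_congr (v := fun _ => 0) hO ⟨mem_chart_target _ x, ?_⟩ fun z hz =>
    loc_eq_zero x (image_eq_zero_of_notMem_tsupport hz.2), flatD]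
  · refine Finset.sum_eq_zero fun a _ => ?_
    have h : pd a (fun _ : Model n => (0 : Cov n)) (chartAt (Model n) x x) = 0 :=
      pd_eq_of_hasCovDeriv (fun _ _ => contDiffOn_const) isOpen_univ (Set.mem_univ _)
        fun k w => hasDerivAt_const _ _
    rw [h, map_zero]
  · rw [Set.mem_preimage, symm_chart_self]
    exact hx

theorem hasCompactSupport_extD {u : Form n X} (hu : IsSmoothForm u) (hc : HasCompactSupport u) :
    HasCompactSupport (extD u) :=
  hc.mono' fun x hx => by
    by_contra h
    exact hx (extD_eq_zero hu h)

variable [MeasurableSpace X] [BorelSpace X]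

theorem integrable_inner {u v : Form n X} (hu : IsSmoothForm u) (hv : IsSmoothForm v)
    (hc : HasCompactSupport u) : Integrable (fun x => g.inner x (u x) (v x)) g.vol := by
  have := isLocallyFiniteMeasure_vol g
  exact (continuous_inner g hu hv).integrable_of_hasCompactSupport (hasCompactSupport_inner g hc v)

/-- Both integrands vanish outside the chart, so their difference can be integrated there, where it
is a compactly supported divergence. -/
theorem l2inner_extD_of_subset_chart (x₀ : X) {u v : Form n X} (hu : IsSmoothForm u)
    (hv : IsSmoothForm v) (hc : HasCompactSupport u)
    (hsub : tsupport u ⊆ (chartAt (Model n) x₀).source) :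
    g.l2inner (extD u) v = g.l2inner u (cod g v) := by
  have hdu := isSmoothForm_extD hu
  have hcv := isSmoothForm_cod g hv
  have hw := flatMetric g x₀
  have hcont : Continuous fun x => g.inner x (extD u x) (v x) - g.inner x (u x) (cod g v x) :=
    (continuous_inner g hdu hv).sub (continuous_inner g hu hcv)
  rw [← sub_eq_zero, HermitianMetric.l2inner, HermitianMetric.l2inner,
    ← integral_sub (integrable_inner g hdu hv (hasCompactSupport_extD hu hc))
      (integrable_inner g hu hcv hc),
    integral_vol g x₀ hcont]
  · have hK : IsCompact (chartAt (Model n) x₀ '' tsupport u) :=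
      hc.isCompact.image_of_continuousOn ((chartAt (Model n) x₀).continuousOn.mono hsub)
    have hKs : chartAt (Model n) x₀ '' tsupport u ⊆ (chartAt (Model n) x₀).target := by
      rintro _ ⟨x, hx, rfl⟩
      exact (chartAt (Model n) x₀).map_source (hsub hx)
    rw [← hw.integral_eq_zero hK hKs (isSmoothForm_iff.1 hu x₀) (isSmoothForm_iff.1 hv x₀)
      fun y hy hyK => loc_eq_zero x₀ (image_eq_zero_of_notMem_tsupport fun h =>
        hyK ⟨_, h, (chartAt (Model n) x₀).right_inv hy⟩)]
    refine setIntegral_congr_fun hw.isOpen.measurableSet fun y hy => ?_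
    rw [inner_symm_chart g x₀ _ _ hy, inner_symm_chart g x₀ _ _ hy, loc_extD hu x₀ hy,
      loc_cod g hv x₀ hy, density_eq g x₀ hy]
  · intro x hx
    have h1 : x ∉ tsupport u := fun h => hx (hsub h)
    rw [inner_eq, inner_eq, extD_eq_zero hu h1, image_eq_zero_of_notMem_tsupport h1, map_zero,
      LinearMap.zero_apply, LinearMap.zero_apply, sub_zero]

theorem l2inner_add_left {u u' v : Form n X} (hu : IsSmoothForm u) (hu' : IsSmoothForm u')
    (hv : IsSmoothForm v) (hc : HasCompactSupport u) (hc' : HasCompactSupport u') :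
    g.l2inner (u + u') v = g.l2inner u v + g.l2inner u' v := by
  rw [HermitianMetric.l2inner, HermitianMetric.l2inner, HermitianMetric.l2inner,
    ← integral_add (integrable_inner g hu hv hc) (integrable_inner g hu' hv hc')]
  refine integral_congr_ae (Filter.Eventually.of_forall fun x => ?_)
  simp only [inner_eq, Pi.add_apply, map_add, LinearMap.add_apply]

variable [T2Space X]

/-- Testing with `b (Q v - Q' v)` for a bump function `b` at `x₀` shows that the integral of `b |Q v
- Q' v|²` is zero. The integrand is continuous and nonnegative, so it vanishes at `x₀`, where `b =
1`. -/
theorem isFormalAdjoint_unique {P Q Q' : Op n X} (h : IsFormalAdjoint g P Q)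
    (h' : IsFormalAdjoint g P Q') {v : Form n X} (hv : IsSmoothForm v) : Q v = Q' v := by
  have := isManifold_real n X
  have := isLocallyFiniteMeasure_vol g
  have := isOpenPosMeasure_vol g
  have hw := (h.1 v hv).sub (h'.1 v hv)
  funext x₀
  rw [← sub_eq_zero, ← Pi.sub_apply]
  let b : SmoothBumpFunction 𝓘(ℝ, Model n) x₀ := Classical.choice inferInstance
  have hb : SmoothFn n b := smoothFn_of_contMDiff b.contMDiff
  have hbw := hw.smulFn hb
  have hc : HasCompactSupport fun x => (b x : ℂ) • (Q v - Q' v) x :=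
    b.hasCompactSupport.mono fun x hx h => hx (by simp only; rw [h, Complex.ofReal_zero, zero_smul])
  have e := (h.2 _ v hbw hv hc).symm.trans (h'.2 _ v hbw hv hc)
  rw [← sub_eq_zero, HermitianMetric.l2inner, HermitianMetric.l2inner,
    ← integral_sub (integrable_inner g hbw (h.1 v hv) hc)
      (integrable_inner g hbw (h'.1 v hv) hc)] at e
  have hself : ∀ x, g.inner x ((Q v - Q' v) x) ((Q v - Q' v) x) =
      ((g.inner x ((Q v - Q' v) x) ((Q v - Q' v) x)).re : ℂ) ∧
      0 ≤ (g.inner x ((Q v - Q' v) x) ((Q v - Q' v) x)).re := fun x => by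
    obtain ⟨r, hr0, hr, -⟩ := innerP_self (coGram_posDef g x) ((Q v - Q' v) x)
    rw [inner_eq, hr, Complex.ofReal_re]
    exact ⟨rfl, hr0⟩
  set F : X → ℝ := fun x => b x * (g.inner x ((Q v - Q' v) x) ((Q v - Q' v) x)).re with hF
  have e2 : ∫ x, (F x : ℂ) ∂g.vol = 0 := by
    rw [← e]
    refine integral_congr_ae (Filter.Eventually.of_forall fun x => ?_)
    simp only [hF, Complex.ofReal_mul]
    rw [← (hself x).1]
    simp only [inner_eq, map_smul, LinearMap.smul_apply, Pi.sub_apply, map_sub, smul_eq_mul,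
      LinearMap.sub_apply]
    ring
  rw [integral_complex_ofReal, Complex.ofReal_eq_zero] at e2
  have hFc : Continuous F := b.contMDiff.continuous.mul
    (Complex.continuous_re.comp (continuous_inner g hw hw))
  have hFs : HasCompactSupport F := b.hasCompactSupport.mul_right
  have hF0 : F x₀ = 0 := by
    by_contra hne
    exact (hFc.integral_pos_of_hasCompactSupport_nonneg_nonzero hFs
      (fun x => mul_nonneg b.nonneg (hself x).2) hne).ne' e2
  have hre : (g.inner x₀ ((Q v - Q' v) x₀) ((Q v - Q' v) x₀)).re = 0 := by
    rw [hF] at hF0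
    simpa [b.eq_one] using hF0
  have hz := (hself x₀).1
  rw [hre, Complex.ofReal_zero, inner_eq] at hz
  exact eq_zero_of_innerP (coGram_posDef g x₀) hz

theorem formalAdjoint_eq {P Q : Op n X} (h : IsFormalAdjoint g P Q) {v : Form n X}
    (hv : IsSmoothForm v) : formalAdjoint g P v = Q v :=
  isFormalAdjoint_unique g (formalAdjoint_spec g h) h hv

variable [SecondCountableTopology X]

/-- The formal adjoint of the exterior derivative. -/
theorem l2inner_extD {u v : Form n X} (hu : IsSmoothForm u) (hv : IsSmoothForm v)
    (hc : HasCompactSupport u) : g.l2inner (extD u) v = g.l2inner u (cod g v) := by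
  have := isManifold_real n X
  have : LocallyCompactSpace X := ChartedSpace.locallyCompactSpace (Model n) X
  -- Only finitely many members of the partition meet the compact support of `u`, so `u` is a finite
  -- sum of forms each supported in one chart domain.
  obtain ⟨ρ, hρ⟩ := SmoothPartitionOfUnity.exists_isSubordinate_chartAt_source 𝓘(ℝ, Model n) X
  have hfin := ρ.locallyFinite.finite_nonempty_inter_compact hc.isCompact
  have hsum : u = ∑ i ∈ hfin.toFinset, fun x => (ρ i x : ℂ) • u x := by
    funext x
    rw [Finset.sum_apply, ← Finset.sum_smul]
    by_cases hx : x ∈ tsupport u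
    · have h1 := ρ.sum_eq_one (Set.mem_univ x)
      rw [finsum_eq_sum_of_support_subset (s := hfin.toFinset)] at h1
      · have h2 : ∑ i ∈ hfin.toFinset, (ρ i x : ℂ) = 1 := by exact_mod_cast h1
        rw [h2, one_smul]
      · intro i hi
        rw [Set.Finite.coe_toFinset]
        exact ⟨x, hi, hx⟩
    · rw [image_eq_zero_of_notMem_tsupport hx, smul_zero]
  -- Smoothness and compact support are carried through the induction, since the additivity of both
  -- sides needs them for differentiability and integrability.
  have key : IsSmoothForm u ∧ HasCompactSupport u ∧
      g.l2inner (extD u) v = g.l2inner u (cod g v) := by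
    rw [hsum]
    refine Finset.sum_induction _ (fun u : Form n X => IsSmoothForm u ∧ HasCompactSupport u ∧
      g.l2inner (extD u) v = g.l2inner u (cod g v)) ?_ ?_ ?_
    · rintro u₁ u₂ ⟨s₁, c₁, e₁⟩ ⟨s₂, c₂, e₂⟩
      refine ⟨s₁.add s₂, c₁.add c₂, ?_⟩
      rw [extD_add s₁ s₂, l2inner_add_left g (isSmoothForm_extD s₁) (isSmoothForm_extD s₂) hv
        (hasCompactSupport_extD s₁ c₁) (hasCompactSupport_extD s₂ c₂),
        l2inner_add_left g s₁ s₂ (isSmoothForm_cod g hv) c₁ c₂, e₁, e₂]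
    · refine ⟨?_, HasCompactSupport.zero, ?_⟩
      · have h := hu.const_smul 0
        rwa [zero_smul] at h
      · rw [extD_zero]
        simp [HermitianMetric.l2inner, inner_eq]
    · intro i _
      have hs := hu.smulFn (smoothFn_of_contMDiff (ρ i).contMDiff)
      have hsup : HasCompactSupport fun x => (ρ i x : ℂ) • u x :=
        hc.mono fun x hx h => hx (by simp only; rw [h, smul_zero])
      refine ⟨hs, hsup, l2inner_extD_of_subset_chart g i hs hv hsup ?_⟩
      have hss : Function.support (fun x => (ρ i x : ℂ) • u x) ⊆ Function.support (ρ i) :=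
        fun x hx h => hx (by simp only; rw [h, Complex.ofReal_zero, zero_smul])
      exact (closure_mono hss).trans (hρ i)
  exact key.2.2

/-- The formal adjoint of `D_η`. -/
theorem isFormalAdjoint_twistedD {η : X → ℝ} (hη : SmoothFn n η) (h0 : ∀ x, η x ≠ 0) :
    IsFormalAdjoint g (twistedD η) (codEta g η) := by
  refine ⟨fun v hv => isSmoothForm_codEta g hη h0 hv, fun u v hu hv hc => ?_⟩
  have hθ : ∀ (a : X → ℝ) (u v : Form n X), g.l2inner (theta a u) v = g.l2inner u (theta a v) :=
    fun a u v => integral_congr_ae (Filter.Eventually.of_forall fun x => by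
      simp only [inner_eq]
      exact isAdj_thetaL (coGram_jInvariant g x) (a x) (u x) (v x))
  rw [twistedD, hθ, l2inner_extD g (hu.theta (hη.inv h0)) (hv.theta hη)
    (hasCompactSupport_theta _ hc), hθ]
  rfl

theorem laplacian_eq {η : X → ℝ} (hη : SmoothFn n η) (h0 : ∀ x, η x ≠ 0) {u : Form n X}
    (hu : IsSmoothForm u) : laplacian g η u =
      twistedD η (codEta g η u) + codEta g η (twistedD η u) := by
  have h := isFormalAdjoint_twistedD g hη h0
  rw [laplacian, bracket_neg, formalAdjoint_eq g h hu,
    formalAdjoint_eq g h (isSmoothForm_twistedD hη h0 hu)]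

theorem conj_laplacian_eq {η : X → ℝ} (hη : SmoothFn n η) (h0 : ∀ x, η x ≠ 0) {u : Form n X}
    (hu : IsSmoothForm u) : conjOp (laplacian g (-η)) u =
      conjOp (twistedD (-η)) (conjOp (codEta g (-η)) u) +
        conjOp (codEta g (-η)) (conjOp (twistedD (-η)) u) := by
  rw [conjOp, laplacian_eq g hη.neg (fun x => neg_ne_zero.2 (h0 x)) (isSmoothForm_conj hu),
    conjForm_add]
  simp only [conjOp, conjForm_conjForm]

end FormalAdjoint

end EtaBKN

end

end

/-! ### The proposition -/

theorem proposition3p6 (n : ℕ) (hn : 2 ≤ n) (X : Type*) [TopologicalSpace X] [T2Space X]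
    [SecondCountableTopology X] [ChartedSpace (Model n) X] [IsManifold 𝓘(ℂ, Model n) ω X]
    [MeasurableSpace X] [BorelSpace X] (g : HermitianMetric n X)
    (η : X → ℝ) (hη : ContMDiff 𝓘(ℝ, Model n) 𝓘(ℝ, ℝ) ∞ η) (hη0 : ∀ x, 0 < η x ∨ η x < 0) :
    -- the adjoints in the identity exist
    IsFormalAdjoint g (twistedD η) (formalAdjoint g (twistedD η)) ∧
    IsFormalAdjoint g (twistedD (-η)) (formalAdjoint g (twistedD (-η))) ∧
    IsPointwiseAdjoint g (wedgeOp g.omega) (lambdaOp g) ∧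
    IsPointwiseAdjoint g (tau g η) (pointwiseAdjoint g (tau g η)) ∧
    IsPointwiseAdjoint g (conjOp (tau g (-η))) (pointwiseAdjoint g (conjOp (tau g (-η)))) ∧
    -- the identity
    ∀ u : Form n X, IsSmoothForm u →
      laplacian g η u =
        (conjOp (laplacian g (-η))
          + Complex.I • bracket 2 (-2)
              (bracket 1 1 (twistedD η) (conjOp (twistedD (-η)))) (lambdaOp g)
          + bracket 1 (-1) (conjOp (twistedD (-η))) (pointwiseAdjoint g (conjOp (tau g (-η))))
          - bracket 1 (-1) (twistedD η) (pointwiseAdjoint g (tau g η))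
          + (n : ℂ) • bracket 1 (-1) (twistedD η) (mulFn η⁻¹
              (bracket 1 (-2) (wedgeOp (Complex.I • conjOp (dEta (-η)) (ofFunction η)))
                (lambdaOp g)))
          + (n : ℂ) • bracket 1 (-1) (conjOp (twistedD (-η))) (mulFn η⁻¹
              (bracket 1 (-2) (wedgeOp (Complex.I • dEta η (ofFunction η)))
                (lambdaOp g)))) u := by
  have hs := smoothFn_of_contMDiff hη
  have h0 : ∀ x, η x ≠ 0 := fun x => (hη0 x).elim ne_of_gt ne_of_lt
  have hneg : ∀ x, (-η) x ≠ 0 := fun x => neg_ne_zero.2 (h0 x)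
  refine ⟨formalAdjoint_spec g (isFormalAdjoint_twistedD g hs h0),
    formalAdjoint_spec g (isFormalAdjoint_twistedD g hs.neg hneg), isPointwiseAdjoint_lambdaOp g,
    (isPointwiseAdjoint_tau g hs h0).spec g, (isPointwiseAdjoint_tau g hs.neg hneg).conj.spec g,
    fun u hu => ?_⟩
  -- The Laplacians are defined with chosen formal adjoints; on smooth forms uniqueness identifies
  -- these with `codEta`, for which the identity is known.
  have h := bochnerKodairaNakano g hs h0 hu
  rw [← laplacian_eq g hs h0 hu, ← conj_laplacian_eq g hs h0 hu] at h
  exact h
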